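/- Consider complex-valued functions on the half-plane $\Omega=\{(x,y): x\ge 0,\ y\in\mathbb R\}$ with boundary $\Gamma=\{x=0\}$, and the problem $$u_{tt}=u_{xx}+u_{yy}+F\quad (x\ge 0,\ t\ge 0),\qquad u=u_t=0\ \text{ at } t=0,$$ with one of the following boundary conditions at $x=0$: 2) $u_x=ib\,u_y+g$ with $b$ real, $0<|b|<1$; 3) $u_x=g$; 4) $u_x=b\,u_y+g$ with $b$ real, $b\ne 0$. Here $F=F(x,y,t)$ and $g=g(y,t)$ are smooth with compact support, and a solution $u$ is a $C^\infty$ function up to the boundary of $\{x\ge 0,\,t\ge 0\}$ with $u(\cdot,t)\in L^2(\Omega)$ for every $t\ge 0$. The problem is called *Boundary Stable* if there are constants $\eta_0>0$, $K>0$, $\alpha>0$ such that for all $g$, all solutions $u$ with $F=0$, all $\eta\ge\eta_0$ and all $T\ge 0$, $$\int_0^T e^{-2\eta t}\|u(\cdot,t)\|^2_{L^2(\Gamma)}\,dt\le\frac{K}{\eta^\alpha}\int_0^T e^{-2\eta t}\|g(\cdot,t)\|^2_{L^2(\Gamma)}\,dt .$$ It satisfies the *interior estimate* if there are constants $\eta_0\ge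 0$, $K>0$, $\alpha>0$ such that for all $F$, all solutions $u$ with $g=0$, all $\eta\ge\eta_0$ with $\eta>0$ and all $T\ge 0$, $$\int_0^T e^{-2\eta t}\Bigl(\|u(\cdot,t)\|^2_{H^1(\Omega)}+\|u_t(\cdot,t)\|^2_{L^2(\Omega)}+\|u(\cdot,t)\|^2_{L^2(\Gamma)}\Bigr)dt\le\frac{K}{\eta^\alpha}\int_0^T e^{-2\eta t}\|F(\cdot,t)\|^2_{L^2(\Omega)}\,dt .$$ The problem is called *Stable* if it is Boundary Stable and satisfies the interior estimate, and *Unstable* if the interior estimate does not hold. **Theorem.** For boundary condition 2), for every real $b$ with $0<|b|<1$, and for boundary condition 3), the problem is Stable. For boundary condition 4), for every real $b\ne 0$, the problem is Unstable (in particular, not Stable). -/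

import Mathlib

open MeasureTheory Set
open scoped ContDiff ENNReal

noncomputable section

namespace HalfPlaneWave

/-! Complex functions `u x y t` on the half plane `x ≥ 0`, `y ∈ ℝ`, at times `t ≥ 0`.  A function that is
smooth up to the boundary of this region is represented by a smooth function on all of `ℝ³`; only its
values and derivatives at points with `x ≥ 0`, `t ≥ 0` enter the equations and the norms below. -/

/-- The partial derivative `u_x`. -/
def dx (u : ℝ → ℝ → ℝ → ℂ) (x y t : ℝ) : ℂ := deriv (fun x' => u x' y t) x

/-- The partial derivative `u_y`. -/
def dy (u : ℝ → ℝ → ℝ → ℂ) (x y t : ℝ) : ℂ := deriv (fun y' => u x y' t) y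

/-- The partial derivative `u_t`. -/
def dt (u : ℝ → ℝ → ℝ → ℂ) (x y t : ℝ) : ℂ := deriv (fun t' => u x y t') t

/-- The spatial domain `Ω = {(x, y) : x ≥ 0}`. -/
def domain : Set (ℝ × ℝ) := {p | 0 ≤ p.1}

/-- `u` is a smooth solution, in `L²(Ω)` at every fixed time `t ≥ 0`, of the problem
`u_tt = u_xx + u_yy + F` for `x ≥ 0`, `t ≥ 0`, with boundary condition `u_x = β u_y + g` at `x = 0`
and homogeneous initial data `u = u_t = 0` at `t = 0`. -/
structure IsSolution (β : ℂ) (F : ℝ → ℝ → ℝ → ℂ) (g : ℝ → ℝ → ℂ) (u : ℝ → ℝ → ℝ → ℂ) : Prop where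
  smooth : ContDiff ℝ ∞ (fun p : ℝ × ℝ × ℝ => u p.1 p.2.1 p.2.2)
  memL2 : ∀ t : ℝ, 0 ≤ t → MemLp (fun p : ℝ × ℝ => u p.1 p.2 t) 2 (volume.restrict domain)
  equation : ∀ x y t : ℝ, 0 ≤ x → 0 ≤ t →
    dt (dt u) x y t = dx (dx u) x y t + dy (dy u) x y t + F x y t
  boundary : ∀ y t : ℝ, 0 ≤ t → dx u 0 y t = β * dy u 0 y t + g y t
  initial : ∀ x y : ℝ, 0 ≤ x → u x y 0 = 0
  initial_dt : ∀ x y : ℝ, 0 ≤ x → dt u x y 0 = 0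

/-- Admissible sources: smooth with compact support in space-time (the support may meet `x = 0`). -/
def IsSource (F : ℝ → ℝ → ℝ → ℂ) : Prop :=
  ContDiff ℝ ∞ (fun p : ℝ × ℝ × ℝ => F p.1 p.2.1 p.2.2) ∧
    HasCompactSupport (fun p : ℝ × ℝ × ℝ => F p.1 p.2.1 p.2.2)

/-- Admissible boundary data `g y t`: smooth with compact support. -/
def IsBoundaryData (g : ℝ → ℝ → ℂ) : Prop :=
  ContDiff ℝ ∞ (fun p : ℝ × ℝ => g p.1 p.2) ∧ HasCompactSupport (fun p : ℝ × ℝ => g p.1 p.2)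

/-- `‖v(·,t)‖²` in `L²(Ω)`, as an extended nonnegative number. -/
def sqNormL2 (v : ℝ → ℝ → ℝ → ℂ) (t : ℝ) : ℝ≥0∞ := ∫⁻ p in domain, ‖v p.1 p.2 t‖ₑ ^ 2

/-- `‖v(·,t)‖²` in `H¹(Ω)`. -/
def sqNormH1 (v : ℝ → ℝ → ℝ → ℂ) (t : ℝ) : ℝ≥0∞ :=
  sqNormL2 v t + sqNormL2 (dx v) t + sqNormL2 (dy v) t

/-- `‖h(·,t)‖²` in `L²(Γ)`, where `Γ = {x = 0}` is parametrised by `y ∈ ℝ`. -/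
def sqNormBdry (h : ℝ → ℝ → ℂ) (t : ℝ) : ℝ≥0∞ := ∫⁻ y, ‖h y t‖ₑ ^ 2

/-- The weighted time integral `∫₀ᵀ e^{-2ηt} N(t) dt`. -/
def weightedInt (η T : ℝ) (N : ℝ → ℝ≥0∞) : ℝ≥0∞ :=
  ∫⁻ t in Icc 0 T, ENNReal.ofReal (Real.exp (-2 * η * t)) * N t

/-- Boundary stability (case `F = 0`): with constants independent of `g`,
`∫₀ᵀ e^{-2ηt} ‖u‖²_{L²(Γ)} dt ≤ K η^{-α} ∫₀ᵀ e^{-2ηt} ‖g‖²_{L²(Γ)} dt` for all `η ≥ η₀`, `T ≥ 0`. -/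
def BoundaryStable (β : ℂ) : Prop :=
  ∃ η₀ K α : ℝ, 0 < η₀ ∧ 0 < K ∧ 0 < α ∧
    ∀ (g : ℝ → ℝ → ℂ) (u : ℝ → ℝ → ℝ → ℂ), IsBoundaryData g →
      IsSolution β (fun _ _ _ => 0) g u →
      ∀ η T : ℝ, η₀ ≤ η → 0 ≤ T →
        weightedInt η T (sqNormBdry (u 0)) ≤
          ENNReal.ofReal (K / η ^ α) * weightedInt η T (sqNormBdry g)

/-- The interior estimate (case `g = 0`): with constants independent of `F`,
`∫₀ᵀ e^{-2ηt} (‖u‖²_{H¹(Ω)} + ‖u_t‖²_{L²(Ω)} + ‖u‖²_{L²(Γ)}) dt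
  ≤ K η^{-α} ∫₀ᵀ e^{-2ηt} ‖F‖²_{L²(Ω)} dt` for all `η ≥ η₀` (`η > 0`) and `T ≥ 0`. -/
def InteriorEstimate (β : ℂ) : Prop :=
  ∃ η₀ K α : ℝ, 0 ≤ η₀ ∧ 0 < K ∧ 0 < α ∧
    ∀ F u : ℝ → ℝ → ℝ → ℂ, IsSource F →
      IsSolution β F (fun _ _ => 0) u →
      ∀ η T : ℝ, η₀ ≤ η → 0 < η → 0 ≤ T →
        weightedInt η T (fun t => sqNormH1 u t + sqNormL2 (dt u) t + sqNormBdry (u 0) t) ≤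
          ENNReal.ofReal (K / η ^ α) * weightedInt η T (sqNormL2 F)

/-- The problem is Stable: it is Boundary Stable and the interior estimate holds. -/
def Stable (β : ℂ) : Prop := BoundaryStable β ∧ InteriorEstimate β

/-- The problem is Unstable: the interior estimate does not hold. -/
def Unstable (β : ℂ) : Prop := ¬ InteriorEstimate β

end HalfPlaneWave

end

namespace HalfPlaneWave

/-! All positive estimates come from balance laws e_t = f_x + h_y + s with e ≥ 0 and |f|, |h| ≤ C e.
Multiply by e^{-2ηt} and by a cutoff whose support shrinks at speed C. The terms in which
derivatives fall on the cutoff then have a favourable sign, so 2η∫e plus the flux f through x = 0 is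
bounded by ∫s without any control at infinity (`weighted_balance`, and `weighted_balance_line` for
laws on the boundary line). Letting the cutoff grow gives the stated norms.

Interior estimate, u_x = ib u_y: the density ½(|u_t|² + |u_x|² + |u_y|²) + b Re⟨i u_x, u_y⟩ is
positive definite exactly when |b| < 1. Its flux in x is Re⟨u_t, u_x - ib u_y⟩, which vanishes at
the boundary (`energy_estimate`). The law with |u|² as both density and flux then controls u and its
trace by first derivatives (`trace_estimate`).

Boundary stability: p = u_x - ib u_y solves the wave equation with zero initial data and trace g. A
potential z with z_t - z_x = p_y and z_y = p_t + p_x satisfies ½(|p|² + |z|²)_t = ½(|z|² - |p|²)_x +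
Re⟨p, z⟩_y, so the trace of z is bounded by that of p (`conjOp_trace_estimate`). With c² = 1 - b²
and w = z + ib p, the wave equation becomes (u_t + p)_t = c² u_yy + w_y. Hence some V gives the
symmetric hyperbolic system u_t = c V_y - p, V_t = c u_y + w/c. On the line x = 0 it is forced only
by the traces of p and z, and its energy estimate gains the factor η^{-2} (`boundary_estimate`).
Condition 3) is the case b = 0.

Instability, u_x = b u_y: with k = 1/b and τ² = 1 + k², the plane wave e^{iμ(x + ky - τt)} solves
both the wave equation and the boundary condition and travels into the domain from the boundary. For
an amplitude A, u_t has size μτ|A|, whereas the source is -2iμ times the derivative of A along the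
rays, up to terms bounded in μ. As μ → ∞ an interior estimate would bound A by its ray derivative
(`ray_estimate_of_interiorEstimate`). An amplitude constant along the rays on the slab considered
violates the boundary condition A_x = b A_y, but a layer of width δ repairs this at a cost O(δ) in
squared norm. Letting δ → 0 gives a contradiction (`unstable_of_ne_zero`). -/

/-- A function of `x, y, t` as a function on the product. -/
abbrev unc {E : Type*} (u : ℝ → ℝ → ℝ → E) : ℝ × ℝ × ℝ → E := fun p => u p.1 p.2.1 p.2.2

/-! ### Partial derivatives of smooth functions of three variables. -/

lemma hasDerivAt_dx_fderiv {u : ℝ → ℝ → ℝ → ℂ} (h : ContDiff ℝ 1 (unc u)) (x y t : ℝ) :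
    HasDerivAt (fun x' => u x' y t) (fderiv ℝ (unc u) (x, y, t) (1, 0, 0)) x := by
  have h1 := (h.differentiable one_ne_zero (x, y, t)).hasFDerivAt
  have h2 : HasDerivAt (fun x' : ℝ => ((x', y, t) : ℝ × ℝ × ℝ)) (1, 0, 0) x :=
    (hasDerivAt_id x).prodMk ((hasDerivAt_const x y).prodMk (hasDerivAt_const x t))
  exact h1.comp_hasDerivAt x h2

lemma hasDerivAt_dy_fderiv {u : ℝ → ℝ → ℝ → ℂ} (h : ContDiff ℝ 1 (unc u)) (x y t : ℝ) :
    HasDerivAt (fun y' => u x y' t) (fderiv ℝ (unc u) (x, y, t) (0, 1, 0)) y := by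
  have h1 := (h.differentiable one_ne_zero (x, y, t)).hasFDerivAt
  have h2 : HasDerivAt (fun y' : ℝ => ((x, y', t) : ℝ × ℝ × ℝ)) (0, 1, 0) y :=
    (hasDerivAt_const y x).prodMk ((hasDerivAt_id y).prodMk (hasDerivAt_const y t))
  exact h1.comp_hasDerivAt y h2

lemma hasDerivAt_dt_fderiv {u : ℝ → ℝ → ℝ → ℂ} (h : ContDiff ℝ 1 (unc u)) (x y t : ℝ) :
    HasDerivAt (fun t' => u x y t') (fderiv ℝ (unc u) (x, y, t) (0, 0, 1)) t := by
  have h1 := (h.differentiable one_ne_zero (x, y, t)).hasFDerivAt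
  have h2 : HasDerivAt (fun t' : ℝ => ((x, y, t') : ℝ × ℝ × ℝ)) (0, 0, 1) t :=
    (hasDerivAt_const t x).prodMk ((hasDerivAt_const t y).prodMk (hasDerivAt_id t))
  exact h1.comp_hasDerivAt t h2

lemma dx_eq_fderiv {u : ℝ → ℝ → ℝ → ℂ} (h : ContDiff ℝ 1 (unc u)) :
    unc (dx u) = fun p => fderiv ℝ (unc u) p (1, 0, 0) :=
  funext fun p => (hasDerivAt_dx_fderiv h p.1 p.2.1 p.2.2).deriv

lemma dy_eq_fderiv {u : ℝ → ℝ → ℝ → ℂ} (h : ContDiff ℝ 1 (unc u)) :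
    unc (dy u) = fun p => fderiv ℝ (unc u) p (0, 1, 0) :=
  funext fun p => (hasDerivAt_dy_fderiv h p.1 p.2.1 p.2.2).deriv

lemma dt_eq_fderiv {u : ℝ → ℝ → ℝ → ℂ} (h : ContDiff ℝ 1 (unc u)) :
    unc (dt u) = fun p => fderiv ℝ (unc u) p (0, 0, 1) :=
  funext fun p => (hasDerivAt_dt_fderiv h p.1 p.2.1 p.2.2).deriv

lemma hasDerivAt_dx {u : ℝ → ℝ → ℝ → ℂ} (h : ContDiff ℝ 1 (unc u)) (x y t : ℝ) :
    HasDerivAt (fun x' => u x' y t) (dx u x y t) x :=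
  (hasDerivAt_dx_fderiv h x y t).differentiableAt.hasDerivAt

lemma hasDerivAt_dy {u : ℝ → ℝ → ℝ → ℂ} (h : ContDiff ℝ 1 (unc u)) (x y t : ℝ) :
    HasDerivAt (fun y' => u x y' t) (dy u x y t) y :=
  (hasDerivAt_dy_fderiv h x y t).differentiableAt.hasDerivAt

lemma hasDerivAt_dt {u : ℝ → ℝ → ℝ → ℂ} (h : ContDiff ℝ 1 (unc u)) (x y t : ℝ) :
    HasDerivAt (fun t' => u x y t') (dt u x y t) t :=
  (hasDerivAt_dt_fderiv h x y t).differentiableAt.hasDerivAt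

lemma continuous_dx {u : ℝ → ℝ → ℝ → ℂ} (h : ContDiff ℝ 1 (unc u)) : Continuous (unc (dx u)) := by
  rw [dx_eq_fderiv h]
  exact (h.continuous_fderiv one_ne_zero).clm_apply continuous_const

lemma continuous_dy {u : ℝ → ℝ → ℝ → ℂ} (h : ContDiff ℝ 1 (unc u)) : Continuous (unc (dy u)) := by
  rw [dy_eq_fderiv h]
  exact (h.continuous_fderiv one_ne_zero).clm_apply continuous_const

lemma continuous_dt {u : ℝ → ℝ → ℝ → ℂ} (h : ContDiff ℝ 1 (unc u)) : Continuous (unc (dt u)) := by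
  rw [dt_eq_fderiv h]
  exact (h.continuous_fderiv one_ne_zero).clm_apply continuous_const

lemma contDiff_dx {u : ℝ → ℝ → ℝ → ℂ} (h : ContDiff ℝ ∞ (unc u)) : ContDiff ℝ ∞ (unc (dx u)) := by
  rw [dx_eq_fderiv (h.of_le (by simp))]
  exact (h.fderiv_right (m := ∞) (by simp)).clm_apply contDiff_const

lemma contDiff_dy {u : ℝ → ℝ → ℝ → ℂ} (h : ContDiff ℝ ∞ (unc u)) : ContDiff ℝ ∞ (unc (dy u)) := by
  rw [dy_eq_fderiv (h.of_le (by simp))]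
  exact (h.fderiv_right (m := ∞) (by simp)).clm_apply contDiff_const

lemma contDiff_dt {u : ℝ → ℝ → ℝ → ℂ} (h : ContDiff ℝ ∞ (unc u)) : ContDiff ℝ ∞ (unc (dt u)) := by
  rw [dt_eq_fderiv (h.of_le (by simp))]
  exact (h.fderiv_right (m := ∞) (by simp)).clm_apply contDiff_const

lemma fderiv_fderiv_apply {U : ℝ × ℝ × ℝ → ℂ} (h : ContDiff ℝ ∞ U) (p v w : ℝ × ℝ × ℝ) :
    fderiv ℝ (fun q => fderiv ℝ U q v) p w = fderiv ℝ (fderiv ℝ U) p w v := by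
  have h1 : DifferentiableAt ℝ (fderiv ℝ U) p :=
    (h.fderiv_right (m := ∞) (by simp)).differentiable (by simp) p
  rw [fderiv_clm_apply h1 (differentiableAt_const v)]
  simp

lemma fderiv_fderiv_comm {U : ℝ × ℝ × ℝ → ℂ} (h : ContDiff ℝ ∞ U) (p v w : ℝ × ℝ × ℝ) :
    fderiv ℝ (fun q => fderiv ℝ U q v) p w = fderiv ℝ (fun q => fderiv ℝ U q w) p v := by
  rw [fderiv_fderiv_apply h, fderiv_fderiv_apply h]
  exact (h.contDiffAt.isSymmSndFDerivAt (by
    rw [minSmoothness_of_isRCLikeNormedField]; exact ENat.LEInfty.out)).eq w v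

lemma dx_dy_comm {u : ℝ → ℝ → ℝ → ℂ} (h : ContDiff ℝ ∞ (unc u)) (x y t : ℝ) :
    dx (dy u) x y t = dy (dx u) x y t := by
  have h1 : ContDiff ℝ 1 (unc u) := h.of_le (by simp)
  have e1 := congrFun (dx_eq_fderiv ((contDiff_dy h).of_le (by simp))) (x, y, t)
  have e2 := congrFun (dy_eq_fderiv ((contDiff_dx h).of_le (by simp))) (x, y, t)
  rw [dy_eq_fderiv h1] at e1
  rw [dx_eq_fderiv h1] at e2
  exact e1.trans ((fderiv_fderiv_comm h _ _ _).trans e2.symm)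

lemma dx_dt_comm {u : ℝ → ℝ → ℝ → ℂ} (h : ContDiff ℝ ∞ (unc u)) (x y t : ℝ) :
    dx (dt u) x y t = dt (dx u) x y t := by
  have h1 : ContDiff ℝ 1 (unc u) := h.of_le (by simp)
  have e1 := congrFun (dx_eq_fderiv ((contDiff_dt h).of_le (by simp))) (x, y, t)
  have e2 := congrFun (dt_eq_fderiv ((contDiff_dx h).of_le (by simp))) (x, y, t)
  rw [dt_eq_fderiv h1] at e1
  rw [dx_eq_fderiv h1] at e2
  exact e1.trans ((fderiv_fderiv_comm h _ _ _).trans e2.symm)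

lemma dy_dt_comm {u : ℝ → ℝ → ℝ → ℂ} (h : ContDiff ℝ ∞ (unc u)) (x y t : ℝ) :
    dy (dt u) x y t = dt (dy u) x y t := by
  have h1 : ContDiff ℝ 1 (unc u) := h.of_le (by simp)
  have e1 := congrFun (dy_eq_fderiv ((contDiff_dt h).of_le (by simp))) (x, y, t)
  have e2 := congrFun (dt_eq_fderiv ((contDiff_dy h).of_le (by simp))) (x, y, t)
  rw [dt_eq_fderiv h1] at e1
  rw [dy_eq_fderiv h1] at e2
  exact e1.trans ((fderiv_fderiv_comm h _ _ _).trans e2.symm)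

/-- Functions differentiable at a point of `[0, ∞)` that agree on `[0, ∞)` have the same derivative
there. -/
lemma HasDerivAt.eq_of_eqOn_Ici {f g : ℝ → ℂ} {f' g' : ℂ} {x : ℝ} (hx : 0 ≤ x)
    (hf : HasDerivAt f f' x) (hg : HasDerivAt g g' x) (h : ∀ s, 0 ≤ s → f s = g s) : f' = g' := by
  have hu : UniqueDiffWithinAt ℝ (Ici (0 : ℝ)) x := uniqueDiffOn_Ici 0 x hx
  exact hu.eq_deriv _ (hf.hasDerivWithinAt.congr (fun s hs => (h s hs).symm) (h x hx).symm)
    hg.hasDerivWithinAt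

/-! ### Differentiation under the integral sign. -/

section ParametricIntegral

variable {E : Type*} [NormedAddCommGroup E] [NormedSpace ℝ E] [ProperSpace E]

/-- Since `E` is proper, the derivative is bounded on the compact product of a closed ball with the
unit interval, and this constant is the dominating function. -/
lemma hasFDerivAt_integral_of_contDiff {G : E × ℝ → ℂ} (hG : ContDiff ℝ 1 G) (p : E) :
    HasFDerivAt (fun q => ∫ s in (0 : ℝ)..1, G (q, s))
      (∫ s in (0 : ℝ)..1, (fderiv ℝ G (p, s)).comp (ContinuousLinearMap.inl ℝ E ℝ)) p := by
  have hc : Continuous fun q : E × ℝ => (fderiv ℝ G q).comp (ContinuousLinearMap.inl ℝ E ℝ) :=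
    (hG.continuous_fderiv one_ne_zero).clm_comp continuous_const
  have hK : IsCompact (Metric.closedBall p 1 ×ˢ Icc (0 : ℝ) 1) :=
    (isCompact_closedBall p 1).prod isCompact_Icc
  obtain ⟨C, hC⟩ := hK.exists_bound_of_continuousOn hc.continuousOn
  have hsec : ∀ q : E, Continuous fun s : ℝ => ((q, s) : E × ℝ) := fun q => by fun_prop
  refine intervalIntegral.hasFDerivAt_integral_of_dominated_of_fderiv_le
    (F := fun q s => G (q, s))
    (F' := fun q s => (fderiv ℝ G (q, s)).comp (ContinuousLinearMap.inl ℝ E ℝ))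
    (bound := fun _ => C) (Metric.closedBall_mem_nhds p one_pos) ?_ ?_ ?_ ?_ ?_ ?_
  · exact Filter.Eventually.of_forall fun q =>
      (hG.continuous.comp (hsec q)).aestronglyMeasurable
  · exact (hG.continuous.comp (hsec p)).intervalIntegrable _ _
  · exact (hc.comp (hsec p)).aestronglyMeasurable
  · refine Filter.Eventually.of_forall fun s hs q hq => hC (q, s) ⟨hq, ?_⟩
    rw [uIoc_of_le zero_le_one] at hs
    exact ⟨hs.1.le, hs.2⟩
  · exact intervalIntegrable_const
  · refine Filter.Eventually.of_forall fun s _ q _ => ?_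
    have h1 := (hG.differentiable one_ne_zero (q, s)).hasFDerivAt
    exact h1.comp q (hasFDerivAt_prodMk_left q s)

lemma contDiff_integral {G : E × ℝ → ℂ} (hG : ContDiff ℝ 1 G) :
    ContDiff ℝ 1 (fun q => ∫ s in (0 : ℝ)..1, G (q, s)) := by
  have hc : Continuous fun q : E × ℝ => (fderiv ℝ G q).comp (ContinuousLinearMap.inl ℝ E ℝ) :=
    (hG.continuous_fderiv one_ne_zero).clm_comp continuous_const
  refine contDiff_one_iff_fderiv.2
    ⟨fun p => (hasFDerivAt_integral_of_contDiff hG p).differentiableAt, ?_⟩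
  rw [funext fun p => (hasFDerivAt_integral_of_contDiff hG p).fderiv]
  exact intervalIntegral.continuous_parametric_intervalIntegral_of_continuous' hc 0 1

lemma fderiv_integral_apply {G : E × ℝ → ℂ} (hG : ContDiff ℝ 1 G) (p v : E) :
    fderiv ℝ (fun q => ∫ s in (0 : ℝ)..1, G (q, s)) p v =
      ∫ s in (0 : ℝ)..1, fderiv ℝ G (p, s) (v, 0) := by
  have hc : Continuous fun q : E × ℝ => (fderiv ℝ G q).comp (ContinuousLinearMap.inl ℝ E ℝ) :=
    (hG.continuous_fderiv one_ne_zero).clm_comp continuous_const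
  rw [(hasFDerivAt_integral_of_contDiff hG p).fderiv,
    ContinuousLinearMap.intervalIntegral_apply]
  · simp
  · exact (hc.comp (by fun_prop : Continuous fun s : ℝ => ((p, s) : E × ℝ))).intervalIntegrable _ _

end ParametricIntegral

/-! ### Transport equations solved along characteristics. -/

/-- The solution `w` of `w_t - θ w_x = v` with `w = 0` at `t = 0`. -/
noncomputable def transportInt (θ : ℝ) (v : ℝ → ℝ → ℝ → ℂ) (x y t : ℝ) : ℂ :=
  ∫ τ in (0 : ℝ)..t, v (x + θ * (t - τ)) y τ

/-- The integrand of `transportInt`, rescaled to the unit interval. -/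
noncomputable def transportIntegrand (θ : ℝ) (v : ℝ → ℝ → ℝ → ℂ) (q : (ℝ × ℝ × ℝ) × ℝ) : ℂ :=
  (q.1.2.2 : ℂ) * v (q.1.1 + θ * (q.1.2.2 - q.1.2.2 * q.2)) q.1.2.1 (q.1.2.2 * q.2)

/-- The substitution τ = ts fixes the interval of integration, so regularity in (x, y, t) reduces to
differentiating under the integral. -/
lemma unc_transportInt (θ : ℝ) (v : ℝ → ℝ → ℝ → ℂ) :
    unc (transportInt θ v) = fun p => ∫ s in (0 : ℝ)..1, transportIntegrand θ v (p, s) := by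
  funext p
  obtain ⟨x, y, t⟩ := p
  have h := intervalIntegral.smul_integral_comp_mul_left (a := 0) (b := 1)
    (fun τ => v (x + θ * (t - τ)) y τ) t
  simp only [mul_zero, mul_one] at h
  simp only [unc, transportInt, transportIntegrand, ← h, intervalIntegral.integral_const_mul]
  simp

lemma contDiff_transportIntegrand {θ : ℝ} {v : ℝ → ℝ → ℝ → ℂ} (hv : ContDiff ℝ 1 (unc v)) :
    ContDiff ℝ 1 (transportIntegrand θ v) := by
  have h1 : ContDiff ℝ 1 fun q : (ℝ × ℝ × ℝ) × ℝ =>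
      ((q.1.1 + θ * (q.1.2.2 - q.1.2.2 * q.2), q.1.2.1, q.1.2.2 * q.2) : ℝ × ℝ × ℝ) := by
    fun_prop
  have h2 : ContDiff ℝ 1 fun q : (ℝ × ℝ × ℝ) × ℝ => (q.1.2.2 : ℂ) :=
    Complex.ofRealCLM.contDiff.comp (by fun_prop)
  exact h2.mul (hv.comp h1)

lemma contDiff_transportInt {θ : ℝ} {v : ℝ → ℝ → ℝ → ℂ} (hv : ContDiff ℝ 1 (unc v)) :
    ContDiff ℝ 1 (unc (transportInt θ v)) := by
  rw [unc_transportInt]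
  exact contDiff_integral (contDiff_transportIntegrand hv)

lemma transportInt_zero (θ : ℝ) (v : ℝ → ℝ → ℝ → ℂ) (x y : ℝ) : transportInt θ v x y 0 = 0 := by
  simp [transportInt]

lemma dy_transportInt {θ : ℝ} {v : ℝ → ℝ → ℝ → ℂ} (hv : ContDiff ℝ 1 (unc v)) (x y t : ℝ) :
    dy (transportInt θ v) x y t = transportInt θ (dy v) x y t := by
  have hG := contDiff_transportIntegrand (θ := θ) hv
  have h1 := congrFun (dy_eq_fderiv (contDiff_transportInt (θ := θ) hv)) (x, y, t)
  have h2 := congrFun (unc_transportInt θ (dy v)) (x, y, t)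
  refine h1.trans (Eq.trans ?_ h2.symm)
  rw [unc_transportInt]
  refine (fderiv_integral_apply hG (x, y, t) (0, 1, 0)).trans ?_
  congr 1
  funext s
  have h3 := (hG.differentiable one_ne_zero ((x, y, t), s)).hasFDerivAt
  have h4 : HasDerivAt (fun y' : ℝ => (((x, y', t), s) : (ℝ × ℝ × ℝ) × ℝ)) ((0, 1, 0), 0) y :=
    ((hasDerivAt_const y x).prodMk ((hasDerivAt_id y).prodMk (hasDerivAt_const y t))).prodMk
      (hasDerivAt_const y s)
  have h5 := h3.comp_hasDerivAt y h4
  have h6 := (hasDerivAt_dy hv (x + θ * (t - t * s)) y (t * s)).const_mul (t : ℂ)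
  exact h5.unique h6

/-- The derivative of a `C¹` function along the characteristic through `(x, y, t)`. -/
lemma hasDerivAt_characteristic {u : ℝ → ℝ → ℝ → ℂ} (hu : ContDiff ℝ 1 (unc u)) (θ x y t s : ℝ) :
    HasDerivAt (fun τ => u (x + θ * (t - τ)) y τ)
      (dt u (x + θ * (t - s)) y s - θ * dx u (x + θ * (t - s)) y s) s := by
  have h1 := (hu.differentiable one_ne_zero (x + θ * (t - s), y, s)).hasFDerivAt
  have h0 : HasDerivAt (fun τ : ℝ => x + θ * (t - τ)) (-θ) s := by
    have := (((hasDerivAt_id s).const_sub t).const_mul θ).const_add x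
    simpa using this
  have h2 : HasDerivAt (fun τ : ℝ => ((x + θ * (t - τ), y, τ) : ℝ × ℝ × ℝ)) (-θ, 0, 1) s :=
    h0.prodMk ((hasDerivAt_const s y).prodMk (hasDerivAt_id s))
  have h3 := h1.comp_hasDerivAt s h2
  have e1 := congrFun (dx_eq_fderiv hu) (x + θ * (t - s), y, s)
  have e2 := congrFun (dt_eq_fderiv hu) (x + θ * (t - s), y, s)
  simp only [unc] at e1 e2
  have e3 : ((-θ, 0, 1) : ℝ × ℝ × ℝ) = (0, 0, 1) - θ • (1, 0, 0) := by ext <;> simp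
  rw [e3, map_sub, map_smul, Complex.real_smul] at h3
  rw [e1, e2]
  exact h3

/-- Along the characteristic through (x, y, t) the integrand no longer depends on the moving point;
only the upper limit moves, and the fundamental theorem of calculus applies. -/
lemma dt_sub_dx_transportInt {θ : ℝ} {v : ℝ → ℝ → ℝ → ℂ} (hv : ContDiff ℝ 1 (unc v))
    (x y t : ℝ) :
    dt (transportInt θ v) x y t - θ * dx (transportInt θ v) x y t = v x y t := by
  have h1 := hasDerivAt_characteristic (contDiff_transportInt (θ := θ) hv) θ x y t t
  have h2 : (fun τ => transportInt θ v (x + θ * (t - τ)) y τ) =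
      fun τ => ∫ σ in (0 : ℝ)..τ, v (x + θ * (t - σ)) y σ := by
    funext τ
    simp only [transportInt]
    congr 1
    funext σ
    congr 1
    ring
  have hc : Continuous fun σ => v (x + θ * (t - σ)) y σ :=
    hv.continuous.comp (f := fun σ => ((x + θ * (t - σ), y, σ) : ℝ × ℝ × ℝ)) (by fun_prop)
  rw [h2] at h1
  have h3 := intervalIntegral.integral_hasDerivAt_right (hc.intervalIntegrable 0 t)
    hc.stronglyMeasurable.stronglyMeasurableAtFilter hc.continuousAt
  simpa using h1.unique h3

/-- Uniqueness for the transport problem. Since θ ≥ 0, the characteristic followed backwards from a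
point of the half plane stays in it until time 0, so the equation and the initial data are needed
only there. -/
lemma transportInt_eq {θ : ℝ} (hθ : 0 ≤ θ) {a v : ℝ → ℝ → ℝ → ℂ} (ha : ContDiff ℝ 1 (unc a))
    (hv : Continuous (unc v))
    (h : ∀ x y t : ℝ, 0 ≤ x → 0 ≤ t → dt a x y t - θ * dx a x y t = v x y t)
    (h0 : ∀ x y : ℝ, 0 ≤ x → a x y 0 = 0) {x y t : ℝ} (hx : 0 ≤ x) (ht : 0 ≤ t) :
    transportInt θ v x y t = a x y t := by
  have hc : Continuous fun σ => v (x + θ * (t - σ)) y σ :=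
    hv.comp (f := fun σ => ((x + θ * (t - σ), y, σ) : ℝ × ℝ × ℝ)) (by fun_prop)
  have h1 := intervalIntegral.integral_eq_sub_of_hasDerivAt (a := 0) (b := t)
    (f := fun τ => a (x + θ * (t - τ)) y τ) (f' := fun σ => v (x + θ * (t - σ)) y σ)
    (fun s hs => by
      rw [uIcc_of_le ht] at hs
      have hxs : 0 ≤ x + θ * (t - s) := by
        have := mul_nonneg hθ (sub_nonneg.2 hs.2)
        linarith
      have := hasDerivAt_characteristic ha θ x y t s
      rwa [h _ _ _ hxs hs.1] at this) (hc.intervalIntegrable _ _)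
  have h2 : a (x + θ * (t - 0)) y 0 = 0 :=
    h0 _ _ (by have := mul_nonneg hθ ht; rw [sub_zero]; linarith)
  rw [transportInt, h1, h2]
  simp

/-! ### The shrinking cutoff. -/

/-- A cutoff to `x ≤ R`, `|y| ≤ R` at time `0`, whose support shrinks at speed `C`. -/
noncomputable def cutoff (C R x y t : ℝ) : ℝ :=
  Real.smoothTransition (R - x - C * t) *
    (Real.smoothTransition (R - y - C * t) * Real.smoothTransition (R + y - C * t))

lemma continuous_cutoff (C R : ℝ) : Continuous (unc (cutoff C R)) := by
  have h := Real.smoothTransition.continuous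
  unfold unc cutoff
  fun_prop

lemma cutoff_nonneg (C R x y t : ℝ) : 0 ≤ cutoff C R x y t :=
  mul_nonneg (Real.smoothTransition.nonneg _)
    (mul_nonneg (Real.smoothTransition.nonneg _) (Real.smoothTransition.nonneg _))

lemma cutoff_le_one (C R x y t : ℝ) : cutoff C R x y t ≤ 1 :=
  mul_le_one₀ (Real.smoothTransition.le_one _)
    (mul_nonneg (Real.smoothTransition.nonneg _) (Real.smoothTransition.nonneg _))
    (mul_le_one₀ (Real.smoothTransition.le_one _) (Real.smoothTransition.nonneg _)
      (Real.smoothTransition.le_one _))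

lemma cutoff_eq_one {C R x y t : ℝ} (h1 : 1 ≤ R - x - C * t) (h2 : 1 ≤ R - y - C * t)
    (h3 : 1 ≤ R + y - C * t) : cutoff C R x y t = 1 := by
  simp [cutoff, Real.smoothTransition.one_of_one_le h1, Real.smoothTransition.one_of_one_le h2,
    Real.smoothTransition.one_of_one_le h3]

lemma cutoff_right {C R t : ℝ} (hC : 0 ≤ C) (ht : 0 ≤ t) (y : ℝ) : cutoff C R R y t = 0 := by
  have : R - R - C * t ≤ 0 := by have := mul_nonneg hC ht; linarith
  rw [cutoff, Real.smoothTransition.zero_of_nonpos this]; simp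

lemma cutoff_top {C R t : ℝ} (hC : 0 ≤ C) (ht : 0 ≤ t) (x : ℝ) : cutoff C R x R t = 0 := by
  have : R - R - C * t ≤ 0 := by have := mul_nonneg hC ht; linarith
  rw [cutoff, Real.smoothTransition.zero_of_nonpos this]; simp

lemma cutoff_bot {C R t : ℝ} (hC : 0 ≤ C) (ht : 0 ≤ t) (x : ℝ) : cutoff C R x (-R) t = 0 := by
  have : R + -R - C * t ≤ 0 := by have := mul_nonneg hC ht; linarith
  rw [cutoff, Real.smoothTransition.zero_of_nonpos this]; simp

lemma hasDerivAt_smoothTransition (s : ℝ) :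
    HasDerivAt Real.smoothTransition (deriv Real.smoothTransition s) s :=
  ((Real.smoothTransition.contDiff (n := 1)).differentiable one_ne_zero s).hasDerivAt

lemma continuous_deriv_smoothTransition : Continuous (deriv Real.smoothTransition) :=
  (Real.smoothTransition.contDiff (n := 1)).continuous_deriv le_rfl

lemma deriv_smoothTransition_nonneg (s : ℝ) : 0 ≤ deriv Real.smoothTransition s :=
  Real.smoothTransition.monotone.deriv_nonneg

/-- Minus the `x` derivative of the cutoff. -/
noncomputable def cutoffRight (C R x y t : ℝ) : ℝ :=
  deriv Real.smoothTransition (R - x - C * t) *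
    (Real.smoothTransition (R - y - C * t) * Real.smoothTransition (R + y - C * t))

/-- The part of minus the `y` derivative of the cutoff due to its upper edge. -/
noncomputable def cutoffTop (C R x y t : ℝ) : ℝ :=
  Real.smoothTransition (R - x - C * t) *
    (deriv Real.smoothTransition (R - y - C * t) * Real.smoothTransition (R + y - C * t))

/-- The part of the `y` derivative of the cutoff due to its lower edge. -/
noncomputable def cutoffBot (C R x y t : ℝ) : ℝ :=
  Real.smoothTransition (R - x - C * t) *
    (Real.smoothTransition (R - y - C * t) * deriv Real.smoothTransition (R + y - C * t))

lemma continuous_cutoffRight (C R : ℝ) : Continuous (unc (cutoffRight C R)) := by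
  have h := Real.smoothTransition.continuous
  have h' := continuous_deriv_smoothTransition
  unfold unc cutoffRight
  fun_prop

lemma continuous_cutoffTop (C R : ℝ) : Continuous (unc (cutoffTop C R)) := by
  have h := Real.smoothTransition.continuous
  have h' := continuous_deriv_smoothTransition
  unfold unc cutoffTop
  fun_prop

lemma continuous_cutoffBot (C R : ℝ) : Continuous (unc (cutoffBot C R)) := by
  have h := Real.smoothTransition.continuous
  have h' := continuous_deriv_smoothTransition
  unfold unc cutoffBot
  fun_prop

lemma cutoffRight_nonneg (C R x y t : ℝ) : 0 ≤ cutoffRight C R x y t :=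
  mul_nonneg (deriv_smoothTransition_nonneg _)
    (mul_nonneg (Real.smoothTransition.nonneg _) (Real.smoothTransition.nonneg _))

lemma cutoffTop_nonneg (C R x y t : ℝ) : 0 ≤ cutoffTop C R x y t :=
  mul_nonneg (Real.smoothTransition.nonneg _)
    (mul_nonneg (deriv_smoothTransition_nonneg _) (Real.smoothTransition.nonneg _))

lemma cutoffBot_nonneg (C R x y t : ℝ) : 0 ≤ cutoffBot C R x y t :=
  mul_nonneg (Real.smoothTransition.nonneg _)
    (mul_nonneg (Real.smoothTransition.nonneg _) (deriv_smoothTransition_nonneg _))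

lemma hasDerivAt_cutoff_x (C R x y t : ℝ) :
    HasDerivAt (fun x' => cutoff C R x' y t) (-cutoffRight C R x y t) x := by
  have h : HasDerivAt (fun x' : ℝ => R - x' - C * t) (-1) x := by
    simpa using ((hasDerivAt_id x).const_sub R).sub_const (C * t)
  have h1 := ((hasDerivAt_smoothTransition _).comp x h).mul_const
    (Real.smoothTransition (R - y - C * t) * Real.smoothTransition (R + y - C * t))
  refine h1.congr_deriv ?_
  simp only [cutoffRight]
  ring

lemma hasDerivAt_cutoff_y (C R x y t : ℝ) :
    HasDerivAt (fun y' => cutoff C R x y' t) (cutoffBot C R x y t - cutoffTop C R x y t) y := by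
  have h2 : HasDerivAt (fun y' : ℝ => R - y' - C * t) (-1) y := by
    simpa using ((hasDerivAt_id y).const_sub R).sub_const (C * t)
  have h3 : HasDerivAt (fun y' : ℝ => R + y' - C * t) 1 y := by
    simpa using ((hasDerivAt_id y).const_add R).sub_const (C * t)
  have h1 := (((hasDerivAt_smoothTransition _).comp y h2).mul
    ((hasDerivAt_smoothTransition _).comp y h3)).const_mul (Real.smoothTransition (R - x - C * t))
  refine h1.congr_deriv ?_
  simp only [cutoffBot, cutoffTop, Function.comp_apply]
  ring

/-- Each of the three edges moves inwards at speed C, so the time derivative is -C times the sum of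
the edge terms. This is what absorbs the fluxes through those edges. -/
lemma hasDerivAt_cutoff_t (C R x y t : ℝ) :
    HasDerivAt (fun t' => cutoff C R x y t')
      (-C * (cutoffRight C R x y t + cutoffTop C R x y t + cutoffBot C R x y t)) t := by
  have h0 : ∀ a : ℝ, HasDerivAt (fun t' : ℝ => a - C * t') (-C) t := fun a => by
    simpa using ((hasDerivAt_id t).const_mul C).const_sub a
  have h1 := ((hasDerivAt_smoothTransition _).comp t (h0 (R - x))).mul
    (((hasDerivAt_smoothTransition _).comp t (h0 (R - y))).mul
    ((hasDerivAt_smoothTransition _).comp t (h0 (R + y))))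
  refine h1.congr_deriv ?_
  simp only [cutoffRight, cutoffBot, cutoffTop, Function.comp_apply, Pi.mul_apply]
  ring

/-! ### Weighted balance laws. -/

/-- The part of the boundary times time interval on which the cutoff lives. -/
def bdryBox (R T : ℝ) : Set (ℝ × ℝ) := Icc (-R) R ×ˢ Icc 0 T

/-- The part of space-time on which the cutoff lives. -/
def box (R T : ℝ) : Set (ℝ × ℝ × ℝ) := Icc 0 R ×ˢ bdryBox R T

lemma isCompact_bdryBox (R T : ℝ) : IsCompact (bdryBox R T) := isCompact_Icc.prod isCompact_Icc

lemma isCompact_box (R T : ℝ) : IsCompact (box R T) := isCompact_Icc.prod (isCompact_bdryBox R T)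

lemma measurableSet_bdryBox (R T : ℝ) : MeasurableSet (bdryBox R T) :=
  (isCompact_bdryBox R T).measurableSet

lemma measurableSet_box (R T : ℝ) : MeasurableSet (box R T) := (isCompact_box R T).measurableSet

lemma setIntegral_prod_symm {α β : Type*} [MeasurableSpace α] [MeasurableSpace β] {μ : Measure α}
    {ν : Measure β} [SFinite μ] [SFinite ν] {s : Set α} {t : Set β} (f : α × β → ℝ)
    (hf : IntegrableOn f (s ×ˢ t) (μ.prod ν)) :
    ∫ z in s ×ˢ t, f z ∂(μ.prod ν) = ∫ y in t, ∫ x in s, f (x, y) ∂μ ∂ν := by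
  rw [← Measure.prod_restrict]
  exact integral_prod_symm f (by rwa [Measure.prod_restrict])

lemma setIntegral_Icc_deriv {f f' : ℝ → ℝ} {a b : ℝ} (hab : a ≤ b)
    (h : ∀ s, HasDerivAt f (f' s) s) (hc : Continuous f') :
    ∫ s in Icc a b, f' s = f b - f a := by
  rw [integral_Icc_eq_integral_Ioc, ← intervalIntegral.integral_of_le hab]
  exact intervalIntegral.integral_eq_sub_of_hasDerivAt (fun s _ => h s) (hc.intervalIntegrable _ _)

/-- Integrating a' in t leaves the final value, which is nonnegative, because the initial one is
zero; integrating h' in y leaves nothing, because h vanishes at both ends. -/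
lemma setIntegral_bdryBox_deriv_nonneg {R T : ℝ} (hR : 0 ≤ R) (hT : 0 ≤ T)
    {a a' h h' : ℝ → ℝ → ℝ}
    (ca : Continuous fun q : ℝ × ℝ => a' q.1 q.2) (ch : Continuous fun q : ℝ × ℝ => h' q.1 q.2)
    (da : ∀ y t, HasDerivAt (fun s => a y s) (a' y t) t)
    (dh : ∀ y t, HasDerivAt (fun s => h s t) (h' y t) y)
    (a0 : ∀ y, a y 0 = 0) (aT : ∀ y, 0 ≤ a y T)
    (hl : ∀ t, 0 ≤ t → h (-R) t = 0) (hr : ∀ t, 0 ≤ t → h R t = 0) :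
    0 ≤ ∫ q in bdryBox R T, (a' q.1 q.2 - h' q.1 q.2) := by
  have ia := ca.continuousOn.integrableOn_compact (μ := volume) (isCompact_bdryBox R T)
  have ih := ch.continuousOn.integrableOn_compact (μ := volume) (isCompact_bdryBox R T)
  rw [integral_sub ia ih]
  have e1 : ∫ q in bdryBox R T, h' q.1 q.2 = 0 := by
    refine (setIntegral_prod_symm _ ih).trans ?_
    refine setIntegral_eq_zero_of_forall_eq_zero fun t ht => ?_
    have := setIntegral_Icc_deriv (a := -R) (b := R) (by linarith) (fun s => dh s t)
      (by fun_prop : Continuous fun s => h' s t)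
    exact this.trans (by rw [hr t ht.1, hl t ht.1, sub_zero])
  have e2 : 0 ≤ ∫ q in bdryBox R T, a' q.1 q.2 := by
    refine le_of_le_of_eq ?_ (setIntegral_prod _ ia).symm
    refine setIntegral_nonneg measurableSet_Icc fun y _ => ?_
    have := setIntegral_Icc_deriv (a := 0) (b := T) hT (fun s => da y s)
      (by fun_prop : Continuous fun s => a' y s)
    refine le_of_le_of_eq ?_ this.symm
    rw [a0, sub_zero]
    exact aT y
  linarith

/-- The weight `e^{-2ηt}` times the cutoff. -/
noncomputable def weight (η C R x y t : ℝ) : ℝ := Real.exp (-2 * η * t) * cutoff C R x y t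

lemma continuous_weight (η C R : ℝ) : Continuous (unc (weight η C R)) := by
  have := continuous_cutoff C R
  unfold unc weight
  exact (by fun_prop : Continuous fun p : ℝ × ℝ × ℝ => Real.exp (-2 * η * p.2.2)).mul this

lemma weight_nonneg (η C R x y t : ℝ) : 0 ≤ weight η C R x y t :=
  mul_nonneg (Real.exp_nonneg _) (cutoff_nonneg _ _ _ _ _)

lemma hasDerivAt_weight_mul_t {η C R x y t e' : ℝ} {e : ℝ → ℝ} (h : HasDerivAt e e' t) :
    HasDerivAt (fun s => weight η C R x y s * e s)
      (-2 * η * (weight η C R x y t * e t) + weight η C R x y t * e' -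
        Real.exp (-2 * η * t) * (C * (cutoffRight C R x y t + cutoffTop C R x y t +
          cutoffBot C R x y t)) * e t) t := by
  have h0 : HasDerivAt (fun s : ℝ => -2 * η * s) (-2 * η) t := by
    simpa using (hasDerivAt_id t).const_mul (-2 * η)
  refine ((h0.exp.mul (hasDerivAt_cutoff_t C R x y t)).mul h).congr_deriv ?_
  simp only [weight, Pi.mul_apply]
  ring

lemma hasDerivAt_weight_mul_y {η C R x y t h' : ℝ} {h : ℝ → ℝ} (hh : HasDerivAt h h' y) :
    HasDerivAt (fun s => weight η C R x s t * h s)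
      (weight η C R x y t * h' + Real.exp (-2 * η * t) *
        (cutoffBot C R x y t - cutoffTop C R x y t) * h y) y := by
  refine (((hasDerivAt_cutoff_y C R x y t).const_mul (Real.exp (-2 * η * t))).mul
    hh).congr_deriv ?_
  simp only [weight]
  ring

lemma hasDerivAt_weight_mul_x {η C R x y t f' : ℝ} {f : ℝ → ℝ} (hf : HasDerivAt f f' x) :
    HasDerivAt (fun s => weight η C R s y t * f s)
      (weight η C R x y t * f' - Real.exp (-2 * η * t) * cutoffRight C R x y t * f x) x := by
  refine (((hasDerivAt_cutoff_x C R x y t).const_mul (Real.exp (-2 * η * t))).mul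
    hf).congr_deriv ?_
  simp only [weight]
  ring

lemma integrableOn_box {f : ℝ × ℝ × ℝ → ℝ} (hf : Continuous f) (R T : ℝ) :
    IntegrableOn f (box R T) :=
  hf.continuousOn.integrableOn_compact (isCompact_box R T)

lemma integrableOn_bdryBox {f : ℝ × ℝ → ℝ} (hf : Continuous f) (R T : ℝ) :
    IntegrableOn f (bdryBox R T) :=
  hf.continuousOn.integrableOn_compact (isCompact_bdryBox R T)

/-- The weighted form of a balance law `e_t = h_y + s` on a line. -/
theorem weighted_balance_line {η C R T : ℝ} (hC : 0 ≤ C) (hR : 0 ≤ R) (hT : 0 ≤ T)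
    {e e' h h' s : ℝ → ℝ → ℝ}
    (ce : Continuous fun q : ℝ × ℝ => e q.1 q.2) (ce' : Continuous fun q : ℝ × ℝ => e' q.1 q.2)
    (ch : Continuous fun q : ℝ × ℝ => h q.1 q.2) (ch' : Continuous fun q : ℝ × ℝ => h' q.1 q.2)
    (cs : Continuous fun q : ℝ × ℝ => s q.1 q.2)
    (de : ∀ y t, HasDerivAt (fun r => e y r) (e' y t) t)
    (dh : ∀ y t, HasDerivAt (fun r => h r t) (h' y t) y)
    (law : ∀ y t, 0 ≤ t → e' y t = h' y t + s y t)
    (he : ∀ y t, 0 ≤ t → |h y t| ≤ C * e y t) (hpos : ∀ y t, 0 ≤ t → 0 ≤ e y t)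
    (e0 : ∀ y, e y 0 = 0) :
    2 * η * ∫ q in bdryBox R T, weight η C R 0 q.1 q.2 * e q.1 q.2 ≤
      ∫ q in bdryBox R T, weight η C R 0 q.1 q.2 * s q.1 q.2 := by
  have cslice : Continuous fun q : ℝ × ℝ => ((0, q.1, q.2) : ℝ × ℝ × ℝ) := by fun_prop
  have cw : Continuous fun q : ℝ × ℝ => weight η C R 0 q.1 q.2 :=
    (continuous_weight η C R).comp cslice
  have c1 : Continuous fun q : ℝ × ℝ => cutoffRight C R 0 q.1 q.2 :=
    (continuous_cutoffRight C R).comp cslice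
  have c2 : Continuous fun q : ℝ × ℝ => cutoffTop C R 0 q.1 q.2 :=
    (continuous_cutoffTop C R).comp cslice
  have c3 : Continuous fun q : ℝ × ℝ => cutoffBot C R 0 q.1 q.2 :=
    (continuous_cutoffBot C R).comp cslice
  have key := setIntegral_bdryBox_deriv_nonneg hR hT
    (a := fun y t => weight η C R 0 y t * e y t)
    (h := fun y t => weight η C R 0 y t * h y t)
    (a' := fun y t => -2 * η * (weight η C R 0 y t * e y t) + weight η C R 0 y t * e' y t -
        Real.exp (-2 * η * t) * (C * (cutoffRight C R 0 y t + cutoffTop C R 0 y t +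
          cutoffBot C R 0 y t)) * e y t)
    (h' := fun y t => weight η C R 0 y t * h' y t + Real.exp (-2 * η * t) *
        (cutoffBot C R 0 y t - cutoffTop C R 0 y t) * h y t)
    (by fun_prop) (by fun_prop) (fun y t => hasDerivAt_weight_mul_t (de y t))
    (fun y t => hasDerivAt_weight_mul_y (dh y t)) (fun y => by simp [e0])
    (fun y => mul_nonneg (weight_nonneg _ _ _ _ _ _) (hpos y T hT))
    (fun t ht => by simp [weight, cutoff_bot hC ht]) (fun t ht => by simp [weight, cutoff_top hC ht])
  -- The terms with derivatives of the cutoff add up to something nonpositive: the edge terms of the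
  -- time derivative carry the factor C e, which dominates |h|.
  have mono : ∫ q in bdryBox R T, (-2 * η * (weight η C R 0 q.1 q.2 * e q.1 q.2) +
        weight η C R 0 q.1 q.2 * e' q.1 q.2 -
        Real.exp (-2 * η * q.2) * (C * (cutoffRight C R 0 q.1 q.2 + cutoffTop C R 0 q.1 q.2 +
          cutoffBot C R 0 q.1 q.2)) * e q.1 q.2 - (weight η C R 0 q.1 q.2 * h' q.1 q.2 +
        Real.exp (-2 * η * q.2) *
        (cutoffBot C R 0 q.1 q.2 - cutoffTop C R 0 q.1 q.2) * h q.1 q.2)) ≤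
      ∫ q in bdryBox R T, (weight η C R 0 q.1 q.2 * s q.1 q.2 -
        2 * η * (weight η C R 0 q.1 q.2 * e q.1 q.2)) := by
    refine setIntegral_mono_on (integrableOn_bdryBox (by fun_prop) R T)
      (integrableOn_bdryBox (by fun_prop) R T) (measurableSet_bdryBox R T) ?_
    rintro ⟨y, t⟩ ⟨-, ht⟩
    have ht : 0 ≤ t := ht.1
    have hh := abs_le.1 (he y t ht)
    have p0 := (Real.exp_pos (-2 * η * t)).le
    -- The right edge has no flux to compensate on a line and has a good sign by itself; the top and
    -- bottom edges use the two halves of |h| ≤ C e.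
    have p1 := mul_nonneg (mul_nonneg (mul_nonneg p0 (cutoffRight_nonneg C R 0 y t)) hC)
      (hpos y t ht)
    have p2 := mul_nonneg (mul_nonneg p0 (cutoffTop_nonneg C R 0 y t))
      (sub_nonneg.2 hh.2)
    have p3 := mul_nonneg (mul_nonneg p0 (cutoffBot_nonneg C R 0 y t))
      (sub_nonneg.2 hh.1)
    simp only [law y t ht]
    linarith
  have total := key.trans mono
  rw [integral_sub (integrableOn_bdryBox (by fun_prop) R T)
    (integrableOn_bdryBox (by fun_prop) R T), integral_const_mul] at total
  linarith

/-- The weighted form of a balance law `e_t = f_x + h_y + s` on the half plane. -/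
theorem weighted_balance {η C R T : ℝ} (hC : 0 ≤ C) (hR : 0 ≤ R) (hT : 0 ≤ T)
    {e e' f f' h h' s : ℝ → ℝ → ℝ → ℝ}
    (ce : Continuous (unc e)) (ce' : Continuous (unc e')) (cf : Continuous (unc f))
    (cf' : Continuous (unc f')) (ch : Continuous (unc h)) (ch' : Continuous (unc h'))
    (cs : Continuous (unc s))
    (de : ∀ x y t, HasDerivAt (fun r => e x y r) (e' x y t) t)
    (df : ∀ x y t, HasDerivAt (fun r => f r y t) (f' x y t) x)
    (dh : ∀ x y t, HasDerivAt (fun r => h x r t) (h' x y t) y)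
    (law : ∀ x y t, 0 ≤ x → 0 ≤ t → e' x y t = f' x y t + h' x y t + s x y t)
    (fe : ∀ x y t, 0 ≤ x → 0 ≤ t → |f x y t| ≤ C * e x y t)
    (he : ∀ x y t, 0 ≤ x → 0 ≤ t → |h x y t| ≤ C * e x y t)
    (hpos : ∀ x y t, 0 ≤ x → 0 ≤ t → 0 ≤ e x y t)
    (e0 : ∀ x y, 0 ≤ x → e x y 0 = 0) :
    2 * η * (∫ p in box R T, weight η C R p.1 p.2.1 p.2.2 * e p.1 p.2.1 p.2.2) +
        ∫ q in bdryBox R T, weight η C R 0 q.1 q.2 * f 0 q.1 q.2 ≤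
      ∫ p in box R T, weight η C R p.1 p.2.1 p.2.2 * s p.1 p.2.1 p.2.2 := by
  have cw := continuous_weight η C R
  have c1 := continuous_cutoffRight C R
  have c2 := continuous_cutoffTop C R
  have c3 := continuous_cutoffBot C R
  have cexp : Continuous fun p : ℝ × ℝ × ℝ => Real.exp (-2 * η * p.2.2) := by fun_prop
  unfold unc at *
  have cA : Continuous fun p : ℝ × ℝ × ℝ =>
      -2 * η * (weight η C R p.1 p.2.1 p.2.2 * e p.1 p.2.1 p.2.2) +
        weight η C R p.1 p.2.1 p.2.2 * e' p.1 p.2.1 p.2.2 -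
        Real.exp (-2 * η * p.2.2) * (C * (cutoffRight C R p.1 p.2.1 p.2.2 +
          cutoffTop C R p.1 p.2.1 p.2.2 + cutoffBot C R p.1 p.2.1 p.2.2)) * e p.1 p.2.1 p.2.2 := by
    fun_prop
  have cH : Continuous fun p : ℝ × ℝ × ℝ => weight η C R p.1 p.2.1 p.2.2 * h' p.1 p.2.1 p.2.2 +
      Real.exp (-2 * η * p.2.2) *
      (cutoffBot C R p.1 p.2.1 p.2.2 - cutoffTop C R p.1 p.2.1 p.2.2) * h p.1 p.2.1 p.2.2 := by
    fun_prop
  have cF : Continuous fun p : ℝ × ℝ × ℝ => weight η C R p.1 p.2.1 p.2.2 * f' p.1 p.2.1 p.2.2 -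
      Real.exp (-2 * η * p.2.2) * cutoffRight C R p.1 p.2.1 p.2.2 * f p.1 p.2.1 p.2.2 := by
    fun_prop
  have key1 : 0 ≤ ∫ p in box R T, (-2 * η * (weight η C R p.1 p.2.1 p.2.2 * e p.1 p.2.1 p.2.2) +
        weight η C R p.1 p.2.1 p.2.2 * e' p.1 p.2.1 p.2.2 -
        Real.exp (-2 * η * p.2.2) * (C * (cutoffRight C R p.1 p.2.1 p.2.2 +
          cutoffTop C R p.1 p.2.1 p.2.2 + cutoffBot C R p.1 p.2.1 p.2.2)) * e p.1 p.2.1 p.2.2 -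
        (weight η C R p.1 p.2.1 p.2.2 * h' p.1 p.2.1 p.2.2 + Real.exp (-2 * η * p.2.2) *
        (cutoffBot C R p.1 p.2.1 p.2.2 - cutoffTop C R p.1 p.2.1 p.2.2) *
          h p.1 p.2.1 p.2.2)) := by
    refine le_of_le_of_eq ?_
      (setIntegral_prod _ (integrableOn_box (cA.sub cH) R T)).symm
    refine setIntegral_nonneg measurableSet_Icc fun x hx => ?_
    have cslice : Continuous fun q : ℝ × ℝ => ((x, q.1, q.2) : ℝ × ℝ × ℝ) := by fun_prop
    exact setIntegral_bdryBox_deriv_nonneg hR hT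
      (a := fun y t => weight η C R x y t * e x y t)
      (h := fun y t => weight η C R x y t * h x y t)
      (cA.comp cslice) (cH.comp cslice) (fun y t => hasDerivAt_weight_mul_t (de x y t))
      (fun y t => hasDerivAt_weight_mul_y (dh x y t)) (fun y => by simp [e0 x y hx.1])
      (fun y => mul_nonneg (weight_nonneg _ _ _ _ _ _) (hpos x y T hx.1 hT))
      (fun t ht => by simp [weight, cutoff_bot hC ht])
      (fun t ht => by simp [weight, cutoff_top hC ht])
  -- Integrating in x leaves only the flux at x = 0, since the cutoff vanishes at x = R.
  have key2 : ∫ p in box R T, (weight η C R p.1 p.2.1 p.2.2 * f' p.1 p.2.1 p.2.2 -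
      Real.exp (-2 * η * p.2.2) * cutoffRight C R p.1 p.2.1 p.2.2 * f p.1 p.2.1 p.2.2) =
      -∫ q in bdryBox R T, weight η C R 0 q.1 q.2 * f 0 q.1 q.2 := by
    refine (setIntegral_prod_symm _ (integrableOn_box cF R T)).trans ?_
    rw [← integral_neg]
    refine setIntegral_congr_fun (measurableSet_bdryBox R T) ?_
    rintro ⟨y, t⟩ ⟨-, ht⟩
    have := setIntegral_Icc_deriv (a := 0) (b := R) hR
      (fun x => hasDerivAt_weight_mul_x (η := η) (C := C) (R := R) (df x y t))
      (cF.comp (by fun_prop : Continuous fun x : ℝ => ((x, y, t) : ℝ × ℝ × ℝ)))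
    refine this.trans ?_
    simp [weight, cutoff_right hC ht.1]
  have mono : (∫ p in box R T, ((-2 * η * (weight η C R p.1 p.2.1 p.2.2 * e p.1 p.2.1 p.2.2) +
        weight η C R p.1 p.2.1 p.2.2 * e' p.1 p.2.1 p.2.2 -
        Real.exp (-2 * η * p.2.2) * (C * (cutoffRight C R p.1 p.2.1 p.2.2 +
          cutoffTop C R p.1 p.2.1 p.2.2 + cutoffBot C R p.1 p.2.1 p.2.2)) * e p.1 p.2.1 p.2.2 -
        (weight η C R p.1 p.2.1 p.2.2 * h' p.1 p.2.1 p.2.2 + Real.exp (-2 * η * p.2.2) *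
        (cutoffBot C R p.1 p.2.1 p.2.2 - cutoffTop C R p.1 p.2.1 p.2.2) *
          h p.1 p.2.1 p.2.2)) - (weight η C R p.1 p.2.1 p.2.2 * f' p.1 p.2.1 p.2.2 -
      Real.exp (-2 * η * p.2.2) * cutoffRight C R p.1 p.2.1 p.2.2 * f p.1 p.2.1 p.2.2))) ≤
      ∫ p in box R T, (weight η C R p.1 p.2.1 p.2.2 * s p.1 p.2.1 p.2.2 -
        2 * η * (weight η C R p.1 p.2.1 p.2.2 * e p.1 p.2.1 p.2.2)) := by
    refine setIntegral_mono_on (integrableOn_box ((cA.sub cH).sub cF) R T)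
      (integrableOn_box (by fun_prop) R T) (measurableSet_box R T) ?_
    rintro ⟨x, y, t⟩ ⟨hx, -, ht⟩
    have hx : 0 ≤ x := hx.1
    have ht : 0 ≤ t := ht.1
    have hf := abs_le.1 (fe x y t hx ht)
    have hh := abs_le.1 (he x y t hx ht)
    have p0 := (Real.exp_pos (-2 * η * t)).le
    have p1 := mul_nonneg (mul_nonneg p0 (cutoffRight_nonneg C R x y t)) (sub_nonneg.2 hf.2)
    have p2 := mul_nonneg (mul_nonneg p0 (cutoffTop_nonneg C R x y t)) (sub_nonneg.2 hh.2)
    have p3 := mul_nonneg (mul_nonneg p0 (cutoffBot_nonneg C R x y t)) (sub_nonneg.2 hh.1)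
    simp only [law x y t hx ht]
    linarith
  rw [integral_sub (integrableOn_box (by fun_prop) R T) (integrableOn_box cF R T), key2] at mono
  have total := (sub_le_sub_right key1 _).trans mono
  rw [integral_sub (integrableOn_box (by fun_prop) R T) (integrableOn_box (by fun_prop) R T),
    integral_const_mul] at total
  linarith

/-! ### Passage from cutoff integrals to the weighted norms. -/

/-- Removing a cutoff from a bound on integrals of a nonnegative function. -/
lemma setLIntegral_le_of_cutoff {α : Type*} [MeasurableSpace α] {μ : Measure α} {S : Set α}
    {B : ℝ → Set α} {w N : α → ℝ} {φ : ℝ → α → ℝ} {c : ℝ≥0∞}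
    (hmeas : ∀ R, MeasurableSet (B R)) (hmono : Monotone B) (hS : ⋃ n : ℕ, B n = S)
    (hw : ∀ a, 0 ≤ w a) (hN : ∀ a, 0 ≤ N a) (hφ : ∀ R a, 0 ≤ φ R a) (r : ℝ) (hr : 0 ≤ r)
    (hone : ∀ n : ℕ, ∀ a ∈ B n, φ (n + r) a = 1)
    (iN : ∀ R, IntegrableOn (fun a => w a * φ R a * N a) (B R) μ)
    (h : ∀ R, 0 ≤ R → ENNReal.ofReal (∫ a in B R, w a * φ R a * N a ∂μ) ≤ c) :
    ∫⁻ a in S, ENNReal.ofReal (w a) * ENNReal.ofReal (N a) ∂μ ≤ c := by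
  have hmono' : Monotone fun n : ℕ => B n := fun m n hmn => hmono (Nat.cast_le.2 hmn)
  rw [← hS, setLIntegral_iUnion_of_directed _ hmono'.directed_le]
  refine iSup_le fun n => ?_
  -- Enlarging the cutoff radius by r makes the cutoff identically one on the n-th set, so nothing
  -- is lost there.
  set R : ℝ := n + r with hR
  have hnR : (n : ℝ) ≤ R := by linarith
  have hR0 : 0 ≤ R := n.cast_nonneg.trans hnR
  calc ∫⁻ a in B n, ENNReal.ofReal (w a) * ENNReal.ofReal (N a) ∂μ
      = ∫⁻ a in B n, ENNReal.ofReal (w a * φ R a * N a) ∂μ := by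
        refine setLIntegral_congr_fun (hmeas n) fun a ha => ?_
        simp only [hR, hone n a ha, mul_one, ENNReal.ofReal_mul (hw a)]
    _ ≤ ∫⁻ a in B R, ENNReal.ofReal (w a * φ R a * N a) ∂μ := lintegral_mono_set (hmono hnR)
    _ = ENNReal.ofReal (∫ a in B R, w a * φ R a * N a ∂μ) :=
        (ofReal_integral_eq_lintegral_ofReal (iN R) (Filter.Eventually.of_forall fun a =>
          mul_nonneg (mul_nonneg (hw a) (hφ R a)) (hN a))).symm
    _ ≤ c := h R hR0

/-- The counterpart for right-hand sides: the cutoff is at most one and its box lies in the full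
region. -/
lemma ofReal_setIntegral_cutoff_le {α : Type*} [MeasurableSpace α] {μ : Measure α} {S : Set α}
    {B : ℝ → Set α} {w M : α → ℝ} {φ : ℝ → α → ℝ} (hmono : Monotone B) (hS : ⋃ n : ℕ, B n = S)
    (hw : ∀ a, 0 ≤ w a) (hM : ∀ a, 0 ≤ M a) (hφ : ∀ R a, 0 ≤ φ R a)
    (hφ1 : ∀ R a, φ R a ≤ 1) {R : ℝ}
    (iM : IntegrableOn (fun a => w a * φ R a * M a) (B R) μ) :
    ENNReal.ofReal (∫ a in B R, w a * φ R a * M a ∂μ) ≤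
      ∫⁻ a in S, ENNReal.ofReal (w a) * ENNReal.ofReal (M a) ∂μ := by
  have hRS : B R ⊆ S := by
    obtain ⟨m, hm⟩ := exists_nat_ge R
    exact (hmono hm).trans (hS ▸ subset_iUnion (fun n : ℕ => B n) m)
  rw [ofReal_integral_eq_lintegral_ofReal iM (Filter.Eventually.of_forall fun a =>
    mul_nonneg (mul_nonneg (hw a) (hφ R a)) (hM a))]
  refine le_trans (lintegral_mono fun a => ?_) (lintegral_mono_set hRS)
  rw [← ENNReal.ofReal_mul (hw a)]
  refine ENNReal.ofReal_le_ofReal (mul_le_mul_of_nonneg_right ?_ (hM a))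
  exact mul_le_of_le_one_right (hw a) (hφ1 R a)

lemma weightedInt_bdry (η T : ℝ) {N : ℝ × ℝ → ℝ≥0∞} (hN : Measurable N) :
    weightedInt η T (fun t => ∫⁻ y, N (y, t)) =
      ∫⁻ q in univ ×ˢ Icc 0 T, ENNReal.ofReal (Real.exp (-2 * η * q.2)) * N q := by
  have hw : Measurable fun q : ℝ × ℝ => ENNReal.ofReal (Real.exp (-2 * η * q.2)) := by fun_prop
  rw [Measure.volume_eq_prod, setLIntegral_prod_symm (fun q : ℝ × ℝ =>
    ENNReal.ofReal (Real.exp (-2 * η * q.2)) * N q) (hw.mul hN).aemeasurable]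
  refine lintegral_congr fun t => ?_
  rw [Measure.restrict_univ, ← lintegral_const_mul _ (by fun_prop)]

/-- The region `x ≥ 0`, `0 ≤ t ≤ T`. -/
def slab (T : ℝ) : Set (ℝ × ℝ × ℝ) := Ici 0 ×ˢ (univ ×ˢ Icc 0 T)

/-- Tonelli's theorem, after reassociating ((x, y), t) to (x, (y, t)). -/
lemma weightedInt_interior (η T : ℝ) {N : ℝ × ℝ × ℝ → ℝ≥0∞} (hN : Measurable N) :
    weightedInt η T (fun t => ∫⁻ p in domain, N (p.1, p.2, t)) =
      ∫⁻ p in slab T, ENNReal.ofReal (Real.exp (-2 * η * p.2.2)) * N p := by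
  have hw : Measurable fun q : ℝ × ℝ × ℝ =>
      ENNReal.ofReal (Real.exp (-2 * η * q.2.2)) * N q := by fun_prop
  have hassoc : MeasurePreserving (MeasurableEquiv.prodAssoc : (ℝ × ℝ) × ℝ ≃ᵐ ℝ × ℝ × ℝ) :=
    measurePreserving_prodAssoc volume volume volume
  have hpre : (MeasurableEquiv.prodAssoc : (ℝ × ℝ) × ℝ ≃ᵐ ℝ × ℝ × ℝ) ⁻¹' slab T =
      domain ×ˢ Icc 0 T := by
    ext ⟨⟨x, y⟩, t⟩
    simp [slab, domain, MeasurableEquiv.prodAssoc]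
  rw [← hassoc.setLIntegral_comp_preimage_emb (MeasurableEquiv.measurableEmbedding _), hpre,
    Measure.volume_eq_prod (ℝ × ℝ) ℝ,
    setLIntegral_prod_symm (fun a : (ℝ × ℝ) × ℝ => ENNReal.ofReal
      (Real.exp (-2 * η * (MeasurableEquiv.prodAssoc a).2.2)) * N (MeasurableEquiv.prodAssoc a))
      (hw.comp (MeasurableEquiv.measurable _)).aemeasurable]
  refine lintegral_congr fun t => ?_
  rw [← lintegral_const_mul _ (by fun_prop)]
  rfl

lemma monotone_bdryBox (T : ℝ) : Monotone fun R => bdryBox R T := fun _ _ h =>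
  prod_mono (Icc_subset_Icc (neg_le_neg h) h) subset_rfl

lemma monotone_box (T : ℝ) : Monotone fun R => box R T := fun _ _ h =>
  prod_mono (Icc_subset_Icc_right h) (monotone_bdryBox T h)

lemma iUnion_bdryBox (T : ℝ) : ⋃ n : ℕ, bdryBox n T = univ ×ˢ Icc 0 T := by
  ext ⟨y, t⟩
  simp only [bdryBox, mem_iUnion, mem_prod, mem_univ, true_and, exists_and_right,
    and_iff_right_iff_imp]
  intro _
  obtain ⟨n, hn⟩ := exists_nat_ge |y|
  exact ⟨n, abs_le.1 hn⟩

lemma iUnion_box (T : ℝ) : ⋃ n : ℕ, box n T = slab T := by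
  ext ⟨x, y, t⟩
  simp only [box, bdryBox, slab, mem_iUnion, mem_prod, mem_univ, true_and, mem_Ici]
  constructor
  · rintro ⟨n, hx, -, ht⟩
    exact ⟨hx.1, ht⟩
  · rintro ⟨hx, ht⟩
    obtain ⟨n, hn⟩ := exists_nat_ge (max x |y|)
    exact ⟨n, ⟨hx, (le_max_left _ _).trans hn⟩, abs_le.1 ((le_max_right _ _).trans hn), ht⟩

lemma cutoff_eq_one_of_mem_box {C T R : ℝ} (hC : 0 ≤ C) {p : ℝ × ℝ × ℝ}
    (hp : p ∈ box R T) : cutoff C (R + (1 + C * T)) p.1 p.2.1 p.2.2 = 1 := by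
  obtain ⟨⟨-, hx⟩, hy, -, ht⟩ := hp
  have := mul_le_mul_of_nonneg_left ht hC
  exact cutoff_eq_one (by linarith) (by linarith [hy.2]) (by linarith [hy.1])

lemma continuous_weight_bdry (η C R : ℝ) :
    Continuous fun q : ℝ × ℝ => weight η C R 0 q.1 q.2 := by
  have h := continuous_weight η C R
  unfold unc at h
  fun_prop

/-- It suffices to bound the cutoff integrals uniformly in R. The shift 1 + C T accounts for the
shrinking up to time T and for the unit width of the smooth transition. -/
lemma weightedInt_bdry_le {η C T : ℝ} (hC : 0 ≤ C) (hT : 0 ≤ T) {c : ℝ≥0∞}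
    {N : ℝ × ℝ → ℝ} (cN : Continuous N) (hN : ∀ q, 0 ≤ N q)
    (h : ∀ R, 0 ≤ R →
      ENNReal.ofReal (∫ q in bdryBox R T, weight η C R 0 q.1 q.2 * N q) ≤ c) :
    weightedInt η T (fun t => ∫⁻ y, ENNReal.ofReal (N (y, t))) ≤ c := by
  rw [weightedInt_bdry η T (N := fun q => ENNReal.ofReal (N q)) cN.measurable.ennreal_ofReal]
  refine setLIntegral_le_of_cutoff (B := fun R => bdryBox R T)
    (φ := fun R q => cutoff C R 0 q.1 q.2) (fun R => measurableSet_bdryBox R T)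
    (monotone_bdryBox T) (iUnion_bdryBox T) (fun _ => (Real.exp_pos _).le) hN
    (fun _ _ => cutoff_nonneg _ _ _ _ _) (1 + C * T)
    (by positivity) (fun n q hq => ?_)
    (fun R => integrableOn_bdryBox ((continuous_weight_bdry η C R).mul cN) R T) h
  exact cutoff_eq_one_of_mem_box (p := (0, q)) hC ⟨⟨le_rfl, n.cast_nonneg⟩, hq⟩

lemma le_weightedInt_bdry (η C T R : ℝ) {M : ℝ × ℝ → ℝ} (cM : Continuous M) (hM : ∀ q, 0 ≤ M q) :
    ENNReal.ofReal (∫ q in bdryBox R T, weight η C R 0 q.1 q.2 * M q) ≤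
      weightedInt η T (fun t => ∫⁻ y, ENNReal.ofReal (M (y, t))) := by
  rw [weightedInt_bdry η T (N := fun q => ENNReal.ofReal (M q)) cM.measurable.ennreal_ofReal]
  exact ofReal_setIntegral_cutoff_le (B := fun R => bdryBox R T)
    (φ := fun R q => cutoff C R 0 q.1 q.2) (monotone_bdryBox T) (iUnion_bdryBox T)
    (fun _ => (Real.exp_pos _).le) hM (fun _ _ => cutoff_nonneg _ _ _ _ _)
    (fun _ _ => cutoff_le_one _ _ _ _ _)
    (integrableOn_bdryBox ((continuous_weight_bdry η C R).mul cM) R T)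

lemma weightedInt_interior_le {η C T : ℝ} (hC : 0 ≤ C) (hT : 0 ≤ T) {c : ℝ≥0∞}
    {N : ℝ × ℝ × ℝ → ℝ} (cN : Continuous N) (hN : ∀ q, 0 ≤ N q)
    (h : ∀ R, 0 ≤ R →
      ENNReal.ofReal (∫ p in box R T, weight η C R p.1 p.2.1 p.2.2 * N p) ≤ c) :
    weightedInt η T (fun t => ∫⁻ p in domain, ENNReal.ofReal (N (p.1, p.2, t))) ≤ c := by
  rw [weightedInt_interior η T (N := fun q => ENNReal.ofReal (N q)) cN.measurable.ennreal_ofReal]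
  exact setLIntegral_le_of_cutoff (B := fun R => box R T)
    (φ := fun R p => cutoff C R p.1 p.2.1 p.2.2) (fun R => measurableSet_box R T)
    (monotone_box T) (iUnion_box T) (fun _ => (Real.exp_pos _).le) hN
    (fun _ _ => cutoff_nonneg _ _ _ _ _) (1 + C * T)
    (by positivity) (fun n p hp => cutoff_eq_one_of_mem_box hC hp)
    (fun R => integrableOn_box ((continuous_weight η C R).mul cN) R T) h

lemma le_weightedInt_interior (η C T R : ℝ) {M : ℝ × ℝ × ℝ → ℝ} (cM : Continuous M)
    (hM : ∀ q, 0 ≤ M q) :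
    ENNReal.ofReal (∫ p in box R T, weight η C R p.1 p.2.1 p.2.2 * M p) ≤
      weightedInt η T (fun t => ∫⁻ p in domain, ENNReal.ofReal (M (p.1, p.2, t))) := by
  rw [weightedInt_interior η T (N := fun q => ENNReal.ofReal (M q)) cM.measurable.ennreal_ofReal]
  exact ofReal_setIntegral_cutoff_le (B := fun R => box R T)
    (φ := fun R p => cutoff C R p.1 p.2.1 p.2.2) (monotone_box T) (iUnion_box T)
    (fun _ => (Real.exp_pos _).le) hM (fun _ _ => cutoff_nonneg _ _ _ _ _)
    (fun _ _ => cutoff_le_one _ _ _ _ _)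
    (integrableOn_box ((continuous_weight η C R).mul cM) R T)

/-! ### Algebra of the cutoff integrals. -/

/-- The weighted integral of `N` over space-time. -/
noncomputable def intW (η C R T : ℝ) (N : ℝ × ℝ × ℝ → ℝ) : ℝ :=
  ∫ p in box R T, weight η C R p.1 p.2.1 p.2.2 * N p

/-- The weighted integral of `N` over the boundary and time. -/
noncomputable def bdryW (η C R T : ℝ) (N : ℝ × ℝ → ℝ) : ℝ :=
  ∫ q in bdryBox R T, weight η C R 0 q.1 q.2 * N q

section

variable {η C R T : ℝ}

lemma intW_mono {N M : ℝ × ℝ × ℝ → ℝ} (cN : Continuous N) (cM : Continuous M)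
    (h : ∀ p, 0 ≤ p.1 → 0 ≤ p.2.2 → N p ≤ M p) : intW η C R T N ≤ intW η C R T M :=
  setIntegral_mono_on (integrableOn_box ((continuous_weight η C R).mul cN) R T)
    (integrableOn_box ((continuous_weight η C R).mul cM) R T) (measurableSet_box R T)
    fun p hp => mul_le_mul_of_nonneg_left (h p hp.1.1 hp.2.2.1) (weight_nonneg _ _ _ _ _ _)

lemma intW_add {N M : ℝ × ℝ × ℝ → ℝ} (cN : Continuous N) (cM : Continuous M) :
    intW η C R T (fun p => N p + M p) = intW η C R T N + intW η C R T M := by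
  simp only [intW, mul_add]
  exact integral_add (integrableOn_box ((continuous_weight η C R).mul cN) R T)
    (integrableOn_box ((continuous_weight η C R).mul cM) R T)

lemma intW_const_mul (c : ℝ) (N : ℝ × ℝ × ℝ → ℝ) :
    intW η C R T (fun p => c * N p) = c * intW η C R T N := by
  simp only [intW, mul_left_comm _ c]
  exact integral_const_mul _ _

lemma intW_nonneg {N : ℝ × ℝ × ℝ → ℝ} (hN : ∀ p, 0 ≤ N p) : 0 ≤ intW η C R T N :=
  setIntegral_nonneg (measurableSet_box R T) fun p _ =>
    mul_nonneg (weight_nonneg _ _ _ _ _ _) (hN p)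

lemma bdryW_mono {N M : ℝ × ℝ → ℝ} (cN : Continuous N) (cM : Continuous M)
    (h : ∀ q, 0 ≤ q.2 → N q ≤ M q) : bdryW η C R T N ≤ bdryW η C R T M :=
  setIntegral_mono_on (integrableOn_bdryBox ((continuous_weight_bdry η C R).mul cN) R T)
    (integrableOn_bdryBox ((continuous_weight_bdry η C R).mul cM) R T) (measurableSet_bdryBox R T)
    fun q hq => mul_le_mul_of_nonneg_left (h q hq.2.1) (weight_nonneg _ _ _ _ _ _)

lemma bdryW_congr {N M : ℝ × ℝ → ℝ} (h : ∀ q, 0 ≤ q.2 → N q = M q) :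
    bdryW η C R T N = bdryW η C R T M :=
  setIntegral_congr_fun (measurableSet_bdryBox R T) fun q hq => by simp only [h q hq.2.1]

lemma bdryW_add {N M : ℝ × ℝ → ℝ} (cN : Continuous N) (cM : Continuous M) :
    bdryW η C R T (fun p => N p + M p) = bdryW η C R T N + bdryW η C R T M := by
  simp only [bdryW, mul_add]
  exact integral_add (integrableOn_bdryBox ((continuous_weight_bdry η C R).mul cN) R T)
    (integrableOn_bdryBox ((continuous_weight_bdry η C R).mul cM) R T)

lemma bdryW_const_mul (c : ℝ) (N : ℝ × ℝ → ℝ) :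
    bdryW η C R T (fun p => c * N p) = c * bdryW η C R T N := by
  simp only [bdryW, mul_left_comm _ c]
  exact integral_const_mul _ _

lemma bdryW_nonneg {N : ℝ × ℝ → ℝ} (hN : ∀ p, 0 ≤ N p) : 0 ≤ bdryW η C R T N :=
  setIntegral_nonneg (measurableSet_bdryBox R T) fun _ _ =>
    mul_nonneg (weight_nonneg _ _ _ _ _ _) (hN _)

end

/-! ### The energy method and the interior estimate. -/

lemma two_inner_le {η : ℝ} (hη : 0 < η) (z w : ℂ) :
    2 * inner ℝ z w ≤ η * ‖z‖ ^ 2 + 1 / η * ‖w‖ ^ 2 := by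
  have h1 := real_inner_le_norm z w
  have h2 : η * ‖z‖ ^ 2 + 1 / η * ‖w‖ ^ 2 - 2 * (‖z‖ * ‖w‖) = 1 / η * (η * ‖z‖ - ‖w‖) ^ 2 := by
    field_simp
    ring
  have h3 : 0 ≤ 1 / η * (η * ‖z‖ - ‖w‖) ^ 2 := by positivity
  linarith

/-- The energy density for the boundary condition `u_x = i b u_y`. -/
noncomputable def energy (b : ℝ) (a p q : ℂ) : ℝ :=
  1 / 2 * (‖a‖ ^ 2 + ‖p‖ ^ 2 + ‖q‖ ^ 2) + b * inner ℝ (Complex.I * p) q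

/-- By Cauchy–Schwarz and the arithmetic-geometric mean inequality the cross term costs at most the
fraction |b| of the standard energy. This is where |b| < 1 yields coercivity. -/
lemma le_energy (b : ℝ) (a p q : ℂ) :
    (1 - |b|) / 2 * (‖a‖ ^ 2 + ‖p‖ ^ 2 + ‖q‖ ^ 2) ≤ energy b a p q := by
  have h1 : |b * inner ℝ (Complex.I * p) q| ≤ |b| * (‖p‖ * ‖q‖) := by
    rw [abs_mul]
    refine mul_le_mul_of_nonneg_left ((abs_real_inner_le_norm _ _).trans ?_) (abs_nonneg b)
    simp
  have h2 : |b| * (‖p‖ * ‖q‖) ≤ |b| * (1 / 2 * (‖p‖ ^ 2 + ‖q‖ ^ 2)) :=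
    mul_le_mul_of_nonneg_left (by nlinarith [sq_nonneg (‖p‖ - ‖q‖)]) (abs_nonneg b)
  have h3 := (abs_le.1 h1).1
  have h4 : 0 ≤ |b| * ‖a‖ ^ 2 := by positivity
  simp only [energy]
  linarith

/-- Exchanging the roles of x and y changes the sign of b; the bound on the y-flux thereby follows
from the one on the x-flux. -/
lemma energy_neg_swap (b : ℝ) (a p q : ℂ) : energy (-b) a q p = energy b a p q := by
  simp only [energy, Complex.inner, Complex.mul_re, Complex.mul_im, Complex.conj_re,
    Complex.conj_im, Complex.I_re, Complex.I_im]
  ring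

/-- Bounds the flux by a multiple of the density; the constant 2 / (1 - |b|) serves as the speed of
the cutoff. -/
lemma abs_inner_flux_le {b : ℝ} (hb : |b| < 1) (a p q : ℂ) {c : ℂ} (hc : ‖c‖ = |b|) :
    |inner ℝ a (p + c * q)| ≤ 2 / (1 - |b|) * energy b a p q := by
  have hδ : 0 < 1 - |b| := by linarith
  have h0 : ‖p + c * q‖ ≤ ‖p‖ + ‖q‖ := by
    refine (norm_add_le _ _).trans (add_le_add_right ?_ _)
    rw [norm_mul, hc]
    exact mul_le_of_le_one_left (norm_nonneg q) hb.le
  have h1 : |inner ℝ a (p + c * q)| ≤ ‖a‖ * (‖p‖ + ‖q‖) :=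
    (abs_real_inner_le_norm _ _).trans (mul_le_mul_of_nonneg_left h0 (norm_nonneg a))
  have h2 : ‖a‖ * (‖p‖ + ‖q‖) ≤ ‖a‖ ^ 2 + ‖p‖ ^ 2 + ‖q‖ ^ 2 := by
    nlinarith [sq_nonneg (‖a‖ - ‖p‖), sq_nonneg (‖a‖ - ‖q‖), sq_nonneg ‖p‖, sq_nonneg ‖q‖]
  have h3 := mul_le_mul_of_nonneg_left (le_energy b a p q) (by positivity : 0 ≤ 2 / (1 - |b|))
  have h4 : 2 / (1 - |b|) * ((1 - |b|) / 2 * (‖a‖ ^ 2 + ‖p‖ ^ 2 + ‖q‖ ^ 2)) =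
      ‖a‖ ^ 2 + ‖p‖ ^ 2 + ‖q‖ ^ 2 := by field_simp
  linarith

section Initial

variable {u : ℝ → ℝ → ℝ → ℂ}

lemma dx_eq_zero_of_initial (hu : ContDiff ℝ 1 (unc u)) (h : ∀ x y : ℝ, 0 ≤ x → u x y 0 = 0)
    {x : ℝ} (hx : 0 ≤ x) (y : ℝ) : dx u x y 0 = 0 :=
  HasDerivAt.eq_of_eqOn_Ici hx (hasDerivAt_dx hu x y 0) (hasDerivAt_const x (0 : ℂ))
    fun s hs => h s y hs

lemma dy_eq_zero_of_initial (hu : ContDiff ℝ 1 (unc u)) (h : ∀ x y : ℝ, 0 ≤ x → u x y 0 = 0)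
    {x : ℝ} (hx : 0 ≤ x) (y : ℝ) : dy u x y 0 = 0 := by
  have h1 := hasDerivAt_dy hu x y 0
  rw [show (fun y' => u x y' 0) = fun _ => 0 from funext fun y' => h x y' hx] at h1
  exact h1.unique (hasDerivAt_const y (0 : ℂ))

end Initial

/-- The energy estimate with homogeneous boundary condition. -/
theorem energy_estimate {b : ℝ} (hb : |b| < 1) {F u : ℝ → ℝ → ℝ → ℂ}
    (hF : Continuous (unc F))
    (hu : IsSolution (Complex.I * b) F (fun _ _ => 0) u) {η R T : ℝ} (hη : 0 < η) (hR : 0 ≤ R)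
    (hT : 0 ≤ T) :
    intW η (2 / (1 - |b|)) R T (fun p => ‖unc (dt u) p‖ ^ 2 + ‖unc (dx u) p‖ ^ 2 +
        ‖unc (dy u) p‖ ^ 2) ≤
      1 / ((1 - |b|) ^ 2 * η ^ 2) *
        intW η (2 / (1 - |b|)) R T (fun p => ‖unc F p‖ ^ 2) := by
  have hδ : 0 < 1 - |b| := by linarith
  have su : ContDiff ℝ ∞ (unc u) := hu.smooth
  have su1 : ContDiff ℝ 1 (unc u) := su.of_le (by simp)
  have sa : ContDiff ℝ 1 (unc (dt u)) := (contDiff_dt su).of_le (by simp)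
  have sp : ContDiff ℝ 1 (unc (dx u)) := (contDiff_dx su).of_le (by simp)
  have sq : ContDiff ℝ 1 (unc (dy u)) := (contDiff_dy su).of_le (by simp)
  have ca := sa.continuous
  have cp := sp.continuous
  have cq := sq.continuous
  have cat := continuous_dt sa
  have cax := continuous_dx sa
  have cay := continuous_dy sa
  have cpx := continuous_dx sp
  have cpy := continuous_dy sp
  have cqy := continuous_dy sq
  have ce : Continuous fun p => energy b (unc (dt u) p) (unc (dx u) p) (unc (dy u) p) := by
    unfold energy
    fun_prop
  have key := weighted_balance (η := η) (C := 2 / (1 - |b|)) (R := R) (T := T) (by positivity)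
    hR hT
    (e := fun x y t => energy b (dt u x y t) (dx u x y t) (dy u x y t))
    (f := fun x y t => inner ℝ (dt u x y t) (dx u x y t + (-Complex.I * b) * dy u x y t))
    (h := fun x y t => inner ℝ (dt u x y t) (dy u x y t + (Complex.I * b) * dx u x y t))
    (s := fun x y t => inner ℝ (dt u x y t) (F x y t))
    (e' := fun x y t => 1 / 2 * (2 * inner ℝ (dt u x y t) (dt (dt u) x y t) +
      2 * inner ℝ (dx u x y t) (dx (dt u) x y t) + 2 * inner ℝ (dy u x y t) (dy (dt u) x y t)) +
      b * (inner ℝ (Complex.I * dx u x y t) (dy (dt u) x y t) +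
        inner ℝ (Complex.I * dx (dt u) x y t) (dy u x y t)))
    (f' := fun x y t => inner ℝ (dt u x y t) (dx (dx u) x y t + (-Complex.I * b) * dy (dx u) x y t)
      + inner ℝ (dx (dt u) x y t) (dx u x y t + (-Complex.I * b) * dy u x y t))
    (h' := fun x y t => inner ℝ (dt u x y t) (dy (dy u) x y t + (Complex.I * b) * dy (dx u) x y t)
      + inner ℝ (dy (dt u) x y t) (dy u x y t + (Complex.I * b) * dx u x y t))
    ce
    (by unfold unc at *; fun_prop) (by unfold unc at *; fun_prop) (by unfold unc at *; fun_prop)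
    (by unfold unc at *; fun_prop) (by unfold unc at *; fun_prop) (by unfold unc at *; fun_prop)
    (fun x y t => by
      have h1 := hasDerivAt_dt sp x y t
      have h2 := hasDerivAt_dt sq x y t
      rw [← dx_dt_comm su] at h1
      rw [← dy_dt_comm su] at h2
      exact ((((hasDerivAt_dt sa x y t).norm_sq.add h1.norm_sq).add h2.norm_sq).const_mul _).add
        (((h1.const_mul Complex.I).inner ℝ h2).const_mul b))
    (fun x y t => by
      have h2 := hasDerivAt_dx sq x y t
      rw [dx_dy_comm su] at h2
      exact (hasDerivAt_dx sa x y t).inner ℝ ((hasDerivAt_dx sp x y t).add (h2.const_mul _)))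
    (fun x y t => (hasDerivAt_dy sa x y t).inner ℝ
      ((hasDerivAt_dy sq x y t).add ((hasDerivAt_dy sp x y t).const_mul _)))
    (fun x y t hx ht => by
      simp only [hu.equation x y t hx ht, Complex.inner, Complex.add_re, Complex.add_im,
        Complex.mul_re, Complex.mul_im, Complex.conj_re, Complex.conj_im, Complex.I_re,
        Complex.I_im, Complex.ofReal_re, Complex.ofReal_im, Complex.neg_re, Complex.neg_im]
      ring)
    (fun x y t _ _ => abs_inner_flux_le hb _ _ _ (by simp))
    (fun x y t _ _ => by
      have h1 := abs_inner_flux_le (b := -b) (by rwa [abs_neg]) (dt u x y t) (dy u x y t)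
        (dx u x y t) (c := Complex.I * b) (by simp)
      rwa [abs_neg, energy_neg_swap] at h1)
    (fun x y t _ _ => le_trans (by positivity) (le_energy b _ _ _))
    (fun x y hx => by
      have h1 : dx u x y 0 = 0 := dx_eq_zero_of_initial su1 hu.initial hx y
      have h2 : dy u x y 0 = 0 := dy_eq_zero_of_initial su1 hu.initial hx y
      simp [h1, h2, hu.initial_dt x y hx, energy])
  -- The x-flux pairs u_t with u_x - ib u_y, which the boundary condition makes zero.
  have hbdry : ∫ q in bdryBox R T, weight η (2 / (1 - |b|)) R 0 q.1 q.2 *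
      inner ℝ (dt u 0 q.1 q.2) (dx u 0 q.1 q.2 + (-Complex.I * b) * dy u 0 q.1 q.2) = 0 := by
    refine setIntegral_eq_zero_of_forall_eq_zero fun q hq => ?_
    rw [hu.boundary q.1 q.2 hq.2.1]
    simp
  rw [hbdry, add_zero] at key
  -- Young's inequality with parameter η(1 - |b|): by coercivity the u_t part costs at most η times
  -- the energy, half of what the left-hand side provides.
  have h1 : intW η (2 / (1 - |b|)) R T (fun p => inner ℝ (unc (dt u) p) (unc F p)) ≤
      intW η (2 / (1 - |b|)) R T
        (fun p => η * energy b (unc (dt u) p) (unc (dx u) p) (unc (dy u) p) +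
          1 / (2 * (1 - |b|) * η) * ‖unc F p‖ ^ 2) := by
    refine intW_mono (by fun_prop) (by fun_prop) fun p _ _ => ?_
    have h2 := two_inner_le (mul_pos hη hδ) (unc (dt u) p) (unc F p)
    have h3 := mul_le_mul_of_nonneg_left
      (le_energy b (unc (dt u) p) (unc (dx u) p) (unc (dy u) p)) hη.le
    have h4 : 0 ≤ η * (1 - |b|) * (‖unc (dx u) p‖ ^ 2 + ‖unc (dy u) p‖ ^ 2) := by positivity
    have h5 : 1 / (η * (1 - |b|)) = 2 * (1 / (2 * (1 - |b|) * η)) := by field_simp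
    rw [h5] at h2
    linarith
  rw [intW_add (by fun_prop) (by fun_prop), intW_const_mul, intW_const_mul] at h1
  have h6 : intW η (2 / (1 - |b|)) R T (fun p => (1 - |b|) / 2 * (‖unc (dt u) p‖ ^ 2 +
      ‖unc (dx u) p‖ ^ 2 + ‖unc (dy u) p‖ ^ 2)) ≤ intW η (2 / (1 - |b|)) R T
        (fun p => energy b (unc (dt u) p) (unc (dx u) p) (unc (dy u) p)) :=
    intW_mono (by fun_prop) ce fun p _ _ => le_energy b _ _ _
  rw [intW_const_mul] at h6
  have h7 : 2 * η * intW η (2 / (1 - |b|)) R T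
        (fun p => energy b (unc (dt u) p) (unc (dx u) p) (unc (dy u) p)) ≤
      intW η (2 / (1 - |b|)) R T (fun p => inner ℝ (unc (dt u) p) (unc F p)) := key
  have h8 := mul_le_mul_of_nonneg_left h6 hη.le
  have h9 := mul_le_mul_of_nonneg_left
    (show η * ((1 - |b|) / 2 * intW η (2 / (1 - |b|)) R T (fun p => ‖unc (dt u) p‖ ^ 2 +
      ‖unc (dx u) p‖ ^ 2 + ‖unc (dy u) p‖ ^ 2)) ≤ 1 / (2 * (1 - |b|) * η) *
        intW η (2 / (1 - |b|)) R T (fun p => ‖unc F p‖ ^ 2) by linarith)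
    (by positivity : 0 ≤ 2 / ((1 - |b|) * η))
  refine le_trans (le_of_eq ?_) (h9.trans (le_of_eq ?_))
  · field_simp
  · field_simp

/-- Control of a function and of its trace by first derivatives. -/
theorem trace_estimate {u : ℝ → ℝ → ℝ → ℂ} (su : ContDiff ℝ ∞ (unc u))
    (h0 : ∀ x y : ℝ, 0 ≤ x → u x y 0 = 0) {η C R T : ℝ} (hη : 0 < η) (hC : 1 ≤ C) (hR : 0 ≤ R)
    (hT : 0 ≤ T) :
    η * intW η C R T (fun p => ‖unc u p‖ ^ 2) + bdryW η C R T (fun q => ‖u 0 q.1 q.2‖ ^ 2) ≤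
      2 / η * intW η C R T (fun p => ‖unc (dt u) p‖ ^ 2 + ‖unc (dx u) p‖ ^ 2 +
        ‖unc (dy u) p‖ ^ 2) := by
  have su1 : ContDiff ℝ 1 (unc u) := su.of_le (by simp)
  have cu := su1.continuous
  have ct := continuous_dt su1
  have cx := continuous_dx su1
  have cy := continuous_dy su1
  -- With |u|² as both density and x-flux, the boundary term of the balance law is the trace norm
  -- itself; the source is 2 Re⟨u, u_t - u_x⟩.
  have key := weighted_balance (η := η) (C := C) (R := R) (T := T) (by linarith) hR hT
    (e := fun x y t => ‖u x y t‖ ^ 2) (f := fun x y t => ‖u x y t‖ ^ 2) (h := fun _ _ _ => 0)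
    (s := fun x y t => 2 * inner ℝ (u x y t) (dt u x y t) - 2 * inner ℝ (u x y t) (dx u x y t))
    (e' := fun x y t => 2 * inner ℝ (u x y t) (dt u x y t))
    (f' := fun x y t => 2 * inner ℝ (u x y t) (dx u x y t)) (h' := fun _ _ _ => 0)
    (by unfold unc at *; fun_prop) (by unfold unc at *; fun_prop) (by unfold unc at *; fun_prop)
    (by unfold unc at *; fun_prop) (by unfold unc; fun_prop) (by unfold unc; fun_prop)
    (by unfold unc at *; fun_prop) (fun x y t => (hasDerivAt_dt su1 x y t).norm_sq)
    (fun x y t => (hasDerivAt_dx su1 x y t).norm_sq) (fun x y t => hasDerivAt_const _ _)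
    (fun x y t _ _ => by ring)
    (fun x y t _ _ => by
      rw [abs_of_nonneg (sq_nonneg _)]
      exact le_mul_of_one_le_left (sq_nonneg _) hC)
    (fun x y t _ _ => by rw [abs_zero]; positivity) (fun x y t _ _ => sq_nonneg _)
    (fun x y hx => by simp [h0 x y hx])
  have h1 : intW η C R T (fun p => 2 * inner ℝ (unc u p) (unc (dt u) p) -
      2 * inner ℝ (unc u p) (unc (dx u) p)) ≤ intW η C R T (fun p => η * ‖unc u p‖ ^ 2 +
        2 / η * (‖unc (dt u) p‖ ^ 2 + ‖unc (dx u) p‖ ^ 2 + ‖unc (dy u) p‖ ^ 2)) := by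
    refine intW_mono (by fun_prop) (by fun_prop) fun p _ _ => ?_
    -- The parameter η/2 is used twice, so η|u|² in total is absorbed and η|u|² remains on the left.
    have h2 := two_inner_le (half_pos hη) (unc u p) (unc (dt u) p)
    have h3 := two_inner_le (half_pos hη) (unc u p) (-unc (dx u) p)
    rw [inner_neg_right, norm_neg] at h3
    have h4 : 0 ≤ 2 / η * ‖unc (dy u) p‖ ^ 2 := by positivity
    have h5 : 1 / (η / 2) = 2 / η := by field_simp
    rw [h5] at h2 h3
    linarith
  rw [intW_add (by fun_prop) (by fun_prop), intW_const_mul, intW_const_mul] at h1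
  have h7 : 2 * η * intW η C R T (fun p => ‖unc u p‖ ^ 2) +
      bdryW η C R T (fun q => ‖u 0 q.1 q.2‖ ^ 2) ≤
      intW η C R T (fun p => 2 * inner ℝ (unc u p) (unc (dt u) p) -
      2 * inner ℝ (unc u p) (unc (dx u) p)) := key
  linarith

lemma enorm_sq_eq_ofReal (z : ℂ) : ‖z‖ₑ ^ 2 = ENNReal.ofReal (‖z‖ ^ 2) := by
  rw [ENNReal.ofReal_pow (norm_nonneg z), ofReal_norm]

lemma sqNormL2_eq (v : ℝ → ℝ → ℝ → ℂ) :
    sqNormL2 v = fun t => ∫⁻ p in domain, ENNReal.ofReal (‖unc v (p.1, p.2, t)‖ ^ 2) := by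
  funext t
  simp only [sqNormL2, enorm_sq_eq_ofReal]

lemma sqNormBdry_eq (g : ℝ → ℝ → ℂ) :
    sqNormBdry g = fun t => ∫⁻ y, ENNReal.ofReal (‖g y t‖ ^ 2) := by
  funext t
  simp only [sqNormBdry, enorm_sq_eq_ofReal]

lemma measurable_weightedInt_integrand {N : ℝ → ℝ≥0∞} (hN : Measurable N) (η : ℝ) :
    Measurable fun t => ENNReal.ofReal (Real.exp (-2 * η * t)) * N t := by
  fun_prop

lemma weightedInt_add {η T : ℝ} {N M : ℝ → ℝ≥0∞} (hN : Measurable N) :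
    weightedInt η T (fun t => N t + M t) = weightedInt η T N + weightedInt η T M := by
  simp only [weightedInt, mul_add]
  exact lintegral_add_left (measurable_weightedInt_integrand hN η) _

lemma measurable_sqNormL2 {v : ℝ → ℝ → ℝ → ℂ} (hv : Continuous (unc v)) :
    Measurable (sqNormL2 v) := by
  have h : Measurable fun a : ℝ × (ℝ × ℝ) => ‖unc v (a.2.1, a.2.2, a.1)‖ₑ ^ 2 :=
    ((hv.comp (by fun_prop : Continuous fun a : ℝ × (ℝ × ℝ) =>
      ((a.2.1, a.2.2, a.1) : ℝ × ℝ × ℝ))).enorm.measurable.pow_const 2)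
  exact h.lintegral_prod_right'

/-- The interior estimate for `u_x = i b u_y` with `|b| < 1`. -/
theorem interiorEstimate_of_abs_lt_one {b : ℝ} (hb : |b| < 1) :
    InteriorEstimate (Complex.I * b) := by
  have hδ : 0 < 1 - |b| := by linarith
  -- The constant is 5 = 2 + 1 + 2, from u in the interior, its first derivatives, and its trace.
  -- Taking η ≥ 1 allows 2/η ≤ 2 and the dropping of the factor η in front of |u|².
  refine ⟨1, 5 / (1 - |b|) ^ 2, 2, zero_le_one, by positivity, two_pos, ?_⟩
  intro F u hF hu η T hη1 hη hT
  rw [Real.rpow_ofNat]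
  have su : ContDiff ℝ ∞ (unc u) := hu.smooth
  have su1 : ContDiff ℝ 1 (unc u) := su.of_le (by simp)
  have cF : Continuous (unc F) := hF.1.continuous
  have cu := su1.continuous
  have ct := continuous_dt su1
  have cx := continuous_dx su1
  have cy := continuous_dy su1
  have hC1 : 1 ≤ 2 / (1 - |b|) := by
    rw [le_div_iff₀ hδ]
    linarith [abs_nonneg b]
  have hC : 0 ≤ 2 / (1 - |b|) := by linarith
  set C := 2 / (1 - |b|) with hCdef
  set K := 1 / ((1 - |b|) ^ 2 * η ^ 2) with hK
  have hK0 : 0 ≤ K := by positivity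
  set c := weightedInt η T (sqNormL2 F) with hc
  have cFN : ∀ R, ENNReal.ofReal (intW η C R T (fun p => ‖unc F p‖ ^ 2)) ≤ c := fun R => by
    rw [hc, sqNormL2_eq]
    exact le_weightedInt_interior η C T R (by fun_prop) fun _ => sq_nonneg _
  have hen : ∀ R, 0 ≤ R → intW η C R T (fun p => ‖unc (dt u) p‖ ^ 2 + ‖unc (dx u) p‖ ^ 2 +
        ‖unc (dy u) p‖ ^ 2) ≤ K * intW η C R T (fun p => ‖unc F p‖ ^ 2) := fun R hR =>
    energy_estimate hb cF hu hη hR hT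
  have hle : ∀ (k X : ℝ) (R : ℝ), 0 ≤ k → X ≤ k * (K * intW η C R T (fun p => ‖unc F p‖ ^ 2)) →
      ENNReal.ofReal X ≤ ENNReal.ofReal (k * K) * c := fun k X R hk h => by
    refine (ENNReal.ofReal_le_ofReal h).trans ?_
    rw [← mul_assoc, ENNReal.ofReal_mul (by positivity)]
    exact mul_le_mul_right (cFN R) _
  have b1 : weightedInt η T (fun t => ∫⁻ p in domain, ENNReal.ofReal
      (‖unc u (p.1, p.2, t)‖ ^ 2)) ≤ ENNReal.ofReal (2 * K) * c := by
    refine weightedInt_interior_le (N := fun p => ‖unc u p‖ ^ 2) hC hT (by fun_prop)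
      (fun _ => sq_nonneg _) fun R hR => hle 2 _ R two_pos.le ?_
    change intW η C R T (fun p => ‖unc u p‖ ^ 2) ≤ _
    have h1 := trace_estimate su hu.initial hη hC1 hR hT
    have h2 := hen R hR
    have h3 : 0 ≤ bdryW η C R T (fun q => ‖u 0 q.1 q.2‖ ^ 2) := bdryW_nonneg fun _ => sq_nonneg _
    have h4 : 0 ≤ intW η C R T (fun p => ‖unc u p‖ ^ 2) := intW_nonneg fun _ => sq_nonneg _
    have h5 : 0 ≤ intW η C R T (fun p => ‖unc (dt u) p‖ ^ 2 + ‖unc (dx u) p‖ ^ 2 +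
        ‖unc (dy u) p‖ ^ 2) := intW_nonneg fun _ => by positivity
    have h6 : 2 / η ≤ 2 := by
      rw [div_le_iff₀ hη]
      linarith
    have h7 := mul_le_mul_of_nonneg_right h6 h5
    have h8 := mul_le_mul_of_nonneg_right hη1 h4
    linarith
  have b2 : weightedInt η T (sqNormBdry (u 0)) ≤ ENNReal.ofReal (2 * K) * c := by
    rw [sqNormBdry_eq]
    refine weightedInt_bdry_le (N := fun q => ‖u 0 q.1 q.2‖ ^ 2) (C := C) hC hT
      (by unfold unc at cu; fun_prop)
      (fun _ => sq_nonneg _) fun R hR => hle 2 _ R two_pos.le ?_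
    change bdryW η C R T (fun q => ‖u 0 q.1 q.2‖ ^ 2) ≤ _
    have h1 := trace_estimate su hu.initial hη hC1 hR hT
    have h2 := hen R hR
    have h4 : 0 ≤ η * intW η C R T (fun p => ‖unc u p‖ ^ 2) :=
      mul_nonneg hη.le (intW_nonneg fun _ => sq_nonneg _)
    have h5 : 0 ≤ intW η C R T (fun p => ‖unc (dt u) p‖ ^ 2 + ‖unc (dx u) p‖ ^ 2 +
        ‖unc (dy u) p‖ ^ 2) := intW_nonneg fun _ => by positivity
    have h6 : 2 / η ≤ 2 := by
      rw [div_le_iff₀ hη]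
      linarith
    have h7 := mul_le_mul_of_nonneg_right h6 h5
    linarith
  have b3 : weightedInt η T (fun t => ∫⁻ p in domain, ENNReal.ofReal
      (‖unc (dt u) (p.1, p.2, t)‖ ^ 2 + ‖unc (dx u) (p.1, p.2, t)‖ ^ 2 +
        ‖unc (dy u) (p.1, p.2, t)‖ ^ 2)) ≤ ENNReal.ofReal (1 * K) * c := by
    refine weightedInt_interior_le (N := fun p => ‖unc (dt u) p‖ ^ 2 + ‖unc (dx u) p‖ ^ 2 +
        ‖unc (dy u) p‖ ^ 2) hC hT (by fun_prop) (fun _ => by positivity)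
        fun R hR => hle 1 _ R one_pos.le ?_
    rw [one_mul]
    exact hen R hR
  have hsplit : (fun t => ∫⁻ p in domain, ENNReal.ofReal
      (‖unc (dt u) (p.1, p.2, t)‖ ^ 2 + ‖unc (dx u) (p.1, p.2, t)‖ ^ 2 +
        ‖unc (dy u) (p.1, p.2, t)‖ ^ 2)) =
      fun t => sqNormL2 (dt u) t + sqNormL2 (dx u) t + sqNormL2 (dy u) t := by
    funext t
    unfold unc at ct cx
    have m1 : Measurable fun p : ℝ × ℝ => ENNReal.ofReal (‖dt u p.1 p.2 t‖ ^ 2) :=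
      (by fun_prop : Continuous fun p : ℝ × ℝ => ‖dt u p.1 p.2 t‖ ^ 2).measurable.ennreal_ofReal
    have m2 : Measurable fun p : ℝ × ℝ => ENNReal.ofReal (‖dx u p.1 p.2 t‖ ^ 2) :=
      (by fun_prop : Continuous fun p : ℝ × ℝ => ‖dx u p.1 p.2 t‖ ^ 2).measurable.ennreal_ofReal
    simp only [sqNormL2, enorm_sq_eq_ofReal]
    rw [← lintegral_add_left m1, ← lintegral_add_left (show Measurable fun p : ℝ × ℝ =>
      ENNReal.ofReal (‖dt u p.1 p.2 t‖ ^ 2) + ENNReal.ofReal (‖dx u p.1 p.2 t‖ ^ 2) from m1.add m2)]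
    refine lintegral_congr fun p => ?_
    rw [← ENNReal.ofReal_add (sq_nonneg _) (sq_nonneg _),
      ← ENNReal.ofReal_add (by positivity) (sq_nonneg _)]
  have hsum : (fun t => sqNormH1 u t + sqNormL2 (dt u) t + sqNormBdry (u 0) t) =
      fun t => sqNormL2 u t + ((sqNormL2 (dt u) t + sqNormL2 (dx u) t + sqNormL2 (dy u) t) +
        sqNormBdry (u 0) t) := by
    funext t
    simp only [sqNormH1]
    ring
  have mt := measurable_sqNormL2 ct
  have mx := measurable_sqNormL2 cx
  have my := measurable_sqNormL2 cy
  rw [hsum, weightedInt_add (measurable_sqNormL2 cu),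
    weightedInt_add (show Measurable fun t => sqNormL2 (dt u) t + sqNormL2 (dx u) t +
      sqNormL2 (dy u) t from (mt.add mx).add my), ← hsplit]
  rw [← sqNormL2_eq] at b1
  refine (add_le_add b1 (add_le_add b3 b2)).trans (le_of_eq ?_)
  rw [← add_mul, ← add_mul, ← ENNReal.ofReal_add (by positivity) (by positivity),
    ← ENNReal.ofReal_add (by positivity) (by positivity)]
  congr 2
  rw [hK]
  field_simp
  norm_num

/-! ### Boundary stability. -/

lemma dx_add_mul {v w : ℝ → ℝ → ℝ → ℂ} (hv : ContDiff ℝ 1 (unc v)) (hw : ContDiff ℝ 1 (unc w))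
    (c : ℂ) (x y t : ℝ) :
    dx (fun x y t => v x y t + c * w x y t) x y t = dx v x y t + c * dx w x y t :=
  ((hasDerivAt_dx hv x y t).add ((hasDerivAt_dx hw x y t).const_mul c)).deriv

lemma dy_add_mul {v w : ℝ → ℝ → ℝ → ℂ} (hv : ContDiff ℝ 1 (unc v)) (hw : ContDiff ℝ 1 (unc w))
    (c : ℂ) (x y t : ℝ) :
    dy (fun x y t => v x y t + c * w x y t) x y t = dy v x y t + c * dy w x y t :=
  ((hasDerivAt_dy hv x y t).add ((hasDerivAt_dy hw x y t).const_mul c)).deriv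

lemma dt_add_mul {v w : ℝ → ℝ → ℝ → ℂ} (hv : ContDiff ℝ 1 (unc v)) (hw : ContDiff ℝ 1 (unc w))
    (c : ℂ) (x y t : ℝ) :
    dt (fun x y t => v x y t + c * w x y t) x y t = dt v x y t + c * dt w x y t :=
  ((hasDerivAt_dt hv x y t).add ((hasDerivAt_dt hw x y t).const_mul c)).deriv

lemma contDiff_add_mul {n : WithTop ℕ∞} {v w : ℝ → ℝ → ℝ → ℂ} (hv : ContDiff ℝ n (unc v))
    (hw : ContDiff ℝ n (unc w)) (c : ℂ) :
    ContDiff ℝ n (unc fun x y t => v x y t + c * w x y t) :=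
  hv.add (contDiff_const.mul hw)

/-- The quantity prescribed by the boundary condition, `u_x - i b u_y`. -/
noncomputable def bdryOp (b : ℝ) (u : ℝ → ℝ → ℝ → ℂ) (x y t : ℝ) : ℂ :=
  dx u x y t + (-Complex.I * b) * dy u x y t

/-- The potential `z` with `z_t - z_x = p_y`, where `p = u_x - i b u_y`. -/
noncomputable def conjOp (b : ℝ) (u : ℝ → ℝ → ℝ → ℂ) : ℝ → ℝ → ℝ → ℂ :=
  transportInt 1 (dy (bdryOp b u))

section

variable {b : ℝ} {g : ℝ → ℝ → ℂ} {u : ℝ → ℝ → ℝ → ℂ}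

lemma contDiff_bdryOp (su : ContDiff ℝ ∞ (unc u)) : ContDiff ℝ ∞ (unc (bdryOp b u)) :=
  contDiff_add_mul (contDiff_dx su) (contDiff_dy su) _

lemma contDiff_conjOp (su : ContDiff ℝ ∞ (unc u)) : ContDiff ℝ 1 (unc (conjOp b u)) :=
  contDiff_transportInt ((contDiff_dy (contDiff_bdryOp su)).of_le (by simp))

variable (hu : IsSolution (Complex.I * b) (fun _ _ _ => 0) g u)
include hu

lemma bdryOp_eq {t : ℝ} (y : ℝ) (ht : 0 ≤ t) : bdryOp b u 0 y t = g y t := by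
  rw [bdryOp, hu.boundary y t ht]
  ring

lemma bdryOp_initial {x : ℝ} (y : ℝ) (hx : 0 ≤ x) : bdryOp b u x y 0 = 0 := by
  have su1 : ContDiff ℝ 1 (unc u) := hu.smooth.of_le (by simp)
  rw [bdryOp, dx_eq_zero_of_initial su1 hu.initial hx, dy_eq_zero_of_initial su1 hu.initial hx]
  simp

lemma dt_bdryOp (x y t : ℝ) : dt (bdryOp b u) x y t = bdryOp b (dt u) x y t := by
  have su : ContDiff ℝ ∞ (unc u) := hu.smooth
  refine (dt_add_mul ((contDiff_dx su).of_le (by simp)) ((contDiff_dy su).of_le (by simp))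
    _ x y t).trans ?_
  rw [bdryOp, dx_dt_comm su, dy_dt_comm su]

lemma dt_bdryOp_initial {x : ℝ} (y : ℝ) (hx : 0 ≤ x) : dt (bdryOp b u) x y 0 = 0 := by
  have su1 : ContDiff ℝ 1 (unc (dt u)) := (contDiff_dt hu.smooth).of_le (by simp)
  rw [dt_bdryOp hu, bdryOp, dx_eq_zero_of_initial su1 hu.initial_dt hx,
    dy_eq_zero_of_initial su1 hu.initial_dt hx]
  simp

/-- `p = u_x - i b u_y` solves the wave equation. -/
lemma wave_bdryOp {x y t : ℝ} (hx : 0 ≤ x) (ht : 0 ≤ t) :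
    dt (dt (bdryOp b u)) x y t = dx (dx (bdryOp b u)) x y t + dy (dy (bdryOp b u)) x y t := by
  have su : ContDiff ℝ ∞ (unc u) := hu.smooth
  have sx := contDiff_dx su
  have sy := contDiff_dy su
  have s1 : ∀ {v : ℝ → ℝ → ℝ → ℂ}, ContDiff ℝ ∞ (unc v) → ContDiff ℝ 1 (unc v) :=
    fun h => h.of_le (by simp)
  have ett : dt (dt (bdryOp b u)) x y t = bdryOp b (dt (dt u)) x y t := by
    have e : dt (bdryOp b u) = bdryOp b (dt u) := by
      funext x y t
      exact dt_bdryOp hu x y t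
    have st := contDiff_dt su
    rw [e]
    refine (dt_add_mul (s1 (contDiff_dx st)) (s1 (contDiff_dy st)) _ x y t).trans ?_
    rw [bdryOp, dx_dt_comm st, dy_dt_comm st]
  have exx : dx (dx (bdryOp b u)) x y t = bdryOp b (dx (dx u)) x y t := by
    have e : dx (bdryOp b u) = bdryOp b (dx u) := by
      funext x y t
      refine (dx_add_mul (s1 sx) (s1 sy) _ x y t).trans ?_
      rw [bdryOp, dx_dy_comm su]
    rw [e]
    refine (dx_add_mul (s1 (contDiff_dx sx)) (s1 (contDiff_dy sx)) _ x y t).trans ?_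
    rw [bdryOp, dx_dy_comm sx]
  have eyy : dy (dy (bdryOp b u)) x y t = bdryOp b (dy (dy u)) x y t := by
    have e : dy (bdryOp b u) = bdryOp b (dy u) := by
      funext x y t
      refine (dy_add_mul (s1 sx) (s1 sy) _ x y t).trans ?_
      rw [bdryOp, dx_dy_comm su]
    rw [e]
    refine (dy_add_mul (s1 (contDiff_dx sy)) (s1 (contDiff_dy sy)) _ x y t).trans ?_
    rw [bdryOp, dx_dy_comm sy]
  have heq : ∀ x y t : ℝ, 0 ≤ x → 0 ≤ t →
      dt (dt u) x y t = dx (dx u) x y t + dy (dy u) x y t := fun x y t hx ht => by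
    simpa using hu.equation x y t hx ht
  have stt := s1 (contDiff_dt (contDiff_dt su))
  have sxx := s1 (contDiff_dx sx)
  have syy := s1 (contDiff_dy sy)
  -- The equation is known only for x ≥ 0, so at x = 0 it is differentiated through uniqueness of
  -- one-sided derivatives.
  have h1 : dx (dt (dt u)) x y t = dx (dx (dx u)) x y t + dx (dy (dy u)) x y t :=
    HasDerivAt.eq_of_eqOn_Ici hx (hasDerivAt_dx stt x y t)
      ((hasDerivAt_dx sxx x y t).add (hasDerivAt_dx syy x y t)) fun s hs => heq s y t hs ht
  have h2 : dy (dt (dt u)) x y t = dy (dx (dx u)) x y t + dy (dy (dy u)) x y t := by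
    have h3 := hasDerivAt_dy stt x y t
    rw [show (fun y' => dt (dt u) x y' t) = fun y' => dx (dx u) x y' t + dy (dy u) x y' t from
      funext fun y' => heq x y' t hx ht] at h3
    exact h3.unique ((hasDerivAt_dy sxx x y t).add (hasDerivAt_dy syy x y t))
  rw [ett, exx, eyy, bdryOp, bdryOp, bdryOp, h1, h2]
  ring

/-- Both sides solve the same transport problem with zero initial data: (∂_t - ∂_x)(p_t + p_x) =
p_tt - p_xx = p_yy by the wave equation for p, and z_y has the source p_yy by construction. -/
lemma dy_conjOp {x y t : ℝ} (hx : 0 ≤ x) (ht : 0 ≤ t) :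
    dy (conjOp b u) x y t = dt (bdryOp b u) x y t + dx (bdryOp b u) x y t := by
  have sp : ContDiff ℝ ∞ (unc (bdryOp b u)) := contDiff_bdryOp hu.smooth
  have s1 : ∀ {v : ℝ → ℝ → ℝ → ℂ}, ContDiff ℝ ∞ (unc v) → ContDiff ℝ 1 (unc v) :=
    fun h => h.of_le (by simp)
  have spt := s1 (contDiff_dt sp)
  have spx := s1 (contDiff_dx sp)
  have sa : ContDiff ℝ 1 (unc fun x y t => dt (bdryOp b u) x y t + 1 * dx (bdryOp b u) x y t) :=
    contDiff_add_mul spt spx 1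
  have h := transportInt_eq (v := dy (dy (bdryOp b u))) zero_le_one sa
    (continuous_dy (s1 (contDiff_dy sp))) (fun x y t hx ht => ?_) (fun x y hx => ?_) hx ht (y := y)
  · rw [conjOp, dy_transportInt (s1 (contDiff_dy sp)), h, one_mul]
  · rw [dt_add_mul spt spx, dx_add_mul spt spx, wave_bdryOp hu hx ht, dx_dt_comm sp]
    push_cast
    ring
  · rw [dt_bdryOp_initial hu y hx,
      dx_eq_zero_of_initial (s1 sp) (fun x y hx => bdryOp_initial hu y hx) hx]
    simp

lemma dt_conjOp (x y t : ℝ) :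
    dt (conjOp b u) x y t = dx (conjOp b u) x y t + dy (bdryOp b u) x y t := by
  have h := dt_sub_dx_transportInt (θ := 1)
    ((contDiff_dy (contDiff_bdryOp (b := b) hu.smooth)).of_le (by simp)) x y t
  rw [Complex.ofReal_one, one_mul, sub_eq_iff_eq_add] at h
  rw [conjOp, h]
  ring

/-- The Dirichlet data of `p` control the trace of `z`. -/
theorem conjOp_trace_estimate {η R T : ℝ} (hη : 0 < η) (hR : 0 ≤ R) (hT : 0 ≤ T) :
    bdryW η 1 R T (fun q => ‖conjOp b u 0 q.1 q.2‖ ^ 2) ≤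
      bdryW η 1 R T (fun q => ‖bdryOp b u 0 q.1 q.2‖ ^ 2) := by
  have su : ContDiff ℝ ∞ (unc u) := hu.smooth
  have sp : ContDiff ℝ 1 (unc (bdryOp b u)) := (contDiff_bdryOp su).of_le (by simp)
  have sz : ContDiff ℝ 1 (unc (conjOp b u)) := contDiff_conjOp su
  have cp := sp.continuous
  have cz := sz.continuous
  have cpt := continuous_dt sp
  have cpx := continuous_dx sp
  have cpy := continuous_dy sp
  have czt := continuous_dt sz
  have czx := continuous_dx sz
  have czy := continuous_dy sz
  have am : ∀ p z : ℂ, |inner ℝ p z| ≤ 1 / 2 * (‖p‖ ^ 2 + ‖z‖ ^ 2) := fun p z =>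
    (abs_real_inner_le_norm p z).trans (by nlinarith [sq_nonneg (‖p‖ - ‖z‖)])
  -- The flux ½(|z|² - |p|²) has the trace of z with a good sign and the Dirichlet data p with a bad
  -- one, and the law has no source.
  have key := weighted_balance (η := η) (C := 1) (R := R) (T := T) zero_le_one hR hT
    (e := fun x y t => 1 / 2 * (‖bdryOp b u x y t‖ ^ 2 + ‖conjOp b u x y t‖ ^ 2))
    (f := fun x y t => 1 / 2 * (‖conjOp b u x y t‖ ^ 2 - ‖bdryOp b u x y t‖ ^ 2))
    (h := fun x y t => inner ℝ (bdryOp b u x y t) (conjOp b u x y t)) (s := fun _ _ _ => 0)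
    (e' := fun x y t => 1 / 2 * (2 * inner ℝ (bdryOp b u x y t) (dt (bdryOp b u) x y t) +
      2 * inner ℝ (conjOp b u x y t) (dt (conjOp b u) x y t)))
    (f' := fun x y t => 1 / 2 * (2 * inner ℝ (conjOp b u x y t) (dx (conjOp b u) x y t) -
      2 * inner ℝ (bdryOp b u x y t) (dx (bdryOp b u) x y t)))
    (h' := fun x y t => inner ℝ (bdryOp b u x y t) (dy (conjOp b u) x y t) +
      inner ℝ (dy (bdryOp b u) x y t) (conjOp b u x y t))
    (by unfold unc at *; fun_prop) (by unfold unc at *; fun_prop) (by unfold unc at *; fun_prop)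
    (by unfold unc at *; fun_prop) (by unfold unc at *; fun_prop) (by unfold unc at *; fun_prop)
    (by unfold unc; fun_prop)
    (fun x y t => ((hasDerivAt_dt sp x y t).norm_sq.add (hasDerivAt_dt sz x y t).norm_sq).const_mul
      _)
    (fun x y t => ((hasDerivAt_dx sz x y t).norm_sq.sub (hasDerivAt_dx sp x y t).norm_sq).const_mul
      _)
    (fun x y t => (hasDerivAt_dy sp x y t).inner ℝ (hasDerivAt_dy sz x y t))
    (fun x y t hx ht => by
      rw [dy_conjOp hu hx ht, dt_conjOp hu, inner_add_right, inner_add_right,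
        real_inner_comm (conjOp b u x y t) (dy (bdryOp b u) x y t)]
      ring)
    (fun x y t _ _ => by
      rw [one_mul, abs_le]
      constructor <;> linarith [sq_nonneg ‖bdryOp b u x y t‖, sq_nonneg ‖conjOp b u x y t‖])
    (fun x y t _ _ => by rw [one_mul]; exact am _ _)
    (fun x y t _ _ => by positivity)
    (fun x y hx => by simp [bdryOp_initial hu y hx, conjOp, transportInt_zero])
  have h1 : 0 ≤ intW η 1 R T
      (fun p => 1 / 2 * (‖unc (bdryOp b u) p‖ ^ 2 + ‖unc (conjOp b u) p‖ ^ 2)) :=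
    intW_nonneg fun _ => by positivity
  have h2 : 2 * η * intW η 1 R T
      (fun p => 1 / 2 * (‖unc (bdryOp b u) p‖ ^ 2 + ‖unc (conjOp b u) p‖ ^ 2)) +
      bdryW η 1 R T (fun q => 1 / 2 * (‖conjOp b u 0 q.1 q.2‖ ^ 2 - ‖bdryOp b u 0 q.1 q.2‖ ^ 2)) ≤
      intW η 1 R T (fun _ => 0) := key
  have h3 : intW η 1 R T (fun _ => 0) = 0 := by simp [intW]
  have c0 : Continuous fun q : ℝ × ℝ => ‖bdryOp b u 0 q.1 q.2‖ ^ 2 := by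
    unfold unc at cp; fun_prop
  have c1 : Continuous fun q : ℝ × ℝ =>
      1 / 2 * (‖conjOp b u 0 q.1 q.2‖ ^ 2 - ‖bdryOp b u 0 q.1 q.2‖ ^ 2) := by
    unfold unc at cp cz; fun_prop
  have h4 : bdryW η 1 R T (fun q => ‖conjOp b u 0 q.1 q.2‖ ^ 2) =
      2 * bdryW η 1 R T
        (fun q => 1 / 2 * (‖conjOp b u 0 q.1 q.2‖ ^ 2 - ‖bdryOp b u 0 q.1 q.2‖ ^ 2)) +
      bdryW η 1 R T (fun q => ‖bdryOp b u 0 q.1 q.2‖ ^ 2) := by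
    rw [← bdryW_const_mul, ← bdryW_add (by fun_prop) c0]
    exact bdryW_congr fun q _ => by ring
  have h5 := mul_nonneg hη.le h1
  linarith

/-- The trace of `u` is controlled by the boundary data. -/
theorem boundary_estimate (hb : |b| < 1) {η R T : ℝ} (hη : 0 < η) (hR : 0 ≤ R) (hT : 0 ≤ T) :
    bdryW η 1 R T (fun q => ‖u 0 q.1 q.2‖ ^ 2) ≤
      (1 + 4 / (1 - b ^ 2)) / η ^ 2 * bdryW η 1 R T (fun q => ‖bdryOp b u 0 q.1 q.2‖ ^ 2) := by
  have hc2 : 0 < 1 - b ^ 2 := by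
    have := (sq_lt_one_iff_abs_lt_one b).2 hb
    linarith
  set c : ℝ := Real.sqrt (1 - b ^ 2) with hc
  have hc0 : 0 < c := Real.sqrt_pos.2 hc2
  have hcsq : c ^ 2 = 1 - b ^ 2 := Real.sq_sqrt hc2.le
  have hc1 : c ≤ 1 := by nlinarith [sq_nonneg b]
  have hcC : (c : ℂ) ≠ 0 := by exact_mod_cast hc0.ne'
  have s1 : ∀ {v : ℝ → ℝ → ℝ → ℂ}, ContDiff ℝ ∞ (unc v) → ContDiff ℝ 1 (unc v) :=
    fun h => h.of_le (by simp)
  have su : ContDiff ℝ ∞ (unc u) := hu.smooth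
  have sy := s1 (contDiff_dy su)
  have sp : ContDiff ℝ 1 (unc (bdryOp b u)) := s1 (contDiff_bdryOp su)
  have sz : ContDiff ℝ 1 (unc (conjOp b u)) := contDiff_conjOp su
  -- By the formula for z_y, w_y = p_t + p_x + ib p_y, and the mixed derivatives u_xy cancel: w_y =
  -- p_t + u_xx + b² u_yy. Therefore (u_t + p)_t = c² u_yy + w_y.
  set w : ℝ → ℝ → ℝ → ℂ := fun x y t => conjOp b u x y t + (Complex.I * b) * bdryOp b u x y t
    with hw
  have sw : ContDiff ℝ 1 (unc w) := contDiff_add_mul sz sp _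
  set v : ℝ → ℝ → ℝ → ℂ := fun x y t => (fun x y t => 0 + (c : ℂ) * dy u x y t) x y t +
    (c : ℂ)⁻¹ * w x y t with hv
  have s0 : ContDiff ℝ 1 (unc fun _ _ _ => (0 : ℂ)) := contDiff_const
  have scy : ContDiff ℝ 1 (unc fun x y t => 0 + (c : ℂ) * dy u x y t) := contDiff_add_mul s0 sy _
  have sv : ContDiff ℝ 1 (unc v) := contDiff_add_mul scy sw _
  -- At speed θ = 0 the transport integral is the plain time integral, so V_t = c u_y + w/c.
  set V := transportInt 0 v with hV
  have sV : ContDiff ℝ 1 (unc V) := contDiff_transportInt sv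
  have Vt : ∀ x y t, dt V x y t = v x y t := fun x y t => by
    have := dt_sub_dx_transportInt (θ := 0) sv x y t
    simpa using this
  have st := s1 (contDiff_dt su)
  have sa : ContDiff ℝ 1 (unc fun x y t => dt u x y t + 1 * bdryOp b u x y t) :=
    contDiff_add_mul st sp _
  -- Both sides vanish at t = 0 and have the same time derivative c² u_yy + w_y.
  have Vy : ∀ x y t, 0 ≤ x → 0 ≤ t → (c : ℂ) * dy V x y t = dt u x y t + bdryOp b u x y t := by
    intro x y t hx ht
    have h := transportInt_eq (θ := 0) le_rfl (v := dy v)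
      (a := fun x y t => 0 + (c : ℂ)⁻¹ * (fun x y t => dt u x y t + 1 * bdryOp b u x y t) x y t)
      (contDiff_add_mul s0 sa _) (continuous_dy sv) (fun x y t hx ht => ?_) (fun x y hx => ?_)
      hx ht (y := y)
    · rw [hV, dy_transportInt sv, h]
      field_simp
      ring
    · rw [dt_add_mul s0 sa, dt_add_mul st sp, hv, dy_add_mul scy sw, dy_add_mul s0 sy, hw,
        dy_add_mul sz sp, dy_conjOp hu hx ht]
      have e1 : dx (bdryOp b u) x y t = dx (dx u) x y t + (-Complex.I * b) * dx (dy u) x y t :=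
        dx_add_mul (s1 (contDiff_dx su)) sy _ x y t
      have e2 : dy (bdryOp b u) x y t = dy (dx u) x y t + (-Complex.I * b) * dy (dy u) x y t :=
        dy_add_mul (s1 (contDiff_dx su)) sy _ x y t
      have e3 : dt (fun _ _ _ => (0 : ℂ)) x y t = 0 := by simp [dt]
      have e4 : dy (fun _ _ _ => (0 : ℂ)) x y t = 0 := by simp [dy]
      have e5 : (c : ℂ) ^ 2 = 1 - (b : ℂ) ^ 2 := by exact_mod_cast hcsq
      rw [e1, e2, e3, e4, hu.equation x y t hx ht, dx_dy_comm su]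
      simp only [Complex.ofReal_zero, zero_mul, sub_zero, add_zero, zero_add, one_mul]
      field_simp
      linear_combination -(dy (dy u) x y t) * e5 + (b : ℂ) ^ 2 * dy (dy u) x y t * Complex.I_sq
    · simp [hu.initial_dt x y hx, bdryOp_initial hu y hx]
  have cu0 : Continuous (unc u) := su.continuous
  have cV := sV.continuous
  have cut := continuous_dt (s1 su)
  have cuy := continuous_dy (s1 su)
  have cVt := continuous_dt sV
  have cVy := continuous_dy sV
  have cp := sp.continuous
  have cw := sw.continuous
  have cz := sz.continuous
  unfold unc at cu0 cV cut cuy cVt cVy cp cw cz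
  -- Energy law on x = 0 for the symmetric system u_t = c V_y - p, V_t = c u_y + w/c; its speed c ≤
  -- 1 is dominated by the unit-speed cutoff.
  have key := weighted_balance_line (η := η) (C := 1) (R := R) (T := T) zero_le_one hR hT
    (e := fun y t => 1 / 2 * (‖u 0 y t‖ ^ 2 + ‖V 0 y t‖ ^ 2))
    (h := fun y t => c * inner ℝ (u 0 y t) (V 0 y t))
    (s := fun y t => - inner ℝ (u 0 y t) (bdryOp b u 0 y t) + c⁻¹ * inner ℝ (V 0 y t) (w 0 y t))
    (e' := fun y t => 1 / 2 * (2 * inner ℝ (u 0 y t) (dt u 0 y t) +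
      2 * inner ℝ (V 0 y t) (dt V 0 y t)))
    (h' := fun y t => c * (inner ℝ (u 0 y t) (dy V 0 y t) + inner ℝ (dy u 0 y t) (V 0 y t)))
    (by fun_prop) (by fun_prop) (by fun_prop) (by fun_prop) (by fun_prop)
    (fun y t => ((hasDerivAt_dt (s1 su) 0 y t).norm_sq.add
      (hasDerivAt_dt sV 0 y t).norm_sq).const_mul _)
    (fun y t => ((hasDerivAt_dy (s1 su) 0 y t).inner ℝ (hasDerivAt_dy sV 0 y t)).const_mul c)
    (fun y t ht => by
      have e1 : dt u 0 y t = c • dy V 0 y t - bdryOp b u 0 y t := by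
        rw [Complex.real_smul, Vy 0 y t le_rfl ht]
        ring
      have e2 : dt V 0 y t = c • dy u 0 y t + c⁻¹ • w 0 y t := by
        rw [Vt, hv, Complex.real_smul, Complex.real_smul]
        push_cast
        ring
      rw [e1, e2, inner_sub_right, inner_add_right, real_inner_smul_right, real_inner_smul_right,
        real_inner_smul_right, real_inner_comm (V 0 y t) (dy u 0 y t)]
      ring)
    (fun y t _ => by
      rw [abs_mul, abs_of_pos hc0, one_mul]
      refine (mul_le_of_le_one_left (abs_nonneg _) hc1).trans
        ((abs_real_inner_le_norm _ _).trans ?_)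
      nlinarith [sq_nonneg (‖u 0 y t‖ - ‖V 0 y t‖)])
    (fun y t _ => by positivity)
    (fun y => by simp [hu.initial 0 y le_rfl, hV, transportInt_zero])
  have k1 : bdryW η 1 R T (fun q => - inner ℝ (u 0 q.1 q.2) (bdryOp b u 0 q.1 q.2) +
      c⁻¹ * inner ℝ (V 0 q.1 q.2) (w 0 q.1 q.2)) ≤
      bdryW η 1 R T (fun q => η * (1 / 2 * (‖u 0 q.1 q.2‖ ^ 2 + ‖V 0 q.1 q.2‖ ^ 2)) +
        (1 / (2 * η) * (1 + 2 / c ^ 2) * ‖bdryOp b u 0 q.1 q.2‖ ^ 2 +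
        1 / (2 * η) * (2 / c ^ 2) * ‖conjOp b u 0 q.1 q.2‖ ^ 2)) := by
    refine bdryW_mono (by fun_prop) (by fun_prop) fun q _ => ?_
    have h1 := two_inner_le hη (u 0 q.1 q.2) (-bdryOp b u 0 q.1 q.2)
    have h2 := two_inner_le hη (V 0 q.1 q.2) (c⁻¹ • w 0 q.1 q.2)
    rw [inner_neg_right, norm_neg] at h1
    rw [real_inner_smul_right, norm_smul, mul_pow, Real.norm_eq_abs, sq_abs] at h2
    have h3 : ‖w 0 q.1 q.2‖ ^ 2 ≤
        2 * (‖conjOp b u 0 q.1 q.2‖ ^ 2 + ‖bdryOp b u 0 q.1 q.2‖ ^ 2) := by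
      have h4 : ‖w 0 q.1 q.2‖ ≤ ‖conjOp b u 0 q.1 q.2‖ + ‖bdryOp b u 0 q.1 q.2‖ := by
        refine (norm_add_le _ _).trans (add_le_add_right ?_ _)
        rw [norm_mul]
        exact mul_le_of_le_one_left (norm_nonneg _) (by simpa using hb.le)
      have h5 := pow_le_pow_left₀ (norm_nonneg _) h4 2
      nlinarith [sq_nonneg (‖conjOp b u 0 q.1 q.2‖ - ‖bdryOp b u 0 q.1 q.2‖)]
    have h6 := mul_le_mul_of_nonneg_left h3 (by positivity : 0 ≤ 1 / η * c⁻¹ ^ 2)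
    have h7 : 1 / (2 * η) * (1 + 2 / c ^ 2) * ‖bdryOp b u 0 q.1 q.2‖ ^ 2 +
        1 / (2 * η) * (2 / c ^ 2) * ‖conjOp b u 0 q.1 q.2‖ ^ 2 =
        1 / 2 * (1 / η * ‖bdryOp b u 0 q.1 q.2‖ ^ 2 + 1 / η * c⁻¹ ^ 2 *
          (2 * (‖conjOp b u 0 q.1 q.2‖ ^ 2 + ‖bdryOp b u 0 q.1 q.2‖ ^ 2))) := by
      field_simp
      ring
    linarith
  have k0 : bdryW η 1 R T (fun q => η * (1 / 2 * (‖u 0 q.1 q.2‖ ^ 2 + ‖V 0 q.1 q.2‖ ^ 2)) +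
        (1 / (2 * η) * (1 + 2 / c ^ 2) * ‖bdryOp b u 0 q.1 q.2‖ ^ 2 +
        1 / (2 * η) * (2 / c ^ 2) * ‖conjOp b u 0 q.1 q.2‖ ^ 2)) =
      η * bdryW η 1 R T (fun q => 1 / 2 * (‖u 0 q.1 q.2‖ ^ 2 + ‖V 0 q.1 q.2‖ ^ 2)) +
      (1 / (2 * η) * (1 + 2 / c ^ 2) * bdryW η 1 R T (fun q => ‖bdryOp b u 0 q.1 q.2‖ ^ 2) +
        1 / (2 * η) * (2 / c ^ 2) * bdryW η 1 R T (fun q => ‖conjOp b u 0 q.1 q.2‖ ^ 2)) := by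
    rw [bdryW_add (by fun_prop) (by fun_prop), bdryW_add (by fun_prop) (by fun_prop),
      ← bdryW_const_mul, ← bdryW_const_mul, ← bdryW_const_mul]
  have k2 : 2 * η * bdryW η 1 R T (fun q => 1 / 2 * (‖u 0 q.1 q.2‖ ^ 2 + ‖V 0 q.1 q.2‖ ^ 2)) ≤
      bdryW η 1 R T (fun q => - inner ℝ (u 0 q.1 q.2) (bdryOp b u 0 q.1 q.2) +
      c⁻¹ * inner ℝ (V 0 q.1 q.2) (w 0 q.1 q.2)) := key
  have k3 : bdryW η 1 R T (fun q => ‖u 0 q.1 q.2‖ ^ 2) ≤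
      bdryW η 1 R T (fun q => 2 * (1 / 2 * (‖u 0 q.1 q.2‖ ^ 2 + ‖V 0 q.1 q.2‖ ^ 2))) :=
    bdryW_mono (by fun_prop) (by fun_prop) fun q _ => by
      linarith [sq_nonneg ‖V 0 q.1 q.2‖]
  rw [bdryW_const_mul] at k3
  have k4 := mul_le_mul_of_nonneg_left (conjOp_trace_estimate hu hη hR hT)
    (by positivity : 0 ≤ 1 / (2 * η) * (2 / c ^ 2))
  have k5 := mul_le_mul_of_nonneg_left k3 hη.le
  have k6 : η * bdryW η 1 R T (fun q => ‖u 0 q.1 q.2‖ ^ 2) ≤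
      (1 + 4 / c ^ 2) / η * bdryW η 1 R T (fun q => ‖bdryOp b u 0 q.1 q.2‖ ^ 2) := by
    have k7 : (1 + 4 / c ^ 2) / η * bdryW η 1 R T (fun q => ‖bdryOp b u 0 q.1 q.2‖ ^ 2) =
        2 * (1 / (2 * η) * (1 + 2 / c ^ 2) *
          bdryW η 1 R T (fun q => ‖bdryOp b u 0 q.1 q.2‖ ^ 2) + 1 / (2 * η) * (2 / c ^ 2) *
          bdryW η 1 R T (fun q => ‖bdryOp b u 0 q.1 q.2‖ ^ 2)) := by
      field_simp
      ring
    linarith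
  rw [← hcsq]
  have k8 := mul_le_mul_of_nonneg_left k6 (by positivity : 0 ≤ 1 / η)
  refine le_trans (le_of_eq ?_) (k8.trans (le_of_eq ?_))
  · field_simp
  · field_simp

end

/-- Boundary stability for `u_x = i b u_y + g` with `|b| < 1`. -/
theorem boundaryStable_of_abs_lt_one {b : ℝ} (hb : |b| < 1) : BoundaryStable (Complex.I * b) := by
  have hc2 : 0 < 1 - b ^ 2 := by
    have := (sq_lt_one_iff_abs_lt_one b).2 hb
    linarith
  refine ⟨1, 1 + 4 / (1 - b ^ 2), 2, one_pos, by positivity, two_pos, ?_⟩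
  intro g u hg hu η T hη1 hT
  have hη : 0 < η := by linarith
  have cu : Continuous (unc u) := hu.smooth.continuous
  have cg : Continuous fun q : ℝ × ℝ => g q.1 q.2 := hg.1.continuous
  rw [Real.rpow_ofNat, sqNormBdry_eq, sqNormBdry_eq]
  refine weightedInt_bdry_le (N := fun q => ‖u 0 q.1 q.2‖ ^ 2) (C := 1) zero_le_one hT
    (by unfold unc at cu; fun_prop) (fun _ => sq_nonneg _) fun R hR => ?_
  have h1 := boundary_estimate hu hb hη hR hT
  rw [bdryW_congr (N := fun q => ‖bdryOp b u 0 q.1 q.2‖ ^ 2) (M := fun q => ‖g q.1 q.2‖ ^ 2) fun q hq => by rw [bdryOp_eq hu _ hq]] at h1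
  refine (ENNReal.ofReal_le_ofReal h1).trans ?_
  rw [ENNReal.ofReal_mul (by positivity)]
  exact mul_le_mul_right (le_weightedInt_bdry η 1 T R (M := fun q => ‖g q.1 q.2‖ ^ 2)
    (by fun_prop) fun _ => sq_nonneg _) _

theorem stable_of_abs_lt_one {b : ℝ} (hb : |b| < 1) : Stable (Complex.I * b) :=
  ⟨boundaryStable_of_abs_lt_one hb, interiorEstimate_of_abs_lt_one hb⟩

/-! ### Compactly supported solutions and their norms. -/

section CompactSupport

variable {v : ℝ → ℝ → ℝ → ℂ}

lemma hasCompactSupport_dx (hv : ContDiff ℝ 1 (unc v)) (h : HasCompactSupport (unc v)) :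
    HasCompactSupport (unc (dx v)) := by
  rw [dx_eq_fderiv hv]
  exact (h.fderiv ℝ).comp_left (g := fun L : ℝ × ℝ × ℝ →L[ℝ] ℂ => L (1, 0, 0)) rfl

lemma hasCompactSupport_dy (hv : ContDiff ℝ 1 (unc v)) (h : HasCompactSupport (unc v)) :
    HasCompactSupport (unc (dy v)) := by
  rw [dy_eq_fderiv hv]
  exact (h.fderiv ℝ).comp_left (g := fun L : ℝ × ℝ × ℝ →L[ℝ] ℂ => L (0, 1, 0)) rfl

lemma hasCompactSupport_dt (hv : ContDiff ℝ 1 (unc v)) (h : HasCompactSupport (unc v)) :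
    HasCompactSupport (unc (dt v)) := by
  rw [dt_eq_fderiv hv]
  exact (h.fderiv ℝ).comp_left (g := fun L : ℝ × ℝ × ℝ →L[ℝ] ℂ => L (0, 0, 1)) rfl

end CompactSupport

/-- The wave operator `u_tt - u_xx - u_yy`. -/
noncomputable def dAlembert (u : ℝ → ℝ → ℝ → ℂ) (x y t : ℝ) : ℂ :=
  dt (dt u) x y t - dx (dx u) x y t - dy (dy u) x y t

section dAlembert

variable {u : ℝ → ℝ → ℝ → ℂ} (su : ContDiff ℝ ∞ (unc u)) (hc : HasCompactSupport (unc u))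
include su

lemma contDiff_dAlembert : ContDiff ℝ ∞ (unc (dAlembert u)) :=
  ((contDiff_dt (contDiff_dt su)).sub (contDiff_dx (contDiff_dx su))).sub
    (contDiff_dy (contDiff_dy su))

include hc

lemma isSource_dAlembert : IsSource (dAlembert u) := by
  have su1 : ContDiff ℝ 1 (unc u) := su.of_le (by simp)
  refine ⟨contDiff_dAlembert su, ?_⟩
  have ht := hasCompactSupport_dt ((contDiff_dt su).of_le (by simp)) (hasCompactSupport_dt su1 hc)
  have hx := hasCompactSupport_dx ((contDiff_dx su).of_le (by simp)) (hasCompactSupport_dx su1 hc)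
  have hy := hasCompactSupport_dy ((contDiff_dy su).of_le (by simp)) (hasCompactSupport_dy su1 hc)
  refine HasCompactSupport.intro (((ht.isCompact.union hx.isCompact).union hy.isCompact)) ?_
  intro p hp
  simp only [mem_union, not_or] at hp
  have e1 := image_eq_zero_of_notMem_tsupport hp.1.1
  have e2 := image_eq_zero_of_notMem_tsupport hp.1.2
  have e3 := image_eq_zero_of_notMem_tsupport hp.2
  simp only [unc] at e1 e2 e3
  simp [dAlembert, e1, e2, e3]

/-- A compactly supported function is a solution with its own image under the wave operator as
source, if it satisfies the boundary and initial conditions. -/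
lemma isSolution_dAlembert {β : ℂ} (hb : ∀ y t : ℝ, 0 ≤ t → dx u 0 y t = β * dy u 0 y t)
    (h0 : ∀ x y : ℝ, 0 ≤ x → u x y 0 = 0) (h1 : ∀ x y : ℝ, 0 ≤ x → dt u x y 0 = 0) :
    IsSolution β (dAlembert u) (fun _ _ => 0) u where
  smooth := su
  memL2 t _ := by
    have hcont : Continuous fun p : ℝ × ℝ => u p.1 p.2 t := by
      have := su.continuous
      unfold unc at this
      fun_prop
    refine MemLp.restrict _ (hcont.memLp_of_hasCompactSupport ?_)
    refine HasCompactSupport.intro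
      (hc.isCompact.image (by fun_prop : Continuous fun p : ℝ × ℝ × ℝ => (p.1, p.2.1))) ?_
    intro p hp
    have : (p.1, p.2, t) ∉ tsupport (unc u) := fun h => hp ⟨_, h, rfl⟩
    exact image_eq_zero_of_notMem_tsupport (f := unc u) this
  equation x y t _ _ := by simp only [dAlembert]; ring
  boundary y t ht := by rw [hb y t ht, add_zero]
  initial := h0
  initial_dt := h1

end dAlembert

/-- The weighted square integral of `v` over `x ≥ 0`, `0 ≤ t ≤ T`. -/
noncomputable def slabInt (η T : ℝ) (v : ℝ × ℝ × ℝ → ℂ) : ℝ :=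
  ∫ p in slab T, Real.exp (-2 * η * p.2.2) * ‖v p‖ ^ 2

lemma integrableOn_slab {v : ℝ × ℝ × ℝ → ℂ} (cv : Continuous v) (hv : HasCompactSupport v)
    (η T : ℝ) : IntegrableOn (fun p => Real.exp (-2 * η * p.2.2) * ‖v p‖ ^ 2) (slab T) := by
  refine Integrable.integrableOn (Continuous.integrable_of_hasCompactSupport (by fun_prop) ?_)
  exact HasCompactSupport.intro hv.isCompact fun p hp => by
    simp [image_eq_zero_of_notMem_tsupport hp]

lemma slabInt_nonneg (η T : ℝ) (v : ℝ × ℝ × ℝ → ℂ) : 0 ≤ slabInt η T v :=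
  integral_nonneg fun _ => by positivity

/-- Compact support makes the extended integrals finite, so the estimates become inequalities
between real numbers, where terms can be subtracted. -/
lemma weightedInt_eq_slabInt {v : ℝ → ℝ → ℝ → ℂ} (cv : Continuous (unc v))
    (hv : HasCompactSupport (unc v)) (η T : ℝ) :
    weightedInt η T (sqNormL2 v) = ENNReal.ofReal (slabInt η T (unc v)) := by
  have cv2 : Continuous fun p => ‖unc v p‖ ^ 2 := by fun_prop
  rw [sqNormL2_eq, weightedInt_interior η T (N := fun p => ENNReal.ofReal (‖unc v p‖ ^ 2))
    cv2.measurable.ennreal_ofReal, slabInt, ofReal_integral_eq_lintegral_ofReal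
    (integrableOn_slab cv hv η T) (Filter.Eventually.of_forall fun _ => by positivity)]
  refine lintegral_congr fun p => ?_
  rw [ENNReal.ofReal_mul (Real.exp_pos _).le]

lemma slabInt_le_add {u v w : ℝ × ℝ × ℝ → ℂ} {η T a b : ℝ} (cu : Continuous u)
    (hu : HasCompactSupport u) (cv : Continuous v) (hv : HasCompactSupport v) (cw : Continuous w)
    (hw : HasCompactSupport w) (h : ∀ p, ‖u p‖ ^ 2 ≤ a * ‖v p‖ ^ 2 + b * ‖w p‖ ^ 2) :
    slabInt η T u ≤ a * slabInt η T v + b * slabInt η T w := by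
  simp only [slabInt]
  rw [← integral_const_mul, ← integral_const_mul, ← integral_add
    ((integrableOn_slab cv hv η T).const_mul a) ((integrableOn_slab cw hw η T).const_mul b)]
  refine integral_mono (integrableOn_slab cu hu η T)
    (((integrableOn_slab cv hv η T).const_mul a).add
      ((integrableOn_slab cw hw η T).const_mul b)) fun p => ?_
  have := mul_le_mul_of_nonneg_left (h p) (Real.exp_pos (-2 * η * p.2.2)).le
  beta_reduce
  linarith

/-! ### High-frequency plane waves. -/

/-- The plane wave `e^{iμ(x + ky - τt)}` times the amplitude `A`. -/
noncomputable def modulated (μ k τ : ℝ) (A : ℝ → ℝ → ℝ → ℂ) (x y t : ℝ) : ℂ :=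
  Complex.exp (Complex.I * μ * (x + k * y - τ * t)) * A x y t

section Modulated

variable {μ k τ : ℝ} {A : ℝ → ℝ → ℝ → ℂ}

/-- The phase is real, so modulation does not change the modulus and hence no weighted norm. -/
lemma norm_modulated (x y t : ℝ) : ‖modulated μ k τ A x y t‖ = ‖A x y t‖ := by
  have : Complex.I * μ * (x + k * y - τ * t) = ((μ * (x + k * y - τ * t) : ℝ) : ℂ) * Complex.I := by
    push_cast
    ring
  rw [modulated, norm_mul, this, Complex.norm_exp_ofReal_mul_I, one_mul]

lemma contDiff_modulated (sA : ContDiff ℝ ∞ (unc A)) :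
    ContDiff ℝ ∞ (unc (modulated μ k τ A)) := by
  have h1 : ContDiff ℝ ∞ fun p : ℝ × ℝ × ℝ =>
      Complex.I * μ * ((p.1 : ℂ) + k * (p.2.1 : ℂ) - τ * (p.2.2 : ℂ)) := by
    have hx : ContDiff ℝ ∞ fun p : ℝ × ℝ × ℝ => (p.1 : ℂ) :=
      Complex.ofRealCLM.contDiff.comp (by fun_prop)
    have hy : ContDiff ℝ ∞ fun p : ℝ × ℝ × ℝ => (p.2.1 : ℂ) :=
      Complex.ofRealCLM.contDiff.comp (by fun_prop)
    have ht : ContDiff ℝ ∞ fun p : ℝ × ℝ × ℝ => (p.2.2 : ℂ) :=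
      Complex.ofRealCLM.contDiff.comp (by fun_prop)
    fun_prop
  exact h1.cexp.mul sA

lemma hasCompactSupport_modulated (hA : HasCompactSupport (unc A)) :
    HasCompactSupport (unc (modulated μ k τ A)) :=
  HasCompactSupport.mul_left hA

variable (sA : ContDiff ℝ 1 (unc A))
include sA

lemma dx_modulated : dx (modulated μ k τ A) =
    modulated μ k τ (fun x y t => dx A x y t + (Complex.I * μ) * A x y t) := by
  funext x y t
  have h0 : HasDerivAt (fun s : ℝ => Complex.I * μ * ((s : ℂ) + k * y - τ * t))
      (Complex.I * μ) x := by
    simpa using ((((hasDerivAt_id x).ofReal_comp).add_const (k * y : ℂ)).sub_const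
      (τ * t : ℂ)).const_mul (Complex.I * μ)
  refine (h0.cexp.mul (hasDerivAt_dx sA x y t)).deriv.trans ?_
  simp only [modulated]
  ring

lemma dy_modulated : dy (modulated μ k τ A) =
    modulated μ k τ (fun x y t => dy A x y t + (Complex.I * μ * k) * A x y t) := by
  funext x y t
  have h0 : HasDerivAt (fun s : ℝ => Complex.I * μ * ((x : ℂ) + k * s - τ * t))
      (Complex.I * μ * k) y := by
    simpa using (((((hasDerivAt_id y).ofReal_comp).const_mul (k : ℂ)).const_add (x : ℂ)).sub_const
      (τ * t : ℂ)).const_mul (Complex.I * μ)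
  refine (h0.cexp.mul (hasDerivAt_dy sA x y t)).deriv.trans ?_
  simp only [modulated]
  ring

lemma dt_modulated : dt (modulated μ k τ A) =
    modulated μ k τ (fun x y t => dt A x y t + (-(Complex.I * μ * τ)) * A x y t) := by
  funext x y t
  have h0 : HasDerivAt (fun s : ℝ => Complex.I * μ * ((x : ℂ) + k * y - τ * s))
      (-(Complex.I * μ * τ)) t := by
    simpa using ((((hasDerivAt_id t).ofReal_comp).const_mul (τ : ℂ)).const_sub
      (x + k * y : ℂ)).const_mul (Complex.I * μ)
  refine (h0.cexp.mul (hasDerivAt_dt sA x y t)).deriv.trans ?_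
  simp only [modulated]
  ring

end Modulated

/-- Transport along the rays of the plane wave. -/
noncomputable def rayOp (k τ : ℝ) (A : ℝ → ℝ → ℝ → ℂ) (x y t : ℝ) : ℂ :=
  τ * dt A x y t + dx A x y t + k * dy A x y t

lemma continuous_rayOp {k τ : ℝ} {A : ℝ → ℝ → ℝ → ℂ} (sA : ContDiff ℝ 1 (unc A)) :
    Continuous (unc (rayOp k τ A)) :=
  ((continuous_const.mul (continuous_dt sA)).add (continuous_dx sA)).add
    (continuous_const.mul (continuous_dy sA))

lemma hasCompactSupport_rayOp {k τ : ℝ} {A : ℝ → ℝ → ℝ → ℂ} (sA : ContDiff ℝ 1 (unc A))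
    (hA : HasCompactSupport (unc A)) : HasCompactSupport (unc (rayOp k τ A)) := by
  have ht := hasCompactSupport_dt sA hA
  have hx := hasCompactSupport_dx sA hA
  have hy := hasCompactSupport_dy sA hA
  refine HasCompactSupport.intro (((ht.isCompact.union hx.isCompact).union hy.isCompact)) ?_
  intro p hp
  simp only [mem_union, not_or] at hp
  have e1 := image_eq_zero_of_notMem_tsupport hp.1.1
  have e2 := image_eq_zero_of_notMem_tsupport hp.1.2
  have e3 := image_eq_zero_of_notMem_tsupport hp.2
  simp only [unc] at e1 e2 e3
  simp [rayOp, e1, e2, e3]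

/-- The relation τ² = 1 + k² cancels the terms of order μ²; those of order μ form the derivative
along the rays. -/
lemma dAlembert_modulated {μ k τ : ℝ} (hτ : τ ^ 2 = 1 + k ^ 2) {A : ℝ → ℝ → ℝ → ℂ}
    (sA : ContDiff ℝ ∞ (unc A)) : dAlembert (modulated μ k τ A) =
      modulated μ k τ (fun x y t => dAlembert A x y t + (-(2 * Complex.I * μ)) *
        rayOp k τ A x y t) := by
  have s1 : ∀ {v : ℝ → ℝ → ℝ → ℂ}, ContDiff ℝ ∞ (unc v) → ContDiff ℝ 1 (unc v) :=
    fun h => h.of_le (by simp)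
  have sx := contDiff_dx sA
  have sy := contDiff_dy sA
  have st := contDiff_dt sA
  funext x y t
  have hτ' : (τ : ℂ) ^ 2 = 1 + (k : ℂ) ^ 2 := by exact_mod_cast hτ
  rw [dAlembert, dt_modulated (s1 sA), dx_modulated (s1 sA), dy_modulated (s1 sA),
    dt_modulated (contDiff_add_mul (s1 st) (s1 sA) _),
    dx_modulated (contDiff_add_mul (s1 sx) (s1 sA) _),
    dy_modulated (contDiff_add_mul (s1 sy) (s1 sA) _)]
  simp only [modulated, rayOp, dAlembert, dt_add_mul (s1 st) (s1 sA), dx_add_mul (s1 sx) (s1 sA),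
    dy_add_mul (s1 sy) (s1 sA)]
  linear_combination Complex.exp (Complex.I * μ * (x + k * y - τ * t)) * A x y t *
    (Complex.I * μ) ^ 2 * hτ'

lemma norm_add_sq_le (z w : ℂ) : ‖z + w‖ ^ 2 ≤ 2 * ‖z‖ ^ 2 + 2 * ‖w‖ ^ 2 := by
  have h := pow_le_pow_left₀ (norm_nonneg _) (norm_add_le z w) 2
  nlinarith [sq_nonneg (‖z‖ - ‖w‖)]

/-- The interior estimate, tested on modulated plane waves of high frequency, bounds amplitudes by
their derivative along the rays. -/
theorem ray_estimate_of_interiorEstimate {b : ℝ} (hb : b ≠ 0) (h : InteriorEstimate (b : ℂ))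
    {τ : ℝ} (hτ0 : 0 < τ) (hτ : τ ^ 2 = 1 + b⁻¹ ^ 2) :
    ∃ η κ : ℝ, 0 ≤ η ∧ 0 ≤ κ ∧ ∀ T : ℝ, 0 ≤ T → ∀ A : ℝ → ℝ → ℝ → ℂ, ContDiff ℝ ∞ (unc A) →
      HasCompactSupport (unc A) → (∀ x y : ℝ, 0 ≤ x → A x y 0 = 0) →
      (∀ x y : ℝ, 0 ≤ x → dt A x y 0 = 0) →
      (∀ y t : ℝ, 0 ≤ t → dx A 0 y t = b * dy A 0 y t) →
      slabInt η T (unc A) ≤ κ * slabInt η T (unc (rayOp b⁻¹ τ A)) := by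
  obtain ⟨η₀, K, α, hη₀, hK, hα, hest⟩ := h
  -- One fixed admissible η > 0 suffices; the contradiction is sought in the frequency, not in η.
  set η := max η₀ 1 with hη
  have hη0 : 0 < η := lt_of_lt_of_le one_pos (le_max_right _ _)
  set K' := K / η ^ α with hK'
  have hK'0 : 0 ≤ K' := by positivity
  refine ⟨η, 16 * K' / τ ^ 2, hη0.le, by positivity, ?_⟩
  intro T hT A sA hA h0 h1 hbd
  have sA1 : ContDiff ℝ 1 (unc A) := sA.of_le (by simp)
  set k := b⁻¹ with hk
  have hmain : ∀ μ : ℝ, 0 < μ → μ ^ 2 * (τ ^ 2 * slabInt η T (unc A)) ≤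
      μ ^ 2 * (16 * K' * slabInt η T (unc (rayOp k τ A))) +
      (4 * K' * slabInt η T (unc (dAlembert A)) + 2 * slabInt η T (unc (dt A))) := by
    intro μ hμ
    set u := modulated μ k τ A with hu
    have su : ContDiff ℝ ∞ (unc u) := contDiff_modulated sA
    have su1 : ContDiff ℝ 1 (unc u) := su.of_le (by simp)
    have hcu : HasCompactSupport (unc u) := hasCompactSupport_modulated hA
    have hsol : IsSolution (b : ℂ) (dAlembert u) (fun _ _ => 0) u := by
      refine isSolution_dAlembert su hcu (fun y t ht => ?_) (fun x y hx => ?_) fun x y hx => ?_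
      -- Since bk = 1 the phase itself satisfies the boundary condition, so only the condition on
      -- the amplitude is left.
      · have hbk : (b : ℂ) * (k : ℂ) = 1 := by
          rw [hk]
          push_cast
          exact mul_inv_cancel₀ (by exact_mod_cast hb)
        rw [hu, dx_modulated sA1, dy_modulated sA1]
        simp only [modulated, hbd y t ht]
        linear_combination -(Complex.exp (Complex.I * μ * ((0 : ℝ) + k * y - τ * t)) *
          Complex.I * μ * A 0 y t) * hbk
      · simp [hu, modulated, h0 x y hx]
      · rw [hu, dt_modulated sA1]
        simp [modulated, h0 x y hx, h1 x y hx]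
    have e1 := hest _ u (isSource_dAlembert su hcu) hsol η T (le_max_left _ _) hη0 hT
    -- Of the left-hand side only u_t is kept; it already grows like μτ|A|.
    have e2 : weightedInt η T (sqNormL2 (dt u)) ≤ weightedInt η T
        (fun t => sqNormH1 u t + sqNormL2 (dt u) t + sqNormBdry (u 0) t) := by
      refine lintegral_mono fun t => ?_
      exact mul_le_mul_right (le_add_right le_add_self) _
    have cF : Continuous (unc (dAlembert u)) := (contDiff_dAlembert su).continuous
    have hF : HasCompactSupport (unc (dAlembert u)) := (isSource_dAlembert su hcu).2
    have cut := continuous_dt su1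
    have hut := hasCompactSupport_dt su1 hcu
    have e3 := e2.trans e1
    rw [weightedInt_eq_slabInt cut hut, weightedInt_eq_slabInt cF hF,
      ← ENNReal.ofReal_mul hK'0,
      ENNReal.ofReal_le_ofReal_iff (mul_nonneg hK'0 (slabInt_nonneg _ _ _))] at e3
    have cAt := continuous_dt sA1
    have hAt := hasCompactSupport_dt sA1 hA
    have cR : Continuous (unc (rayOp k τ A)) := continuous_rayOp sA1
    have hR : HasCompactSupport (unc (rayOp k τ A)) := hasCompactSupport_rayOp sA1 hA
    have e4 : slabInt η T (unc (dAlembert u)) ≤ 2 * slabInt η T (unc (dAlembert A)) +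
        8 * μ ^ 2 * slabInt η T (unc (rayOp k τ A)) := by
      refine slabInt_le_add cF hF (contDiff_dAlembert sA).continuous (isSource_dAlembert sA hA).2
        cR hR fun p => ?_
      simp only [unc]
      rw [hu, dAlembert_modulated hτ sA, norm_modulated]
      refine (norm_add_sq_le _ _).trans (le_of_eq ?_)
      rw [norm_mul, mul_pow]
      simp only [norm_neg, norm_mul, Complex.norm_I, Complex.norm_real, Complex.norm_ofNat,
        Real.norm_eq_abs, mul_pow, sq_abs]
      ring
    have e5 : slabInt η T (unc A) ≤ 2 / (μ ^ 2 * τ ^ 2) * slabInt η T (unc (dt u)) +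
        2 / (μ ^ 2 * τ ^ 2) * slabInt η T (unc (dt A)) := by
      refine slabInt_le_add sA.continuous hA cut hut cAt hAt fun p => ?_
      have e6 := norm_add_sq_le (unc (dt A) p + (-(Complex.I * μ * τ)) * unc A p) (-unc (dt A) p)
      have e7 : unc (dt A) p + (-(Complex.I * μ * τ)) * unc A p + -unc (dt A) p =
          -(Complex.I * μ * τ) * unc A p := by ring
      have e8 : ‖unc (dt u) p‖ = ‖unc (dt A) p + (-(Complex.I * μ * τ)) * unc A p‖ := by
        simp only [unc]
        rw [hu, dt_modulated sA1, norm_modulated]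
      rw [e7, ← e8, norm_mul, mul_pow, norm_neg] at e6
      simp only [norm_neg, norm_mul, Complex.norm_I, Complex.norm_real, one_mul,
        Real.norm_eq_abs, mul_pow, sq_abs] at e6
      have hpos : 0 < μ ^ 2 * τ ^ 2 := by positivity
      rw [div_mul_eq_mul_div, div_mul_eq_mul_div, ← add_div, le_div_iff₀ hpos]
      linarith
    have hpos : 0 < μ ^ 2 * τ ^ 2 := by positivity
    rw [div_mul_eq_mul_div, div_mul_eq_mul_div, ← add_div, le_div_iff₀ hpos] at e5
    have e9 := mul_le_mul_of_nonneg_left e4 hK'0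
    linarith
  have hτ2 : 0 < τ ^ 2 := by positivity
  rw [div_mul_eq_mul_div, le_div_iff₀ hτ2, mul_comm _ (τ ^ 2)]
  set D := 4 * K' * slabInt η T (unc (dAlembert A)) + 2 * slabInt η T (unc (dt A)) with hD
  -- If the leading coefficients were in the wrong order with gap d, then μ²d ≤ D for every μ > 0,
  -- which fails at μ = D/d + 1.
  by_contra hlt
  rw [not_le] at hlt
  set d := τ ^ 2 * slabInt η T (unc A) - 16 * K' * slabInt η T (unc (rayOp k τ A)) with hd
  have hd0 : 0 < d := sub_pos.2 hlt
  have hD0 : 0 ≤ D := add_nonneg (mul_nonneg (by positivity) (slabInt_nonneg _ _ _))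
    (mul_nonneg two_pos.le (slabInt_nonneg _ _ _))
  have hm := hmain (D / d + 1) (by positivity)
  have hm2 : (D / d + 1) ^ 2 * d ≤ D := by
    rw [hd]
    linarith
  have h3 : D / d * d = D := div_mul_cancel₀ D hd0.ne'
  have h4 : 0 ≤ (D / d) ^ 2 * d := by positivity
  nlinarith

/-! ### Amplitudes carried by rays, and the boundary layer. -/

lemma exists_smooth_bump (c : ℝ) {r : ℝ} (hr : 0 < r) : ∃ f : ℝ → ℝ, ContDiff ℝ ∞ f ∧
    (∀ s, |s - c| ≤ r → f s = 1) ∧ ∀ s, 2 * r ≤ |s - c| → f s = 0 := by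
  let φ : ContDiffBump c := ⟨r, 2 * r, hr, by linarith⟩
  refine ⟨φ, φ.contDiff, fun s hs => φ.one_of_mem_closedBall ?_, fun s hs => φ.zero_of_le_dist ?_⟩
  · simpa [Metric.mem_closedBall, Real.dist_eq] using hs
  · simpa [Real.dist_eq] using hs

/-- Such a profile changes the normal derivative at the boundary without changing the trace. -/
lemma exists_boundary_profile : ∃ m : ℝ → ℝ, ContDiff ℝ ∞ m ∧ m 0 = 0 ∧ deriv m 0 = 1 ∧
    ∀ s, 1 ≤ |s| → m s = 0 := by
  obtain ⟨χ, sχ, h1, h0⟩ := exists_smooth_bump 0 (r := 1 / 2) (by norm_num)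
  refine ⟨fun s => s * χ s, contDiff_id.mul sχ, by simp, ?_, fun s hs => ?_⟩
  · have hd : HasDerivAt χ (deriv χ 0) 0 := (sχ.differentiable (by simp) 0).hasDerivAt
    have := ((hasDerivAt_id (0 : ℝ)).mul hd).deriv
    simp only [id] at this
    refine this.trans ?_
    rw [h1 0 (by norm_num)]
    simp
  · simp [h0 s (by simpa using hs)]

lemma exists_bound_of_zero_outside {m : ℝ → ℝ} (cm : Continuous m) (h : ∀ s, 1 < |s| → m s = 0) :
    ∃ M, 0 ≤ M ∧ ∀ s, |m s| ≤ M := by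
  obtain ⟨M, hM⟩ := (isCompact_Icc (a := (-1 : ℝ)) (b := 1)).exists_bound_of_continuousOn
    cm.continuousOn
  have hM0 : 0 ≤ M := (norm_nonneg _).trans (hM 0 (by norm_num))
  refine ⟨M, hM0, fun s => ?_⟩
  by_cases hs : |s| ≤ 1
  · exact hM s (abs_le.1 hs)
  · rw [h s (not_le.1 hs), abs_zero]
    exact hM0

lemma deriv_eq_zero_of_eqOn {f : ℝ → ℝ} {U : Set ℝ} (hU : IsOpen U) {c : ℝ}
    (h : ∀ s ∈ U, f s = c) {s : ℝ} (hs : s ∈ U) : deriv f s = 0 := by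
  have : f =ᶠ[nhds s] fun _ => c := by
    filter_upwards [hU.mem_nhds hs] with r hr using h r hr
  rw [this.deriv_eq]
  simp

/-- An amplitude constant along the rays where `ψ` is constant. -/
noncomputable def rayAmplitude (ψ f h : ℝ → ℝ) (k τ x y t : ℝ) : ℂ :=
  ((ψ x * (f (y - k * x) * h (t - τ * x)) : ℝ) : ℂ)

/-- The defect of `rayAmplitude` in the boundary condition. -/
noncomputable def rayDefect (f h : ℝ → ℝ) (b k τ : ℝ) (_x y t : ℝ) : ℂ :=
  (((b + k) * (deriv f y * h t) + τ * (f y * deriv h t) : ℝ) : ℂ)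

/-- A correction of `rayAmplitude` in a boundary layer of width `δ`. -/
noncomputable def layer (m f h : ℝ → ℝ) (b k τ δ x y t : ℝ) : ℂ :=
  ((δ * m (x / δ) : ℝ) : ℂ) * rayDefect f h b k τ x y t

section Amplitudes

variable {ψ f h m : ℝ → ℝ} {b k τ δ : ℝ}

lemma hasDerivAt_of_contDiff {f : ℝ → ℝ} (sf : ContDiff ℝ ∞ f) (s : ℝ) :
    HasDerivAt f (deriv f s) s := (sf.differentiable (by simp) s).hasDerivAt

lemma contDiff_deriv {f : ℝ → ℝ} (sf : ContDiff ℝ ∞ f) : ContDiff ℝ ∞ (deriv f) :=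
  ContDiff.iterate_deriv 1 sf

lemma contDiff_rayAmplitude (sψ : ContDiff ℝ ∞ ψ) (sf : ContDiff ℝ ∞ f) (sh : ContDiff ℝ ∞ h) :
    ContDiff ℝ ∞ (unc (rayAmplitude ψ f h k τ)) := by
  have : ContDiff ℝ ∞ fun p : ℝ × ℝ × ℝ =>
      ψ p.1 * (f (p.2.1 - k * p.1) * h (p.2.2 - τ * p.1)) :=
    (sψ.comp (by fun_prop)).mul ((sf.comp (by fun_prop)).mul (sh.comp (by fun_prop)))
  exact Complex.ofRealCLM.contDiff.comp this

lemma contDiff_rayDefect (sf : ContDiff ℝ ∞ f) (sh : ContDiff ℝ ∞ h) :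
    ContDiff ℝ ∞ (unc (rayDefect f h b k τ)) := by
  have sf' := contDiff_deriv sf
  have sh' := contDiff_deriv sh
  have : ContDiff ℝ ∞ fun p : ℝ × ℝ × ℝ =>
      (b + k) * (deriv f p.2.1 * h p.2.2) + τ * (f p.2.1 * deriv h p.2.2) :=
    (contDiff_const.mul ((sf'.comp (by fun_prop)).mul (sh.comp (by fun_prop)))).add
      (contDiff_const.mul ((sf.comp (by fun_prop)).mul (sh'.comp (by fun_prop))))
  exact Complex.ofRealCLM.contDiff.comp this

lemma contDiff_layer (sm : ContDiff ℝ ∞ m) (sf : ContDiff ℝ ∞ f) (sh : ContDiff ℝ ∞ h) :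
    ContDiff ℝ ∞ (unc (layer m f h b k τ δ)) := by
  have : ContDiff ℝ ∞ fun p : ℝ × ℝ × ℝ => δ * m (p.1 / δ) :=
    contDiff_const.mul (sm.comp (by fun_prop))
  exact (Complex.ofRealCLM.contDiff.comp this).mul (contDiff_rayDefect sf sh)

lemma dx_rayAmplitude (sψ : ContDiff ℝ ∞ ψ) (sf : ContDiff ℝ ∞ f) (sh : ContDiff ℝ ∞ h)
    (x y t : ℝ) : dx (rayAmplitude ψ f h k τ) x y t =
      ((deriv ψ x * (f (y - k * x) * h (t - τ * x)) +
        ψ x * (-k * deriv f (y - k * x) * h (t - τ * x) +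
          f (y - k * x) * (-τ * deriv h (t - τ * x))) : ℝ) : ℂ) := by
  have h1 : HasDerivAt (fun s => y - k * s) (-k) x := by
    simpa using ((hasDerivAt_id x).const_mul k).const_sub y
  have h2 : HasDerivAt (fun s => t - τ * s) (-τ) x := by
    simpa using ((hasDerivAt_id x).const_mul τ).const_sub t
  have h3 := (hasDerivAt_of_contDiff sψ x).mul (((hasDerivAt_of_contDiff sf _).comp x h1).mul
    ((hasDerivAt_of_contDiff sh _).comp x h2))
  refine h3.ofReal_comp.deriv.trans ?_
  simp only [Function.comp_apply, Pi.mul_apply]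
  push_cast
  ring

lemma dy_rayAmplitude (sf : ContDiff ℝ ∞ f) (x y t : ℝ) : dy (rayAmplitude ψ f h k τ) x y t =
      ((ψ x * (deriv f (y - k * x) * h (t - τ * x)) : ℝ) : ℂ) := by
  have h1 : HasDerivAt (fun s => s - k * x) 1 y := (hasDerivAt_id y).sub_const _
  have h3 := ((((hasDerivAt_of_contDiff sf _).comp y h1).mul_const (h (t - τ * x))).const_mul (ψ x))
  refine h3.ofReal_comp.deriv.trans ?_
  push_cast
  ring

lemma dt_rayAmplitude (sh : ContDiff ℝ ∞ h) (x y t : ℝ) : dt (rayAmplitude ψ f h k τ) x y t =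
      ((ψ x * (f (y - k * x) * deriv h (t - τ * x)) : ℝ) : ℂ) := by
  have h1 : HasDerivAt (fun s => s - τ * x) 1 t := (hasDerivAt_id t).sub_const _
  have h3 := ((((hasDerivAt_of_contDiff sh _).comp t h1).const_mul (f (y - k * x))).const_mul (ψ x))
  refine h3.ofReal_comp.deriv.trans ?_
  push_cast
  ring

/-- The arguments y - kx and t - τx are constant along the rays, so only the derivative of the
cutoff ψ survives. -/
lemma rayOp_rayAmplitude (sψ : ContDiff ℝ ∞ ψ) (sf : ContDiff ℝ ∞ f) (sh : ContDiff ℝ ∞ h)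
    (x y t : ℝ) : rayOp k τ (rayAmplitude ψ f h k τ) x y t =
      ((deriv ψ x * (f (y - k * x) * h (t - τ * x)) : ℝ) : ℂ) := by
  rw [rayOp, dx_rayAmplitude sψ sf sh, dy_rayAmplitude sf, dt_rayAmplitude sh]
  push_cast
  ring

lemma dx_layer (hδ : δ ≠ 0) (sm : ContDiff ℝ ∞ m) (x y t : ℝ) :
    dx (layer m f h b k τ δ) x y t = ((deriv m (x / δ) : ℝ) : ℂ) * rayDefect f h b k τ 0 y t := by
  have h1 : HasDerivAt (fun s => s / δ) (1 / δ) x := (hasDerivAt_id x).div_const δ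
  have h2 := ((((hasDerivAt_of_contDiff sm _).comp x h1).const_mul δ).ofReal_comp.mul_const
    (rayDefect f h b k τ 0 y t))
  refine h2.deriv.trans ?_
  congr 1
  norm_cast
  field_simp

lemma dy_layer (sf : ContDiff ℝ ∞ f) (sh : ContDiff ℝ ∞ h) (x y t : ℝ) :
    dy (layer m f h b k τ δ) x y t =
      ((δ * m (x / δ) : ℝ) : ℂ) * dy (rayDefect f h b k τ) 0 y t :=
  ((hasDerivAt_dy ((contDiff_rayDefect sf sh).of_le (by simp)) 0 y t).const_mul
    ((δ * m (x / δ) : ℝ) : ℂ)).deriv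

lemma dt_layer (sf : ContDiff ℝ ∞ f) (sh : ContDiff ℝ ∞ h) (x y t : ℝ) :
    dt (layer m f h b k τ δ) x y t =
      ((δ * m (x / δ) : ℝ) : ℂ) * dt (rayDefect f h b k τ) 0 y t :=
  ((hasDerivAt_dt ((contDiff_rayDefect sf sh).of_le (by simp)) 0 y t).const_mul
    ((δ * m (x / δ) : ℝ) : ℂ)).deriv

end Amplitudes

lemma rayOp_eq_zero_of_notMem_tsupport {k τ : ℝ} {v : ℝ → ℝ → ℝ → ℂ} (sv : ContDiff ℝ 1 (unc v))
    {p : ℝ × ℝ × ℝ} (hp : p ∉ tsupport (unc v)) : unc (rayOp k τ v) p = 0 := by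
  have h : fderiv ℝ (unc v) p = 0 :=
    image_eq_zero_of_notMem_tsupport fun h => hp (tsupport_fderiv_subset ℝ h)
  have e1 := congrFun (dx_eq_fderiv sv) p
  have e2 := congrFun (dy_eq_fderiv sv) p
  have e3 := congrFun (dt_eq_fderiv sv) p
  simp only [unc] at e1 e2 e3
  simp only [unc, rayOp, e1, e2, e3]
  rw [h]
  simp

/-- Only the part with 0 ≤ x ≤ δ, |y| ≤ 2, 0 ≤ t ≤ 3 counts, of volume 12δ. A bounded function on a
thin layer thus has a small norm. -/
lemma slabInt_le_of_support {η M δ : ℝ} (hη : 0 ≤ η) (hδ : 0 ≤ δ) {v : ℝ × ℝ × ℝ → ℂ}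
    (hM : ∀ p ∈ slab 3, ‖v p‖ ≤ M)
    (h0 : ∀ p, p ∉ Icc (-δ) δ ×ˢ (Icc (-2 : ℝ) 2 ×ˢ Icc (1 : ℝ) 3) → v p = 0) :
    slabInt η 3 v ≤ 12 * M ^ 2 * δ := by
  set B : Set (ℝ × ℝ × ℝ) := Icc 0 δ ×ˢ (Icc (-2) 2 ×ˢ Icc (0 : ℝ) 3) with hB
  have hBs : B ⊆ slab 3 := prod_mono (fun x hx => hx.1) (prod_mono (subset_univ _) subset_rfl)
  have e1 : slabInt η 3 v = ∫ p in B, Real.exp (-2 * η * p.2.2) * ‖v p‖ ^ 2 := by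
    refine setIntegral_eq_of_subset_of_forall_sdiff_eq_zero ?_ hBs ?_
    · exact measurableSet_Ici.prod (MeasurableSet.univ.prod measurableSet_Icc)
    · rintro p ⟨hp, hpB⟩
      rw [h0 p fun hp' => hpB ⟨⟨hp.1, hp'.1.2⟩, hp'.2.1, hp.2.2⟩]
      simp
  have hvol : volume.real B = 12 * δ := by
    rw [hB, Measure.volume_eq_prod, measureReal_prod_prod, Measure.volume_eq_prod,
      measureReal_prod_prod, Real.volume_real_Icc_of_le hδ,
      Real.volume_real_Icc_of_le (by norm_num), Real.volume_real_Icc_of_le (by norm_num)]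
    ring
  have hBc : IsCompact B := isCompact_Icc.prod (isCompact_Icc.prod isCompact_Icc)
  have e2 := norm_setIntegral_le_of_norm_le_const (μ := volume) (s := B) (C := M ^ 2)
    (f := fun p => Real.exp (-2 * η * p.2.2) * ‖v p‖ ^ 2) hBc.measure_lt_top fun p hp => by
      rw [norm_mul, norm_pow, norm_norm, Real.norm_eq_abs, Real.abs_exp]
      have h1 : Real.exp (-2 * η * p.2.2) ≤ 1 := by
        rw [Real.exp_le_one_iff]
        have := mul_nonneg hη hp.2.2.1
        linarith
      have h2 := pow_le_pow_left₀ (norm_nonneg _) (hM p (hBs hp)) 2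
      exact (mul_le_of_le_one_left (by positivity) h1).trans h2
  rw [e1]
  refine (le_abs_self _).trans (e2.trans (le_of_eq ?_))
  rw [hvol]
  ring

lemma slabInt_pos {η T : ℝ} {v : ℝ × ℝ × ℝ → ℂ} (cv : Continuous v) (hv : HasCompactSupport v)
    {p : ℝ × ℝ × ℝ} (hx : 0 < p.1) (ht : 0 < p.2.2) (htT : p.2.2 < T) (hp : v p ≠ 0) :
    0 < slabInt η T v := by
  have hms : MeasurableSet (slab T) :=
    measurableSet_Ici.prod (MeasurableSet.univ.prod measurableSet_Icc)
  rw [slabInt, setIntegral_pos_iff_support_of_nonneg_ae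
    (Filter.Eventually.of_forall fun p => by positivity) (integrableOn_slab cv hv η T)]
  have hU : IsOpen ({p | v p ≠ 0} ∩ (Ioi 0 ×ˢ (univ ×ˢ Ioo 0 T) : Set (ℝ × ℝ × ℝ))) :=
    (isOpen_ne_fun cv continuous_const).inter (isOpen_Ioi.prod (isOpen_univ.prod isOpen_Ioo))
  refine (hU.measure_pos volume ⟨p, hp, hx, mem_univ _, ht, htT⟩).trans_le (measure_mono ?_)
  rintro q ⟨hq, hq1, -, hq2⟩
  refine ⟨?_, show (0 : ℝ) ≤ q.1 from le_of_lt hq1, mem_univ _, hq2.1.le, hq2.2.le⟩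
  have h1 : 0 < ‖v q‖ := norm_pos_iff.2 hq
  exact (by positivity : 0 < Real.exp (-2 * η * q.2.2) * ‖v q‖ ^ 2).ne'

set_option maxHeartbeats 1000000 in
/-- For `u_x = b u_y` with real `b ≠ 0` the interior estimate fails. -/
theorem unstable_of_ne_zero {b : ℝ} (hb : b ≠ 0) : Unstable (b : ℂ) := by
  intro hest
  set k := b⁻¹ with hk
  set τ := Real.sqrt (1 + k ^ 2) with hτ
  have hτsq : τ ^ 2 = 1 + k ^ 2 := Real.sq_sqrt (by positivity)
  have hτ1 : 1 ≤ τ := by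
    rw [hτ, Real.one_le_sqrt]
    linarith [sq_nonneg k]
  have hτ0 : 0 < τ := by linarith
  obtain ⟨η, κ, hη, hκ, hray⟩ := ray_estimate_of_interiorEstimate hb hest hτ0 hτsq
  -- The sizes fit the time interval [0, 3]: h lives on (1, 3) and τ ≥ 1, so for t ≤ 3 the amplitude
  -- vanishes where x ≥ 3, and ψ is constant for |x| ≤ 3.
  obtain ⟨ψ, sψ, ψ1, ψ0⟩ := exists_smooth_bump 0 (r := 3) (by norm_num)
  obtain ⟨f, sf, f1, f0⟩ := exists_smooth_bump 0 (r := 1) (by norm_num)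
  obtain ⟨h, sh, h1, h0⟩ := exists_smooth_bump 2 (r := 1 / 2) (by norm_num)
  obtain ⟨m, sm, m0, m1, mz⟩ := exists_boundary_profile
  simp only [sub_zero] at ψ1 ψ0 f1 f0
  norm_num at ψ0 f0 h0
  have h0' : ∀ s, s ≤ 1 → h s = 0 := fun s hs => h0 s (by
    rw [abs_of_nonpos (by linarith)]
    linarith)
  have hopen : ∀ c : ℝ, IsOpen {s : ℝ | c < |s|} := fun c => isOpen_lt continuous_const continuous_abs
  have f0' : ∀ y, 2 < |y| → deriv f y = 0 := fun y hy =>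
    deriv_eq_zero_of_eqOn (hopen 2) (fun s hs => f0 s (le_of_lt hs)) hy
  have h0d : ∀ t, t < 1 ∨ 3 < t → deriv h t = 0 := fun t ht =>
    deriv_eq_zero_of_eqOn (U := Iio 1 ∪ Ioi 3) (isOpen_Iio.union isOpen_Ioi) (c := 0)
      (fun s hs => h0 s (by
        rcases hs with hs | hs
        · rw [le_abs]; right; linarith [mem_Iio.1 hs]
        · rw [le_abs]; left; linarith [mem_Ioi.1 hs])) ht
  have m0' : ∀ s, 1 < |s| → deriv m s = 0 := fun s hs =>
    deriv_eq_zero_of_eqOn (hopen 1) (fun s hs => mz s (le_of_lt hs)) hs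
  have ψ' : ∀ x, |x| < 3 → deriv ψ x = 0 := fun x hx =>
    deriv_eq_zero_of_eqOn (U := {s : ℝ | |s| < 3}) (isOpen_lt continuous_abs continuous_const)
      (fun s hs => ψ1 s (le_of_lt hs)) hx
  set a := rayAmplitude ψ f h k τ with ha
  have sa : ContDiff ℝ ∞ (unc a) := contDiff_rayAmplitude sψ sf sh
  have sa1 : ContDiff ℝ 1 (unc a) := sa.of_le (by simp)
  have hac : HasCompactSupport (unc a) := by
    refine HasCompactSupport.intro (K := Icc (-6) 6 ×ˢ (Icc (-(2 + |k| * 6)) (2 + |k| * 6) ×ˢ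
      Icc (-(3 + τ * 6)) (3 + τ * 6)))
      (isCompact_Icc.prod (isCompact_Icc.prod isCompact_Icc)) ?_
    rintro ⟨x, y, t⟩ hp
    simp only [unc, ha, rayAmplitude]
    by_contra hne
    have hne' : ψ x * (f (y - k * x) * h (t - τ * x)) ≠ 0 := by exact_mod_cast hne
    have n1 : |x| < 6 := by
      by_contra hc
      exact left_ne_zero_of_mul hne' (ψ0 x (not_lt.1 hc))
    have n2 : |y - k * x| < 2 := by
      by_contra hc
      exact left_ne_zero_of_mul (right_ne_zero_of_mul hne') (f0 _ (not_lt.1 hc))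
    have n3 : |t - τ * x - 2| < 1 := by
      by_contra hc
      exact right_ne_zero_of_mul (right_ne_zero_of_mul hne') (h0 _ (not_lt.1 hc))
    have n4 : |k * x| ≤ |k| * 6 := by
      rw [abs_mul]
      exact mul_le_mul_of_nonneg_left n1.le (abs_nonneg k)
    have n5 : |τ * x| ≤ τ * 6 := by
      rw [abs_mul, abs_of_pos hτ0]
      exact mul_le_mul_of_nonneg_left n1.le hτ0.le
    rw [abs_lt] at n1 n2 n3
    rw [abs_le] at n4 n5
    exact hp ⟨⟨n1.1.le, n1.2.le⟩, ⟨by linarith [n4.1, n2.1], by linarith [n4.2, n2.2]⟩,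
      by linarith [n5.1, n3.1], by linarith [n5.2, n3.2]⟩
  have sc : ContDiff ℝ ∞ (unc (rayDefect f h b k τ)) := contDiff_rayDefect sf sh
  have sc1 : ContDiff ℝ 1 (unc (rayDefect f h b k τ)) := sc.of_le (by simp)
  obtain ⟨M1, hM1, bm⟩ := exists_bound_of_zero_outside sm.continuous fun s hs => mz s (le_of_lt hs)
  obtain ⟨M2, hM2, bm'⟩ := exists_bound_of_zero_outside (contDiff_deriv sm).continuous m0'
  have hKc : IsCompact (Icc (0 : ℝ) 0 ×ˢ (Icc (-2 : ℝ) 2 ×ˢ Icc (1 : ℝ) 3)) :=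
    isCompact_Icc.prod (isCompact_Icc.prod isCompact_Icc)
  obtain ⟨M3, bc⟩ := hKc.exists_bound_of_continuousOn sc.continuous.continuousOn
  obtain ⟨M4, bct⟩ := hKc.exists_bound_of_continuousOn (continuous_dt sc1).continuousOn
  obtain ⟨M5, bcy⟩ := hKc.exists_bound_of_continuousOn (continuous_dy sc1).continuousOn
  have hmem : ((0, 0, 1) : ℝ × ℝ × ℝ) ∈ Icc (0 : ℝ) 0 ×ˢ (Icc (-2 : ℝ) 2 ×ˢ Icc (1 : ℝ) 3) := by
    norm_num
  have hM3 : 0 ≤ M3 := (norm_nonneg _).trans (bc _ hmem)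
  have hM4 : 0 ≤ M4 := (norm_nonneg _).trans (bct _ hmem)
  have hM5 : 0 ≤ M5 := (norm_nonneg _).trans (bcy _ hmem)
  -- The corrected amplitude a + l is admissible and its ray derivative on the slab is that of the
  -- layer l alone; both l and this derivative have squared norm O(δ).
  have main : ∀ δ : ℝ, 0 < δ → δ ≤ 1 → slabInt η 3 (unc a) ≤
      (2 * κ * (12 * (τ * (M1 * M4) + M2 * M3 + |k| * (M1 * M5)) ^ 2) +
        2 * (12 * (M1 * M3) ^ 2)) * δ := by
    intro δ hδ hδ1
    set l := layer m f h b k τ δ with hl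
    have sl : ContDiff ℝ ∞ (unc l) := contDiff_layer sm sf sh
    have sl1 : ContDiff ℝ 1 (unc l) := sl.of_le (by simp)
    have lz : ∀ p : ℝ × ℝ × ℝ, p ∉ Icc (-δ) δ ×ˢ (Icc (-2 : ℝ) 2 ×ˢ Icc (1 : ℝ) 3) →
        unc l p = 0 := by
      rintro ⟨x, y, t⟩ hp
      simp only [unc, hl, layer]
      by_cases hx : |x| ≤ δ
      · have : rayDefect f h b k τ x y t = 0 := by
          by_cases hy : |y| ≤ 2
          · have ht : t < 1 ∨ 3 < t := by
              by_contra hc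
              rw [not_or, not_lt, not_lt] at hc
              exact hp ⟨abs_le.1 hx, abs_le.1 hy, hc⟩
            have : h t = 0 := h0 t (by
              rcases ht with ht | ht
              · rw [le_abs]; right; linarith
              · rw [le_abs]; left; linarith)
            simp [rayDefect, this, h0d t ht]
          · rw [not_le] at hy
            simp [rayDefect, f0 y hy.le, f0' y hy]
        rw [this, mul_zero]
      · have : m (x / δ) = 0 := mz _ (by
          rw [abs_div, abs_of_pos hδ, le_div_iff₀ hδ]
          linarith [not_le.1 hx])
        simp [this]
    have hKl : IsCompact (Icc (-δ) δ ×ˢ (Icc (-2 : ℝ) 2 ×ˢ Icc (1 : ℝ) 3)) :=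
      isCompact_Icc.prod (isCompact_Icc.prod isCompact_Icc)
    have hlc : HasCompactSupport (unc l) := HasCompactSupport.intro hKl lz
    have hts : tsupport (unc l) ⊆ Icc (-δ) δ ×ˢ (Icc (-2 : ℝ) 2 ×ˢ Icc (1 : ℝ) 3) :=
      closure_minimal (fun p hp => by
        by_contra hc
        exact hp (lz p hc)) hKl.isClosed
    set A : ℝ → ℝ → ℝ → ℂ := fun x y t => a x y t + 1 * l x y t with hA
    have sA : ContDiff ℝ ∞ (unc A) := contDiff_add_mul sa sl 1
    have hAc : HasCompactSupport (unc A) := hac.add (hlc.mul_left (f := fun _ => (1 : ℂ)))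
    have Az : ∀ x y t : ℝ, 0 ≤ x → t < 1 → A x y t = 0 := by
      intro x y t hx ht
      have e1 : h (t - τ * x) = 0 := h0' _ (by have := mul_nonneg hτ0.le hx; linarith)
      have e2 : l x y t = 0 := lz (x, y, t) fun hp => by linarith [hp.2.2.1]
      simp [hA, e2, ha, rayAmplitude, e1]
    have key := hray 3 (by norm_num) A sA hAc (fun x y hx => Az x y 0 hx one_pos)
      (fun x y hx => by
        have : (fun t => A x y t) =ᶠ[nhds 0] fun _ => 0 := by
          filter_upwards [gt_mem_nhds one_pos] with t ht using Az x y t hx ht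
        rw [dt, this.deriv_eq]
        simp)
      -- At x = 0 the layer vanishes and its x-derivative equals b a_y - a_x, since m(0) = 0 and
      -- m'(0) = 1.
      (fun y t _ => by
        rw [hA, dx_add_mul sa1 sl1, dy_add_mul sa1 sl1, ha, hl, dx_rayAmplitude sψ sf sh,
          dy_rayAmplitude sf, dx_layer hδ.ne' sm, dy_layer sf sh]
        simp only [zero_div, m0, m1, ψ1 0 (by norm_num), ψ' 0 (by norm_num), rayDefect, mul_zero,
          sub_zero]
        push_cast
        ring)
    have hrayA : slabInt η 3 (unc (rayOp k τ A)) = slabInt η 3 (unc (rayOp k τ l)) := by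
      refine setIntegral_congr_fun
        (measurableSet_Ici.prod (MeasurableSet.univ.prod measurableSet_Icc)) ?_
      rintro ⟨x, y, t⟩ ⟨hx, -, ht⟩
      have hx : 0 ≤ x := hx
      have e1 : rayOp k τ A x y t = rayOp k τ a x y t + rayOp k τ l x y t := by
        simp only [rayOp, hA, dx_add_mul sa1 sl1, dy_add_mul sa1 sl1, dt_add_mul sa1 sl1]
        ring
      have e2 : rayOp k τ a x y t = 0 := by
        rw [ha, rayOp_rayAmplitude sψ sf sh]
        by_cases hx3 : x < 3
        · simp [ψ' x (by rwa [abs_of_nonneg hx])]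
        · have : x ≤ τ * x := le_mul_of_one_le_left hx hτ1
          have : h (t - τ * x) = 0 := h0' _ (by linarith [ht.2, not_lt.1 hx3])
          simp [this]
      simp only [unc, e1, e2, zero_add]
    have hm : ∀ x, ‖((δ * m (x / δ) : ℝ) : ℂ)‖ ≤ M1 := fun x => by
      rw [Complex.norm_real, Real.norm_eq_abs, abs_mul, abs_of_pos hδ]
      exact (mul_le_of_le_one_left (abs_nonneg _) hδ1).trans (bm _)
    have bl : slabInt η 3 (unc l) ≤ 12 * (M1 * M3) ^ 2 * δ := by
      refine slabInt_le_of_support hη hδ.le ?_ lz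
      rintro ⟨x, y, t⟩ -
      by_cases hp : (x, y, t) ∈ Icc (-δ) δ ×ˢ (Icc (-2 : ℝ) 2 ×ˢ Icc (1 : ℝ) 3)
      · simp only [unc, hl, layer]
        rw [norm_mul]
        exact mul_le_mul (hm x) (bc (0, y, t) ⟨by simp, hp.2⟩) (norm_nonneg _) hM1
      · rw [lz _ hp, norm_zero]
        positivity
    -- The x-derivative of the layer is bounded but not small as δ → 0; the smallness comes from the
    -- width of the support alone.
    have br : slabInt η 3 (unc (rayOp k τ l)) ≤
        12 * (τ * (M1 * M4) + M2 * M3 + |k| * (M1 * M5)) ^ 2 * δ := by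
      have rz : ∀ p : ℝ × ℝ × ℝ, p ∉ Icc (-δ) δ ×ˢ (Icc (-2 : ℝ) 2 ×ˢ Icc (1 : ℝ) 3) →
          unc (rayOp k τ l) p = 0 := fun p hp =>
        rayOp_eq_zero_of_notMem_tsupport sl1 fun h => hp (hts h)
      refine slabInt_le_of_support hη hδ.le ?_ rz
      rintro ⟨x, y, t⟩ -
      by_cases hp : (x, y, t) ∈ Icc (-δ) δ ×ˢ (Icc (-2 : ℝ) 2 ×ˢ Icc (1 : ℝ) 3)
      · have hq : ((0, y, t) : ℝ × ℝ × ℝ) ∈ Icc (0 : ℝ) 0 ×ˢ (Icc (-2 : ℝ) 2 ×ˢ Icc (1 : ℝ) 3) :=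
          ⟨by simp, hp.2⟩
        simp only [unc, rayOp]
        rw [hl, dt_layer sf sh, dx_layer hδ.ne' sm, dy_layer sf sh]
        refine (norm_add_le _ _).trans (add_le_add ((norm_add_le _ _).trans
          (add_le_add ?_ ?_)) ?_)
        · rw [norm_mul, norm_mul, Complex.norm_real, Real.norm_eq_abs, abs_of_pos hτ0]
          exact mul_le_mul_of_nonneg_left (mul_le_mul (hm x) (bct _ hq) (norm_nonneg _) hM1) hτ0.le
        · rw [norm_mul, Complex.norm_real]
          exact mul_le_mul (bm' _) (bc _ hq) (norm_nonneg _) hM2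
        · rw [norm_mul, norm_mul, Complex.norm_real, Real.norm_eq_abs]
          exact mul_le_mul_of_nonneg_left (mul_le_mul (hm x) (bcy _ hq) (norm_nonneg _) hM1)
            (abs_nonneg k)
      · rw [rz _ hp, norm_zero]
        positivity
    have e3 : slabInt η 3 (unc a) ≤ 2 * slabInt η 3 (unc A) + 2 * slabInt η 3 (unc l) := by
      refine slabInt_le_add sa.continuous hac sA.continuous hAc sl.continuous hlc fun p => ?_
      have := norm_add_sq_le (unc A p) (-unc l p)
      rw [norm_neg] at this
      refine le_trans (le_of_eq ?_) this
      simp only [hA, unc]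
      congr 2
      ring
    rw [hrayA] at key
    have e4 := mul_le_mul_of_nonneg_left br hκ
    linarith
  have pos : 0 < slabInt η 3 (unc a) := by
    have hx : 0 < 1 / (2 * τ) := by positivity
    have hτx : τ * (1 / (2 * τ)) = 1 / 2 := by field_simp
    -- The point lies on the ray issuing from (0, 0, 2), far enough to have x > 0, at time 5/2 < 3;
    -- all three factors equal one there.
    refine slabInt_pos sa.continuous hac
      (p := (1 / (2 * τ), k * (1 / (2 * τ)), 2 + τ * (1 / (2 * τ)))) hx
      (by rw [hτx]; norm_num) (by rw [hτx]; norm_num) ?_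
    have hx3 : |1 / (2 * τ)| ≤ 3 := by
      rw [abs_of_pos hx, div_le_iff₀ (by positivity)]
      linarith
    simp only [unc, ha, rayAmplitude]
    rw [ψ1 _ hx3, f1 _ (by simp), h1 _ (by simp)]
    simp
  set D := 2 * κ * (12 * (τ * (M1 * M4) + M2 * M3 + |k| * (M1 * M5)) ^ 2) +
        2 * (12 * (M1 * M3) ^ 2) with hD
  have hD0 : 0 ≤ D := by positivity
  set s := slabInt η 3 (unc a) with hs
  -- For this δ ≤ 1 the bound s ≤ Dδ forces s(D + s + 1) ≤ Ds, impossible for s > 0.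
  have hd : 0 < s / (D + s + 1) := by positivity
  have hfin := main (s / (D + s + 1)) hd (by
    rw [div_le_one (by positivity)]
    linarith)
  rw [mul_div_assoc', le_div_iff₀ (by positivity)] at hfin
  nlinarith

end HalfPlaneWave

/-- The boundary condition is `u_x = β u_y + g` with `β = i b`, `β = 0` and `β = b` respectively. -/
theorem mainTheorem1 :
    (∀ b : ℝ, b ≠ 0 → |b| < 1 → HalfPlaneWave.Stable (Complex.I * (b : ℂ))) ∧
    HalfPlaneWave.Stable 0 ∧
    (∀ b : ℝ, b ≠ 0 → HalfPlaneWave.Unstable (b : ℂ)) := by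
  refine ⟨fun b _ hb => HalfPlaneWave.stable_of_abs_lt_one hb, ?_,
    fun b hb => HalfPlaneWave.unstable_of_ne_zero hb⟩
  -- Condition 3) is the member b = 0 of the family u_x = ib u_y + g, for which the estimates were
  -- proved without excluding b = 0.
  have h := HalfPlaneWave.stable_of_abs_lt_one (b := 0) (by norm_num)
  rwa [Complex.ofReal_zero, mul_zero] at h
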